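/- **Setting.** Let $\lambda_n\in\mathbb C\setminus\{0\}$ and $0<a_n<b_n$ for $n\ge 1$. Put $E_\lambda(z)=\lambda e^z$, $\Delta_n=\log\frac{b_n}{a_n}$, and $$I=\{z\in\mathbb C:\ a_n\le |E_{\lambda_n}\circ\cdots\circ E_{\lambda_1}(z)|\le b_n\ \text{for all sufficiently large } n\}.$$ Let $\dim_H$ and $\dim_P$ denote the Hausdorff and the packing dimension, and $\log^+=\max(\log,0)$. **Statement.** For all $0<q<1$ and $\Delta>0$ there is a constant $a$, depending only on $q$ and $\Delta$, such that the following holds for all sequences $(\lambda_n)$, $(a_n)$, $(b_n)$ as above that satisfy * (a) $a_{n+1}\le|\lambda_{n+1}|e^{qa_n}$ and $b_{n+1}\ge|\lambda_{n+1}|e^{-qa_n}$ for all sufficiently large $n$; * (b) $(a_1\cdots a_n)^{1/n}\to\infty$ as $n\to\infty$; * (c) $\Delta_n>\Delta$ for all $n\ge 1$; * (d) $\liminf_{n\to\infty}a_n>a$. We have $$1\le\dim_H I\le 1+\liminf_{n\to\infty}\frac{\log(\Delta_1\cdots\Delta_n)}{\log(a_1\cdots a_{n-1})+\log^+(a_n/\Delta_{n+1})},$$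 $$1\le\dim_P I\le 1+\limsup_{n\to\infty}\frac{\log(\Delta_1\cdots\Delta_{n+1})}{\log(a_1\cdots a_n)}.$$ If, additionally, $\sup_{n\ge1}\frac{\Delta_{n+1}}{a_n}<\infty$, then $$\dim_H I=1,\qquad \dim_P I\ge 1+\limsup_{n\to\infty}\frac{\log(\Delta_1\cdots\Delta_{n+1})}{\log(b_1\cdots b_n)}.$$ (The upper and lower limits are taken in $[-\infty,\infty]$.) -/

import Mathlib

open Filter Topology MeasureTheory
open scoped NNReal ENNReal

noncomputable section

namespace ExpIter

/-! ## Packing measures and packing dimension -/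

/-- A finite `δ`-packing of `E`: finitely many (centre, radius) pairs, with centres in `E`, radii in
`(0, δ]` and pairwise disjoint closed balls. -/
def IsPacking {X : Type*} [MetricSpace X] (E : Set X) (δ : ℝ) (P : Finset (X × ℝ)) : Prop :=
  (∀ p ∈ P, p.1 ∈ E ∧ 0 < p.2 ∧ p.2 ≤ δ) ∧
    (P : Set (X × ℝ)).PairwiseDisjoint (fun p => Metric.closedBall p.1 p.2)

/-- The supremum of `∑ (2 r_i) ^ s` over the `δ`-packings of `E` by balls of radii `r_i`
(in the plane, `2 r_i` is the diameter of the ball). The supremum over countable packings is the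
same, as the sums have nonnegative terms. -/
def packingSup {X : Type*} [MetricSpace X] (s δ : ℝ) (E : Set X) : ℝ≥0∞ :=
  ⨆ (P : Finset (X × ℝ)) (_ : IsPacking E δ P), ∑ p ∈ P, ENNReal.ofReal (2 * p.2) ^ s

/-- The `s`-dimensional packing premeasure: the limit of `packingSup s δ E` as `δ` decreases
to `0`, which is an infimum by monotonicity in `δ`. -/
def packingPremeasure {X : Type*} [MetricSpace X] (s : ℝ) (E : Set X) : ℝ≥0∞ :=
  ⨅ (δ : ℝ) (_ : 0 < δ), packingSup s δ E

/-- The `s`-dimensional packing (outer) measure. -/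
def packingMeasure {X : Type*} [MetricSpace X] (s : ℝ) (E : Set X) : ℝ≥0∞ :=
  ⨅ (F : ℕ → Set X) (_ : E ⊆ ⋃ i, F i), ∑' i, packingPremeasure s (F i)

/-- The packing dimension `sup {s ≥ 0 : P^s(E) = ∞}`; same pattern as Mathlib's `dimH`. -/
def dimP {X : Type*} [MetricSpace X] (E : Set X) : ℝ≥0∞ :=
  ⨆ (s : ℝ≥0) (_ : packingMeasure (s : ℝ) E = ∞), (s : ℝ≥0∞)

/-! ## Non-autonomous exponential iteration

All sequences are indexed by `n ≥ 1`; their value at `0` is irrelevant. -/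

/-- `iter lam n = E_{lam n} ∘ ⋯ ∘ E_{lam 1}`, where `E_c z = c * exp z`. -/
def iter (lam : ℕ → ℂ) : ℕ → ℂ → ℂ
  | 0, z => z
  | n + 1, z => lam (n + 1) * Complex.exp (iter lam n z)

/-- The set of points with `a n ≤ |E_{lam n} ∘ ⋯ ∘ E_{lam 1} (z)| ≤ b n` for all large `n`. -/
def rateSet (lam : ℕ → ℂ) (a b : ℕ → ℝ) : Set ℂ :=
  {z | ∀ᶠ n in atTop, a n ≤ ‖iter lam n z‖ ∧ ‖iter lam n z‖ ≤ b n}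

/-- The modulus `Δ_n = log (b_n / a_n)` of the `n`-th annulus. -/
def modulus (a b : ℕ → ℝ) (n : ℕ) : ℝ := Real.log (b n / a n)

/-- Admissibility of the sequences `a`, `b` with constant `q`. -/
def Admissible (q : ℝ) (lam : ℕ → ℂ) (a b : ℕ → ℝ) : Prop :=
  ∀ᶠ n in atTop, a (n + 1) ≤ ‖lam (n + 1)‖ * Real.exp (q * a n) ∧
    ‖lam (n + 1)‖ * Real.exp (-(q * a n)) ≤ b (n + 1)

/-- The standing setting (`lam_n ≠ 0`, `0 < a_n < b_n`) together with the general assumptions on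
the sequences, for given constants `q`, `Δ` and `A`. -/
structure Assumptions (q Δ A : ℝ) (lam : ℕ → ℂ) (a b : ℕ → ℝ) : Prop where
  lam_ne_zero : ∀ n, 1 ≤ n → lam n ≠ 0
  a_pos : ∀ n, 1 ≤ n → 0 < a n
  a_lt_b : ∀ n, 1 ≤ n → a n < b n
  admissible : Admissible q lam a b
  geom_mean : Tendsto (fun n : ℕ => (∏ i ∈ Finset.Icc 1 n, a i) ^ (1 / (n : ℝ))) atTop atTop
  modulus_gt : ∀ n, 1 ≤ n → Δ < modulus a b n
  liminf_gt : (A : EReal) < liminf (fun n => (a n : EReal)) atTop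

end ExpIter

end

namespace ExpIter

/-! ### Packing measures: exponent comparison, bounds from covers and from mass distributions. -/

section Packing
variable {X : Type*} [MetricSpace X]

/-! Write `F_n` for the `n`-th iterate. Its derivative has modulus `|F_1 ⋯ F_n|`, and the condition
on `|F_(n+1)|` confines `F_n` to a vertical strip of width `Δ_(n+1)`. While two orbits stay close,
each step expands distances by its derivative up to a factor 2. Distortion and counting thus cost
factors `C ^ n`, and (b) makes these negligible against every positive power of `a_1 ⋯ a_n`.

Upper bounds. Up to a countable union, the constraints hold for all `n ≥ 1` and the starting point
is bounded. Cut the set into cells on which the first `n` iterates vary by at most 1/2, the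
derivative is at least `d` and the next modulus is about `x`. The image of a cell splits into
squares of side 1/4, about `x` rows and about `4Δ + 1` columns. If the finer cells have mass at most
a multiple of `d ^ (-s) * x ^ (-γ)` with `γ > 0`, the sum over the columns is geometric, so the
width of the strip disappears (`exists_measure_le_of_cellBound`). Only one step with `γ = 0` costs a
factor `Δ + 1` (`exists_cellBound_of_succ_zero`). For the Hausdorff dimension the mass is a
Hausdorff content. Covering a cell by itself pays that factor once; cutting its image into squares
of side `Δ_(n+1)` avoids it when `Δ_(n+1)` is at most a multiple of `a_n`. As one good level at each
scale suffices, a lower limit appears. For the packing dimension the mass consists of weighted point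
masses at the centres of a packing, sorted by the level at which the balls reach unit size; all
levels are summed, so an upper limit appears. Since every `Δ_k` exceeds `Δ`, a bound on `Δ_1 ⋯ Δ_n`
also controls the last factor up to `C ^ n`.

Lower bounds. Condition (a) leaves room for strips of width `min(Δ_(n+1), (1 - q) a_n)` such that
the image of a box of height `2π` in one strip is an annulus crossing the next, where many separated
boxes fit. Sharing mass equally among these children yields `ν` with `ν(B) ≤ C ^ m * r / (w_1 ⋯
w_m)` for sets of diameter at most `r`, where `m` is the level of scale `r`
(`IsStripSystem.volume_le`). Widths bounded below give dimension at least 1 by the mass distribution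
principle. At scales near `1 / (b_1 ⋯ b_n)` all the first `n` widths enter the denominator; with
`Δ_(n+1) / a_n` bounded they are comparable to the moduli, which gives the packing bound through
`le_mul_packingMeasure`. -/

theorem packingSup_mono_radius {s δ δ' : ℝ} (h : δ ≤ δ') (E : Set X) :
    packingSup s δ E ≤ packingSup s δ' E := by
  refine iSup₂_le fun P hP => ?_
  exact le_iSup₂_of_le P ⟨fun p hp => ⟨(hP.1 p hp).1, (hP.1 p hp).2.1, (hP.1 p hp).2.2.trans h⟩,
    hP.2⟩ le_rfl

theorem packingSup_le_mul {s s' δ : ℝ} (h : s' ≤ s) (E : Set X) :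
    packingSup s δ E ≤ ENNReal.ofReal (2 * δ) ^ (s - s') * packingSup s' δ E := by
  refine iSup₂_le fun P hP => ?_
  calc ∑ p ∈ P, ENNReal.ofReal (2 * p.2) ^ s
      ≤ ∑ p ∈ P, ENNReal.ofReal (2 * δ) ^ (s - s') * ENNReal.ofReal (2 * p.2) ^ s' := by
        refine Finset.sum_le_sum fun p hp => ?_
        have hr := hP.1 p hp
        have h0 : ENNReal.ofReal (2 * p.2) ≠ 0 := by
          simpa using hr.2.1
        have : ENNReal.ofReal (2 * p.2) ^ s
            = ENNReal.ofReal (2 * p.2) ^ (s - s') * ENNReal.ofReal (2 * p.2) ^ s' := by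
          rw [← ENNReal.rpow_add _ _ h0 ENNReal.ofReal_ne_top]; simp
        rw [this]
        gcongr
        exact hr.2.2
    _ = ENNReal.ofReal (2 * δ) ^ (s - s') * ∑ p ∈ P, ENNReal.ofReal (2 * p.2) ^ s' := by
        rw [Finset.mul_sum]
    _ ≤ _ := by
        gcongr
        exact le_iSup₂_of_le P hP le_rfl

/-- Raising the exponent gains `(2 * δ) ^ (s - s')`, which tends to 0, while the sums with exponent
`s'` stay bounded by a finite value at one fixed scale. -/
theorem packingPremeasure_eq_zero {s s' : ℝ} (h : s' < s) {E : Set X}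
    (hE : packingPremeasure s' E ≠ ∞) : packingPremeasure s E = 0 := by
  obtain ⟨δ₀, hδ⟩ := iInf_lt_iff.1 (lt_top_iff_ne_top.2 hE)
  obtain ⟨hδ₀, hlt⟩ := iInf_lt_iff.1 hδ
  have key : ∀ᶠ δ in 𝓝[>] (0 : ℝ), packingPremeasure s E ≤
      ENNReal.ofReal (2 * δ) ^ (s - s') * packingSup s' δ₀ E := by
    filter_upwards [Ioo_mem_nhdsGT hδ₀] with δ hδ
    calc packingPremeasure s E ≤ packingSup s δ E := iInf₂_le δ hδ.1
      _ ≤ _ := packingSup_le_mul h.le E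
      _ ≤ _ := by gcongr; exact packingSup_mono_radius hδ.2.le E
  have lim : Tendsto (fun δ : ℝ => ENNReal.ofReal (2 * δ) ^ (s - s') * packingSup s' δ₀ E)
      (𝓝[>] 0) (𝓝 0) := by
    have h1 : Tendsto (fun δ : ℝ => ENNReal.ofReal (2 * δ) ^ (s - s')) (𝓝[>] 0) (𝓝 0) := by
      have : ContinuousAt (fun δ : ℝ => ENNReal.ofReal (2 * δ) ^ (s - s')) 0 := by
        have := (ENNReal.continuous_rpow_const (y := s - s')).comp
          (ENNReal.continuous_ofReal.comp (continuous_const_mul (2 : ℝ)))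
        exact this.continuousAt
      have h2 := this.tendsto
      simp only [mul_zero, ENNReal.ofReal_zero, ENNReal.zero_rpow_of_pos (sub_pos.2 h)] at h2
      exact h2.mono_left nhdsWithin_le_nhds
    have := ENNReal.Tendsto.mul_const (b := packingSup s' δ₀ E) h1 (Or.inr hlt.ne)
    simpa using this
  exact le_antisymm (ge_of_tendsto lim key) zero_le

theorem packingMeasure_eq_zero {s s' : ℝ} (h : s' < s) {E : Set X}
    (hE : packingMeasure s' E ≠ ∞) : packingMeasure s E = 0 := by
  obtain ⟨F, hF⟩ := iInf_lt_iff.1 (lt_top_iff_ne_top.2 hE)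
  obtain ⟨hEF, hlt⟩ := iInf_lt_iff.1 hF
  have h0 : ∀ i, packingPremeasure s (F i) = 0 := fun i =>
    packingPremeasure_eq_zero h (ENNReal.ne_top_of_tsum_ne_top hlt.ne i)
  refine le_antisymm (iInf₂_le_of_le F hEF ?_) zero_le
  simp [h0]

theorem le_dimP_of_packingMeasure_ne_zero {s : ℝ} {E : Set X}
    (hE : packingMeasure s E ≠ 0) : ENNReal.ofReal s ≤ dimP E := by
  refine le_of_forall_lt fun c hc => ?_
  obtain ⟨c', hcc', hc's⟩ := exists_between hc
  lift c' to ℝ≥0 using hc's.ne_top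
  refine hcc'.trans_le ?_
  have hlt : (c' : ℝ) < s := by
    have := (ENNReal.lt_ofReal_iff_toReal_lt ENNReal.coe_ne_top).1 hc's
    simpa using this
  have : packingMeasure (c' : ℝ) E = ∞ := by
    by_contra h
    exact hE (packingMeasure_eq_zero hlt h)
  exact le_iSup₂_of_le c' this le_rfl

theorem dimP_le_of_packingPremeasure_ne_top {ι : Type*} [Countable ι] [Nonempty ι] {s : ℝ}
    {E : Set X} {F : ι → Set X} (hEF : E ⊆ ⋃ i, F i)
    (hF : ∀ i, packingPremeasure s (F i) ≠ ∞) : dimP E ≤ ENNReal.ofReal s := by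
  refine iSup₂_le fun c hc => ?_
  by_contra hlt
  push Not at hlt
  have hsc : s < c := by
    by_contra hcs
    refine hlt.not_ge ?_
    rw [← ENNReal.ofReal_coe_nnreal]
    exact ENNReal.ofReal_le_ofReal (not_lt.1 hcs)
  obtain ⟨f, hf⟩ := exists_surjective_nat ι
  have : packingMeasure (c : ℝ) E ≤ 0 := by
    refine iInf₂_le_of_le (fun n => F (f n)) ?_ ?_
    · rwa [hf.iUnion_comp F]
    · simp [fun n => packingPremeasure_eq_zero hsc (hF (f n))]
  simp [hc] at this

/-- If an outer measure gives small mass to all sets of diameter comparable to `r`, for a sequence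
of radii `r` tending to `0`, then it is controlled by the packing measure. -/
theorem le_mul_packingMeasure {s K : ℝ} (hK : 0 < K) (ν : OuterMeasure X)
    (h : ∀ δ > 0, ∃ r, 0 < r ∧ r ≤ δ ∧ ∀ B : Set X, (∀ x ∈ B, ∀ y ∈ B, dist x y ≤ 4 * r) →
      ν B ≤ ENNReal.ofReal K * ENNReal.ofReal (2 * r) ^ s) (E : Set X) :
    ν E ≤ ENNReal.ofReal K * packingMeasure s E := by
  have hK0 : ENNReal.ofReal K ≠ 0 := by simpa using hK
  have key : ∀ F : Set X, ν F ≤ ENNReal.ofReal K * packingPremeasure s F := by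
    intro F
    rw [packingPremeasure, ENNReal.mul_iInf_of_ne hK0 ENNReal.ofReal_ne_top]
    refine le_iInf fun δ => ?_
    rw [ENNReal.mul_iInf_of_ne hK0 ENNReal.ofReal_ne_top]
    refine le_iInf fun hδ => ?_
    obtain ⟨r, hr, hrδ, hB⟩ := h δ hδ
    have hpack : ∀ P : Finset X, (P : Set X) ⊆ F → (P : Set X).Pairwise (fun x y => 2 * r < dist x y) →
        P.card * ENNReal.ofReal (2 * r) ^ s ≤ packingSup s δ F := by
      classical
      intro P hPF hsep
      refine le_iSup₂_of_le (P.image fun x => (x, r)) ⟨?_, ?_⟩ ?_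
      · intro p hp
        obtain ⟨x, hx, rfl⟩ := Finset.mem_image.1 hp
        exact ⟨hPF hx, hr, hrδ⟩
      · intro p hp q hq hpq
        obtain ⟨x, hx, rfl⟩ := Finset.mem_image.1 (Finset.mem_coe.1 hp)
        obtain ⟨y, hy, rfl⟩ := Finset.mem_image.1 (Finset.mem_coe.1 hq)
        have hxy : x ≠ y := fun h => hpq (by rw [h])
        refine Metric.closedBall_disjoint_closedBall ?_
        have := hsep hx hy hxy
        simp only
        linarith
      · rw [Finset.sum_image (by intro x _ y _ hxy; exact (Prod.mk.inj hxy).1)]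
        simp
    -- Balls of radius `r` around a maximal separated set are disjoint, and by maximality the balls
    -- of radius `2 * r` cover `F`. This is why the hypothesis tests sets of diameter `4 * r`.
    obtain ⟨S, hS⟩ := zorn_subset {S : Set X | S ⊆ F ∧ S.Pairwise (fun x y => 2 * r < dist x y)} (by
      intro c hc hchain
      refine ⟨⋃₀ c, ⟨Set.sUnion_subset fun t ht => (hc ht).1, ?_⟩, fun t ht => Set.subset_sUnion_of_mem ht⟩
      exact (Set.pairwise_sUnion hchain.directedOn).2 fun t ht => (hc ht).2)
    have hcov : F ⊆ ⋃ x ∈ S, F ∩ Metric.closedBall x (2 * r) := by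
      intro y hy
      by_contra hcon
      simp only [Set.mem_iUnion, Set.mem_inter_iff, Metric.mem_closedBall, not_exists, not_and,
        not_le] at hcon
      have h1 : insert y S ∈ {S : Set X | S ⊆ F ∧ S.Pairwise (fun x y => 2 * r < dist x y)} := by
        refine ⟨Set.insert_subset hy hS.prop.1, ?_⟩
        refine hS.prop.2.insert fun x hx _ => ⟨hcon x hx hy, ?_⟩
        rw [dist_comm]; exact hcon x hx hy
      have hyS : y ∈ S := hS.le_of_ge h1 (Set.subset_insert y S) (Set.mem_insert y S)
      have := hcon y hyS hy
      rw [dist_self] at this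
      linarith
    rcases S.finite_or_infinite with hfin | hinf
    · calc ν F ≤ ν (⋃ x ∈ hfin.toFinset, F ∩ Metric.closedBall x (2 * r)) := by
            refine ν.mono ?_
            simpa using hcov
        _ ≤ ∑ x ∈ hfin.toFinset, ν (F ∩ Metric.closedBall x (2 * r)) :=
            measure_biUnion_finset_le _ _
        _ ≤ ∑ x ∈ hfin.toFinset, ENNReal.ofReal K * ENNReal.ofReal (2 * r) ^ s := by
            refine Finset.sum_le_sum fun x _ => hB _ fun y hy z hz => ?_
            have h1 := hy.2; have h2 := hz.2
            rw [Metric.mem_closedBall] at h1 h2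
            linarith [dist_triangle_right y z x]
        _ = ENNReal.ofReal K * (hfin.toFinset.card * ENNReal.ofReal (2 * r) ^ s) := by
            rw [Finset.sum_const, nsmul_eq_mul]; ring
        _ ≤ _ := by
            gcongr
            refine hpack _ ?_ ?_
            · simpa using hS.prop.1
            · simpa using hS.prop.2
    -- Infinitely many separated centres give packings with arbitrarily many equal positive terms.
    · have htop : packingSup s δ F = ∞ := by
        refine ENNReal.eq_top_of_forall_nnreal_le fun c => ?_
        have hpos : ENNReal.ofReal (2 * r) ^ s ≠ 0 := by
          refine (ENNReal.rpow_pos ?_ ENNReal.ofReal_ne_top).ne'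
          simpa using hr
        obtain ⟨n, hn⟩ := ENNReal.exists_nat_mul_gt hpos (ENNReal.coe_ne_top (r := c))
        obtain ⟨P, hPS, hPn⟩ := hinf.exists_subset_card_eq n
        refine hn.le.trans ?_
        rw [← hPn]
        exact hpack P (hPS.trans hS.prop.1) (hS.prop.2.mono hPS)
      rw [htop, ENNReal.mul_top hK0]
      exact le_top
  rw [packingMeasure, ENNReal.mul_iInf_of_ne hK0 ENNReal.ofReal_ne_top]
  refine le_iInf fun F => ?_
  rw [ENNReal.mul_iInf_of_ne hK0 ENNReal.ofReal_ne_top]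
  refine le_iInf fun hF => ?_
  calc ν E ≤ ν (⋃ i, F i) := ν.mono hF
    _ ≤ ∑' i, ν (F i) := measure_iUnion_le F
    _ ≤ ∑' i, ENNReal.ofReal K * packingPremeasure s (F i) := ENNReal.tsum_le_tsum fun i => key _
    _ = _ := ENNReal.tsum_mul_left

theorem packingMeasure_mono {s : ℝ} {E F : Set X} (h : E ⊆ F) :
    packingMeasure s E ≤ packingMeasure s F :=
  le_iInf₂ fun G hG => iInf₂_le G (h.trans hG)

theorem dimP_mono {E F : Set X} (h : E ⊆ F) : dimP E ≤ dimP F :=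
  iSup₂_le fun s hs => le_iSup₂_of_le s (top_le_iff.1 (hs ▸ packingMeasure_mono h)) le_rfl

end Packing

/-! ### Expansion and distortion of iterated exponentials. -/

section Growth

/-- The modulus of the derivative of `iter lam n` at `z`. -/
noncomputable def derivNorm (lam : ℕ → ℂ) (n : ℕ) (z : ℂ) : ℝ := ∏ k ∈ Finset.range n, ‖iter lam (k + 1) z‖

variable {lam : ℕ → ℂ}

@[simp] theorem derivNorm_zero (z : ℂ) : derivNorm lam 0 z = 1 := by simp [derivNorm]

theorem derivNorm_succ (n : ℕ) (z : ℂ) :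
    derivNorm lam (n + 1) z = derivNorm lam n z * ‖iter lam (n + 1) z‖ := by
  simp [derivNorm, Finset.prod_range_succ]

theorem derivNorm_nonneg (n : ℕ) (z : ℂ) : 0 ≤ derivNorm lam n z :=
  Finset.prod_nonneg fun _ _ => norm_nonneg _

theorem norm_iter_succ (n : ℕ) (z : ℂ) :
    ‖iter lam (n + 1) z‖ = ‖lam (n + 1)‖ * Real.exp (iter lam n z).re := by
  simp [iter, Complex.norm_exp]

theorem norm_exp_sub_exp (u v : ℂ) :
    ‖Complex.exp u - Complex.exp v‖ = ‖Complex.exp v‖ * ‖Complex.exp (u - v) - 1‖ := by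
  rw [← norm_mul, mul_sub, ← Complex.exp_add]; simp

theorem norm_iter_succ_sub (n : ℕ) (z w : ℂ) :
    ‖iter lam (n + 1) z - iter lam (n + 1) w‖ =
      ‖iter lam (n + 1) w‖ * ‖Complex.exp (iter lam n z - iter lam n w) - 1‖ := by
  simp only [iter]
  rw [← mul_sub, norm_mul, norm_exp_sub_exp, norm_mul, mul_assoc]

theorem half_norm_le_norm_exp_sub_one {h : ℂ} (hh : ‖h‖ ≤ 1 / 2) :
    ‖h‖ / 2 ≤ ‖Complex.exp h - 1‖ := by
  have h1 := Complex.norm_exp_sub_one_sub_id_le (x := h) (by linarith)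
  have h2 : ‖h‖ ≤ ‖Complex.exp h - 1‖ + ‖Complex.exp h - 1 - h‖ := by
    have := norm_sub_le (Complex.exp h - 1) (Complex.exp h - 1 - h)
    simpa using this
  nlinarith [norm_nonneg h]

/-- For `‖h‖ ≤ 1 / 2` one has `‖exp h - 1‖ ≥ ‖h‖ / 2`, so each step loses at most a factor 2. Only
the iterates before order `n` must be close; those of order `n` may be far apart. -/
theorem derivNorm_mul_norm_sub_le {n : ℕ} {z w : ℂ}
    (h : ∀ k < n, ‖iter lam k z - iter lam k w‖ ≤ 1 / 2) :
    derivNorm lam n w * ‖z - w‖ ≤ 2 ^ n * ‖iter lam n z - iter lam n w‖ := by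
  induction n with
  | zero => simp [iter]
  | succ n ih =>
    have ih' := ih fun k hk => h k (by omega)
    have h1 := half_norm_le_norm_exp_sub_one (h n (by omega))
    rw [derivNorm_succ, norm_iter_succ_sub]
    calc derivNorm lam n w * ‖iter lam (n + 1) w‖ * ‖z - w‖
        = ‖iter lam (n + 1) w‖ * (derivNorm lam n w * ‖z - w‖) := by ring
      _ ≤ ‖iter lam (n + 1) w‖ * (2 ^ n * ‖iter lam n z - iter lam n w‖) := by gcongr
      _ ≤ ‖iter lam (n + 1) w‖ *
          (2 ^ n * (2 * ‖Complex.exp (iter lam n z - iter lam n w) - 1‖)) := by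
          gcongr; linarith
      _ = _ := by ring

theorem norm_iter_succ_sub_le {n : ℕ} {z w : ℂ} (h : ‖iter lam n z - iter lam n w‖ ≤ 1) :
    ‖iter lam (n + 1) z - iter lam (n + 1) w‖ ≤
      2 * ‖iter lam (n + 1) w‖ * ‖iter lam n z - iter lam n w‖ := by
  rw [norm_iter_succ_sub]
  have := Complex.norm_exp_sub_one_le h
  calc _ ≤ ‖iter lam (n + 1) w‖ * (2 * ‖iter lam n z - iter lam n w‖) := by gcongr
    _ = _ := by ring

theorem norm_iter_sub_le {n : ℕ} {z w : ℂ}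
    (h : ∀ k < n, ‖iter lam k z - iter lam k w‖ ≤ 1) :
    ‖iter lam n z - iter lam n w‖ ≤ 2 ^ n * derivNorm lam n w * ‖z - w‖ := by
  induction n with
  | zero => simp [iter]
  | succ n ih =>
    refine (norm_iter_succ_sub_le (h n (by omega))).trans ?_
    have := ih fun k hk => h k (by omega)
    calc _ ≤ 2 * ‖iter lam (n + 1) w‖ * (2 ^ n * derivNorm lam n w * ‖z - w‖) := by gcongr
      _ = _ := by rw [derivNorm_succ]; ring

end Growth

/-! ### Mass bounds on cells and their propagation to lower levels. -/

section Cells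

/-- The points of the disc of radius `M` whose iterates of all orders `n ≥ 1` have modulus
between `α n` and `β n`. -/
def boundedRateSet (lam : ℕ → ℂ) (α β : ℕ → ℝ) (M : ℝ) : Set ℂ :=
  {z | ‖z‖ ≤ M ∧ ∀ n, α (n + 1) ≤ ‖iter lam (n + 1) z‖ ∧ ‖iter lam (n + 1) z‖ ≤ β (n + 1)}

/-- A subset of `K` on which the iterates up to order `n` stay close to each other, the derivative
of order `n` is at least `d` and the next iterate has modulus in `[x, 2 * x]`. -/
structure IsCell (lam : ℕ → ℂ) (K : Set ℂ) (n : ℕ) (d x : ℝ) (X : Set ℂ) : Prop where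
  subset : X ⊆ K
  le_derivNorm : ∀ z ∈ X, d ≤ derivNorm lam n z
  le_norm : ∀ z ∈ X, x ≤ ‖iter lam (n + 1) z‖
  norm_le : ∀ z ∈ X, ‖iter lam (n + 1) z‖ ≤ 2 * x
  norm_sub_le : ∀ z ∈ X, ∀ w ∈ X, ∀ k ≤ n, ‖iter lam k z - iter lam k w‖ ≤ 1 / 2

/-- The outer measure `Φ` of every cell of level `n` is at most `G * d ^ (-s) * x ^ (-γ)`. -/
def CellBound (lam : ℕ → ℂ) (K : Set ℂ) (η s : ℝ) (Φ : OuterMeasure ℂ) (n : ℕ) (γ G : ℝ) : Prop :=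
  ∀ (d x : ℝ) (X : Set ℂ), 0 < d → η ≤ x → IsCell lam K n d x X →
    Φ X ≤ ENNReal.ofReal (G * d ^ (-s) * x ^ (-γ))

theorem measure_le_sum_of_cover {ι : Type*} (Φ : OuterMeasure ℂ) {X : Set ℂ} (I : Finset ι)
    (Y : ι → Set ℂ) (h : ∀ z ∈ X, ∃ i ∈ I, z ∈ Y i) : Φ X ≤ ∑ i ∈ I, Φ (X ∩ Y i) := by
  refine le_trans (Φ.mono ?_) (measure_biUnion_finset_le I fun i => X ∩ Y i)
  intro z hz
  obtain ⟨i, hi, hzi⟩ := h z hz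
  exact Set.mem_biUnion hi ⟨hz, hzi⟩

variable {lam : ℕ → ℂ} {α β : ℕ → ℝ} {M η s γ G : ℝ}

/-- This turns an annulus for the iterate of order `n + 1` into a vertical strip for the iterate of
order `n`, of width the logarithm of the ratio of the radii. -/
theorem re_iter_eq (hlam : ∀ n, lam (n + 1) ≠ 0) (n : ℕ) (z : ℂ) :
    (iter lam n z).re = Real.log ‖iter lam (n + 1) z‖ - Real.log ‖lam (n + 1)‖ := by
  rw [norm_iter_succ, Real.log_mul (by simpa using hlam n) (Real.exp_ne_zero _), Real.log_exp]
  ring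

theorem abs_sub_le_of_floor_eq {c u v : ℝ} (hc : 0 < c) (h : ⌊c * u⌋ = ⌊c * v⌋) :
    |u - v| ≤ 1 / c := by
  have := Int.abs_sub_lt_one_of_floor_eq_floor h
  rw [← mul_sub, abs_mul, abs_of_pos hc] at this
  rw [le_div_iff₀ hc]; linarith

theorem exp_quarter_le_two : Real.exp (1 / 4) ≤ 2 := by
  have h := Real.exp_one_lt_d9
  have h2 : Real.exp (1 / 4) ^ 4 = Real.exp 1 := by
    rw [← Real.exp_nat_mul]; norm_num
  by_contra hcon
  push Not at hcon
  have : (2 : ℝ) ^ 4 < Real.exp (1 / 4) ^ 4 := by gcongr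
  rw [h2] at this
  linarith

/-- The iterates of order `n` lie in a strip, at height at most `y` in modulus. Cut this region into
squares of side 1/4: there are at most `8 * y + 3` rows, and the preimage of a square in column `i`
is a cell with next modulus about `α (n + 1) * exp (i / 4)`. -/
theorem measure_le_of_cellBound (hlam : ∀ n, lam (n + 1) ≠ 0) (hη : 0 < η)
    (hα : ∀ n, η ≤ α (n + 1)) {Φ : OuterMeasure ℂ} {n : ℕ} (hG : 0 ≤ G)
    (hΦ : CellBound lam (boundedRateSet lam α β M) η s Φ n γ G) {X : Set ℂ}
    (hX : X ⊆ boundedRateSet lam α β M) {d y : ℝ} (hd : 0 < d) (hy : 0 ≤ y)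
    (hdX : ∀ z ∈ X, d ≤ derivNorm lam n z) (hyX : ∀ z ∈ X, ‖iter lam n z‖ ≤ y)
    (hclose : ∀ z ∈ X, ∀ w ∈ X, ∀ k < n, ‖iter lam k z - iter lam k w‖ ≤ 1 / 2) :
    Φ X ≤ ENNReal.ofReal ((8 * y + 3) * G * d ^ (-s) *
      ∑ i ∈ Finset.range (⌊4 * Real.log (β (n + 1) / α (n + 1))⌋₊ + 1),
        (α (n + 1) * Real.exp (i / 4)) ^ (-γ)) := by
  have hα0 : 0 < α (n + 1) := hη.trans_le (hα n)
  set m : ℕ := ⌊4 * Real.log (β (n + 1) / α (n + 1))⌋₊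
  set N : ℕ := ⌊4 * y⌋₊ + 1
  have hF : ∀ z ∈ X, 0 < ‖iter lam (n + 1) z‖ := fun z hz =>
    hα0.trans_le ((hX hz).2 n).1
  -- The distance of `iter lam n z` from the left edge of the strip.
  let g : ℂ → ℝ := fun z => Real.log (‖iter lam (n + 1) z‖ / α (n + 1))
  have hg0 : ∀ z ∈ X, 0 ≤ g z := fun z hz =>
    Real.log_nonneg ((one_le_div hα0).2 ((hX hz).2 n).1)
  have hgexp : ∀ z ∈ X, ‖iter lam (n + 1) z‖ = α (n + 1) * Real.exp (g z) := fun z hz => by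
    simp only [g]
    rw [Real.exp_log (div_pos (hF z hz) hα0)]; field_simp
  have hgre : ∀ z ∈ X, ∀ w ∈ X, (iter lam n z).re - (iter lam n w).re = g z - g w := by
    intro z hz w hw
    simp only [g]
    rw [re_iter_eq hlam, re_iter_eq hlam, Real.log_div (hF z hz).ne' hα0.ne',
      Real.log_div (hF w hw).ne' hα0.ne']
    ring
  let Y : ℕ × ℤ → Set ℂ := fun p => {z | ⌊4 * g z⌋₊ = p.1 ∧ ⌊4 * (iter lam n z).im⌋ = p.2}
  have hcov := measure_le_sum_of_cover Φ (X := X) (Finset.range (m + 1) ×ˢ Finset.Icc (-(N : ℤ)) N) Y (by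
    intro z hz
    refine ⟨(⌊4 * g z⌋₊, ⌊4 * (iter lam n z).im⌋), ?_, rfl, rfl⟩
    have him : |4 * (iter lam n z).im| ≤ 4 * y := by
      rw [abs_mul, abs_of_pos (by norm_num : (0 : ℝ) < 4)]
      have := (Complex.abs_im_le_norm (iter lam n z)).trans (hyX z hz)
      linarith
    have hN : 4 * y < N := by
      simp only [N]; push_cast; exact Nat.lt_floor_add_one _
    rw [abs_le] at him
    simp only [Finset.mem_product, Finset.mem_range, Finset.mem_Icc]
    refine ⟨Nat.lt_succ_of_le (Nat.floor_le_floor ?_), ?_, ?_⟩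
    · have := hF z hz
      have := ((hX hz).2 n).2
      simp only [g]
      gcongr
    · rw [Int.le_floor]; push_cast; linarith
    · have : ⌊4 * (iter lam n z).im⌋ ≤ (4 * (iter lam n z).im) := Int.floor_le _
      exact_mod_cast (show ((⌊4 * (iter lam n z).im⌋ : ℤ) : ℝ) ≤ (N : ℤ) by push_cast; linarith))
  refine hcov.trans ?_
  have hcell : ∀ p ∈ Finset.range (m + 1) ×ˢ Finset.Icc (-(N : ℤ)) N,
      Φ (X ∩ Y p) ≤ ENNReal.ofReal (G * d ^ (-s) * (α (n + 1) * Real.exp (p.1 / 4)) ^ (-γ)) := by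
    intro p _
    refine hΦ d _ _ hd ?_ ⟨Set.inter_subset_left.trans hX, fun z hz => hdX z hz.1, ?_, ?_, ?_⟩
    · have : 1 ≤ Real.exp ((p.1 : ℝ) / 4) := Real.one_le_exp (by positivity)
      nlinarith [hα n]
    · intro z hz
      rw [hgexp z hz.1]
      have := Nat.floor_le (a := 4 * g z) (by linarith [hg0 z hz.1])
      rw [hz.2.1] at this
      gcongr
      linarith
    · intro z hz
      rw [hgexp z hz.1]
      have h1 := Nat.lt_floor_add_one (4 * g z)
      rw [hz.2.1] at h1
      calc α (n + 1) * Real.exp (g z) ≤ α (n + 1) * Real.exp (p.1 / 4 + 1 / 4) := by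
            gcongr; linarith
        _ ≤ α (n + 1) * (Real.exp (p.1 / 4) * 2) := by
            rw [Real.exp_add]; gcongr; exact exp_quarter_le_two
        _ = _ := by ring
    · intro z hz w hw k hk
      rcases hk.lt_or_eq with hk | rfl
      · exact hclose z hz.1 w hw.1 k hk
      · refine (Complex.norm_le_abs_re_add_abs_im _).trans ?_
        rw [Complex.sub_re, Complex.sub_im, hgre z hz.1 w hw.1]
        have h1 : |g z - g w| ≤ 1 / 4 := by
          refine abs_sub_le_of_floor_eq (by norm_num) ?_
          rw [← Int.natCast_floor_eq_floor (by linarith [hg0 z hz.1]),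
            ← Int.natCast_floor_eq_floor (by linarith [hg0 w hw.1]), hz.2.1, hw.2.1]
        have h2 : |(iter lam k z).im - (iter lam k w).im| ≤ 1 / 4 :=
          abs_sub_le_of_floor_eq (by norm_num) (hz.2.2.trans hw.2.2.symm)
        linarith
  refine (Finset.sum_le_sum hcell).trans ?_
  rw [← ENNReal.ofReal_sum_of_nonneg (fun p _ => by positivity), Finset.sum_product]
  refine ENNReal.ofReal_le_ofReal ?_
  simp only [Finset.sum_const, nsmul_eq_mul]
  rw [← Finset.mul_sum, ← Finset.mul_sum]
  have hcard : ((Finset.Icc (-(N : ℤ)) N).card : ℝ) ≤ 8 * y + 3 := by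
    rw [Int.card_Icc]
    have h1 : ((N : ℤ) + 1 - -(N : ℤ)).toNat = 2 * N + 1 := by omega
    rw [h1]
    have h2 := Nat.floor_le (a := 4 * y) (by positivity)
    simp only [N]; push_cast
    linarith
  calc _ ≤ (8 * y + 3) * (G * d ^ (-s) * ∑ i ∈ Finset.range (m + 1),
        (α (n + 1) * Real.exp (i / 4)) ^ (-γ)) := by
        gcongr
    _ = _ := by ring

/-- A geometric series: for positive `γ` the bound does not depend on the number of columns, so
neither on the width of the strip. -/
theorem sum_mul_exp_rpow_le (hγ : 0 < γ) {x : ℝ} (hx : 0 < x) (m : ℕ) :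
    ∑ i ∈ Finset.range m, (x * Real.exp (i / 4)) ^ (-γ) ≤
      x ^ (-γ) * (1 - Real.exp (-γ / 4))⁻¹ := by
  have h1 : ∀ i : ℕ, (x * Real.exp (i / 4)) ^ (-γ) = x ^ (-γ) * Real.exp (-γ / 4) ^ i := by
    intro i
    rw [Real.mul_rpow hx.le (Real.exp_pos _).le, ← Real.exp_mul, ← Real.exp_nat_mul]
    congr 2; ring
  simp_rw [h1]
  rw [← Finset.mul_sum]
  gcongr
  have h2 : Real.exp (-γ / 4) < 1 := by
    rw [Real.exp_lt_one_iff]; linarith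
  rw [← tsum_geometric_of_lt_one (Real.exp_pos _).le h2]
  exact (summable_geometric_of_lt_one (Real.exp_pos _).le h2).sum_le_tsum _
    (fun _ _ => by positivity)

/-- Passing from level `n + 1` to level `n` by subdivision. -/
theorem cellBound_of_succ (hlam : ∀ n, lam (n + 1) ≠ 0) (hη : 0 < η)
    (hα : ∀ n, η ≤ α (n + 1)) {Φ : OuterMeasure ℂ} {n : ℕ} (hG : 0 ≤ G)
    (hΦ : CellBound lam (boundedRateSet lam α β M) η s Φ (n + 1) γ G) :
    CellBound lam (boundedRateSet lam α β M) η s Φ n (s - 1) ((16 + 3 / η) * G *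
      ∑ i ∈ Finset.range (⌊4 * Real.log (β (n + 2) / α (n + 2))⌋₊ + 1),
        (α (n + 2) * Real.exp (i / 4)) ^ (-γ)) := by
  intro d x X hd hx hX
  have hx0 : 0 < x := hη.trans_le hx
  -- On a cell the derivative of order `n + 1` is at least `d * x`. The number of rows is of order
  -- `x`, so `(d * x) ^ (-s)` becomes `d ^ (-s) * x ^ (-(s - 1))`, whatever `γ` was.
  refine (measure_le_of_cellBound hlam hη hα hG hΦ hX.subset (d := d * x) (y := 2 * x)
    (by positivity) (by positivity) ?_ hX.norm_le ?_).trans ?_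
  · intro z hz
    rw [derivNorm_succ]
    have := hX.le_derivNorm z hz
    have := hX.le_norm z hz
    gcongr
    exact derivNorm_nonneg _ _
  · exact fun z hz w hw k hk => hX.norm_sub_le z hz w hw k (by omega)
  · refine ENNReal.ofReal_le_ofReal ?_
    set S := ∑ i ∈ Finset.range (⌊4 * Real.log (β (n + 2) / α (n + 2))⌋₊ + 1),
        (α (n + 2) * Real.exp (i / 4)) ^ (-γ)
    have hS : 0 ≤ S := Finset.sum_nonneg fun i _ =>
      Real.rpow_nonneg (mul_nonneg (hη.le.trans (hα (n + 1))) (Real.exp_pos _).le) _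
    have h1 : 8 * (2 * x) + 3 ≤ (16 + 3 / η) * x := by
      have : 3 ≤ 3 / η * x := by
        rw [div_mul_eq_mul_div, le_div_iff₀ hη]; linarith
      linarith
    have h2 : (d * x) ^ (-s) = d ^ (-s) * x ^ (-s) := Real.mul_rpow hd.le hx0.le
    have h3 : x ^ (-(s - 1)) = x * x ^ (-s) := by
      rw [show -(s - 1) = 1 + -s by ring, Real.rpow_add hx0, Real.rpow_one]
    calc (8 * (2 * x) + 3) * G * (d * x) ^ (-s) * S
        ≤ ((16 + 3 / η) * x) * G * (d * x) ^ (-s) * S := by gcongr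
      _ = _ := by rw [h2, h3]; ring

theorem cellBound_mono {Φ : OuterMeasure ℂ} {K : Set ℂ} {n : ℕ} {G' : ℝ} (hη : 0 < η) (h : G ≤ G')
    (hΦ : CellBound lam K η s Φ n γ G) : CellBound lam K η s Φ n γ G' := by
  intro d x X hd hx hX
  refine (hΦ d x X hd hx hX).trans (ENNReal.ofReal_le_ofReal ?_)
  have : 0 < x := hη.trans_le hx
  gcongr

/-- For `γ = 0` all columns count equally, so this step costs the width of the strip plus a
constant. Afterwards the exponent is `s - 1`. -/
theorem exists_cellBound_of_succ_zero (hη : 0 < η) :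
    ∃ C : ℝ, 1 ≤ C ∧ ∀ (lam : ℕ → ℂ) (α β : ℕ → ℝ) (M s : ℝ), (∀ n, lam (n + 1) ≠ 0) →
      (∀ n, η ≤ α (n + 1)) → (∀ n, α (n + 1) ≤ β (n + 1)) →
      ∀ (Φ : OuterMeasure ℂ) (n : ℕ) (G : ℝ), 0 ≤ G →
      CellBound lam (boundedRateSet lam α β M) η s Φ (n + 1) 0 G →
      CellBound lam (boundedRateSet lam α β M) η s Φ n (s - 1)
        (G * C * (Real.log (β (n + 2) / α (n + 2)) + 1)) := by
  refine ⟨4 * (16 + 3 / η), by have : 0 ≤ 3 / η := by positivity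
                               linarith, ?_⟩
  intro lam α β M s hlam hα hαβ Φ n G hG hΦ
  refine cellBound_mono hη ?_ (cellBound_of_succ hlam hη hα hG hΦ)
  simp only [neg_zero, Real.rpow_zero, Finset.sum_const, Finset.card_range, nsmul_eq_mul, mul_one]
  have hα0 : 0 < α (n + 2) := hη.trans_le (hα (n + 1))
  have h0 : 0 ≤ Real.log (β (n + 2) / α (n + 2)) :=
    Real.log_nonneg ((one_le_div hα0).2 (hαβ (n + 1)))
  have := Nat.floor_le (a := 4 * Real.log (β (n + 2) / α (n + 2))) (by positivity)
  push_cast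
  calc (16 + 3 / η) * G * ((⌊4 * Real.log (β (n + 2) / α (n + 2))⌋₊ : ℝ) + 1)
      ≤ (16 + 3 / η) * G * (4 * (Real.log (β (n + 2) / α (n + 2)) + 1)) := by gcongr; linarith
    _ = _ := by ring

/-- The exponent `s - 1` is reproduced by each subdivision and is positive, so the sum over the
columns is geometric and every level costs only `C * α (k + 1) ^ (-(s - 1))`. The outer radii do not
enter. -/
theorem exists_measure_le_of_cellBound (hη : 0 < η) (hM : 0 ≤ M) (hs : 1 < s) :
    ∃ C : ℝ, 1 ≤ C ∧ ∀ (lam : ℕ → ℂ) (α β : ℕ → ℝ), (∀ n, lam (n + 1) ≠ 0) →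
      (∀ n, η ≤ α (n + 1)) →
      ∀ (Φ : OuterMeasure ℂ) (n : ℕ) (G : ℝ), 0 ≤ G →
      CellBound lam (boundedRateSet lam α β M) η s Φ n (s - 1) G →
      Φ (boundedRateSet lam α β M) ≤ ENNReal.ofReal
        (G * C ^ (n + 1) * ∏ k ∈ Finset.range (n + 1), α (k + 1) ^ (-(s - 1))) := by
  set S : ℝ := (1 - Real.exp (-(s - 1) / 4))⁻¹
  have hS : 1 ≤ S := by
    have h2 : Real.exp (-(s - 1) / 4) < 1 := by
      rw [Real.exp_lt_one_iff]; linarith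
    have := Real.exp_pos (-(s - 1) / 4)
    exact (one_le_inv₀ (by linarith)).2 (by linarith)
  have hη3 : 0 ≤ 3 / η := by positivity
  set C := (16 + 3 / η + 8 * M) * S
  have hC : 1 ≤ C := by
    have : 1 ≤ 16 + 3 / η + 8 * M := by linarith
    exact one_le_mul_of_one_le_of_one_le this hS
  refine ⟨C, hC, ?_⟩
  intro lam α β hlam hα Φ n
  induction n with
  | zero =>
    intro G hG hΦ
    -- At level 0 the derivative is an empty product, and the radius of the disc of starting points
    -- bounds the height.
    refine (measure_le_of_cellBound hlam hη hα hG hΦ subset_rfl (d := 1) (y := M) one_pos hM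
      (by simp) (fun z hz => hz.1) (by simp)).trans (ENNReal.ofReal_le_ofReal ?_)
    have hα0 : 0 < α 1 := hη.trans_le (hα 0)
    have h1 := sum_mul_exp_rpow_le (γ := s - 1) (by linarith) hα0
      (⌊4 * Real.log (β 1 / α 1)⌋₊ + 1)
    simp only [zero_add, Real.one_rpow, mul_one, pow_one, Finset.range_one, Finset.prod_singleton]
    calc (8 * M + 3) * G * _ ≤ (8 * M + 3) * G * (α 1 ^ (-(s - 1)) * S) := by gcongr
      _ ≤ (16 + 3 / η + 8 * M) * G * (α 1 ^ (-(s - 1)) * S) := by gcongr ?_ * _ * _; linarith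
      _ = _ := by ring
  | succ n ih =>
    intro G hG hΦ
    have hα0 : 0 < α (n + 2) := hη.trans_le (hα (n + 1))
    have h1 := sum_mul_exp_rpow_le (γ := s - 1) (by linarith) hα0
      (⌊4 * Real.log (β (n + 2) / α (n + 2))⌋₊ + 1)
    have h2 := cellBound_of_succ hlam hη hα hG hΦ
    have h3 := cellBound_mono (G' := G * C * α (n + 2) ^ (-(s - 1))) hη ?_ h2
    · refine (ih _ (by positivity) h3).trans (ENNReal.ofReal_le_ofReal ?_)
      rw [Finset.prod_range_succ _ (n + 1), pow_succ _ (n + 1)]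
      exact le_of_eq (by ring)
    · calc (16 + 3 / η) * G * _ ≤ (16 + 3 / η) * G * (α (n + 2) ^ (-(s - 1)) * S) := by gcongr
        _ ≤ (16 + 3 / η + 8 * M) * G * (α (n + 2) ^ (-(s - 1)) * S) := by
            gcongr ?_ * _ * _; linarith
        _ = _ := by ring

end Cells

/-! ### Hausdorff contents of cells. -/

section Content

variable {lam : ℕ → ℂ} {α β : ℕ → ℝ} {M η s t : ℝ}

/-- The `s`-dimensional Hausdorff content of scale `r`. -/
noncomputable def hausdorffContent (s : ℝ) (r : ℝ≥0∞) : OuterMeasure ℂ :=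
  OuterMeasure.mkMetric'.pre (fun A => Metric.ediam A ^ s) r

theorem hausdorffContent_le {ρ : ℝ} {r : ℝ≥0∞} {Y : Set ℂ} (hs : 0 ≤ s)
    (hY : ∀ z ∈ Y, ∀ w ∈ Y, ‖z - w‖ ≤ ρ) (hr : Metric.ediam Y ≤ r) :
    hausdorffContent s r Y ≤ ENNReal.ofReal ρ ^ s := by
  refine (OuterMeasure.mkMetric'.pre_le hr).trans ?_
  gcongr
  exact Metric.ediam_le_of_forall_dist_le fun z hz w hw => by
    rw [dist_eq_norm]; exact hY z hz w hw

theorem hausdorffMeasure_eq_zero_of_content {K : Set ℂ}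
    (h : ∀ r > 0, hausdorffContent s r K = 0) : μH[s] K = 0 := by
  have h1 : μH[s] K = OuterMeasure.mkMetric (fun r => r ^ s) K := by
    rw [Measure.hausdorffMeasure, ← OuterMeasure.coe_mkMetric]
  rw [h1, OuterMeasure.mkMetric, OuterMeasure.mkMetric']
  simp only [OuterMeasure.iSup_apply, ENNReal.iSup_eq_zero]
  exact fun r hr => h r hr

theorem prod_le_derivNorm (hη : 0 < η) (hα : ∀ n, η ≤ α (n + 1)) {z : ℂ}
    (hz : z ∈ boundedRateSet lam α β M) (n : ℕ) :
    ∏ k ∈ Finset.range n, α (k + 1) ≤ derivNorm lam n z :=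
  Finset.prod_le_prod (fun k _ => hη.le.trans (hα k)) fun k _ => (hz.2 k).1

theorem ediam_le_of_mul_le {Y : Set ℂ} {P ρ : ℝ} (hP : 0 < P)
    (h : ∀ z ∈ Y, ∀ w ∈ Y, P * ‖z - w‖ ≤ ρ) : Metric.ediam Y ≤ ENNReal.ofReal (ρ / P) :=
  Metric.ediam_le_of_forall_dist_le fun z hz w hw => by
    rw [dist_eq_norm, le_div_iff₀ hP, mul_comm]; exact h z hz w hw

/-- A cell serves as its own cover: by bounded distortion its diameter is at most `2 ^ n / d`. The
next modulus plays no role, whence the exponent 0. -/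
theorem cellBound_content_zero (hη : 0 < η) (hα : ∀ n, η ≤ α (n + 1)) (hs : 0 ≤ s) {r : ℝ≥0∞}
    {n : ℕ} (hr : ENNReal.ofReal (2 ^ n / ∏ k ∈ Finset.range n, α (k + 1)) ≤ r) :
    CellBound lam (boundedRateSet lam α β M) η s (hausdorffContent s r) n 0 ((2 ^ n) ^ s) := by
  intro d x X hd hx hX
  have hP : 0 < ∏ k ∈ Finset.range n, α (k + 1) :=
    Finset.prod_pos fun k _ => hη.trans_le (hα k)
  have key : ∀ z ∈ X, ∀ w ∈ X, derivNorm lam n w * ‖z - w‖ ≤ 2 ^ n := by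
    intro z hz w hw
    refine (derivNorm_mul_norm_sub_le fun k hk => hX.norm_sub_le z hz w hw k hk.le).trans ?_
    have := hX.norm_sub_le z hz w hw n le_rfl
    have h2 : (0 : ℝ) < 2 ^ n := by positivity
    nlinarith
  refine (hausdorffContent_le (ρ := 2 ^ n / d) hs ?_ ((ediam_le_of_mul_le hP ?_).trans hr)).trans ?_
  · intro z hz w hw
    rw [le_div_iff₀ hd, mul_comm]
    refine le_trans ?_ (key z hz w hw)
    gcongr
    exact hX.le_derivNorm w hw
  · intro z hz w hw
    refine le_trans ?_ (key z hz w hw)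
    gcongr
    exact prod_le_derivNorm hη hα (hX.subset hw) n
  · rw [ENNReal.ofReal_rpow_of_nonneg (by positivity) hs]
    refine ENNReal.ofReal_le_ofReal (le_of_eq ?_)
    rw [Real.div_rpow (by positivity) hd.le, Real.rpow_neg hd.le]
    simp [div_eq_mul_inv]

/-- Subdivision of a cell into pieces whose images have the width of the strip. -/
theorem cellBound_content_of_modulus_le (hlam : ∀ n, lam (n + 1) ≠ 0) (hη : 0 < η)
    (hα : ∀ n, η ≤ α (n + 1)) (hs : 0 ≤ s) {r : ℝ≥0∞} {n : ℕ} {D Λ : ℝ}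
    (hΛ : Λ = Real.log (β (n + 2) / α (n + 2))) (hΛ0 : 0 < Λ) (hD : 0 ≤ D)
    (hΛD : Λ ≤ D * α (n + 1))
    (hr : ENNReal.ofReal (2 ^ (n + 2) * Λ / ∏ k ∈ Finset.range (n + 1), α (k + 1)) ≤ r) :
    CellBound lam (boundedRateSet lam α β M) η s (hausdorffContent s r) n (s - 1)
      ((4 + 6 * D) * (2 ^ (n + 2)) ^ s * Λ ^ (s - 1)) := by
  intro d x X hd hx hX
  rcases X.eq_empty_or_nonempty with rfl | ⟨z₀, hz₀⟩
  · simp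
  have hx0 : 0 < x := hη.trans_le hx
  have hP : 0 < ∏ k ∈ Finset.range (n + 1), α (k + 1) :=
    Finset.prod_pos fun k _ => hη.trans_le (hα k)
  have hαx : α (n + 1) ≤ 2 * x := (((hX.subset hz₀).2 n).1).trans (hX.norm_le z₀ hz₀)
  -- The comparison of `Λ` with `α (n + 1)` makes the number of slices of height `Λ` of order `x /
  -- Λ`, with the additive constant absorbed.
  have hΛx : Λ ≤ 2 * D * x := by nlinarith
  set N : ℕ := ⌊2 * x / Λ⌋₊ + 1
  let Y : ℤ → Set ℂ := fun j => {z | ⌊Λ⁻¹ * (iter lam (n + 1) z).im⌋ = j}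
  have hcov := measure_le_sum_of_cover (hausdorffContent s r) (X := X)
    (Finset.Icc (-(N : ℤ)) N) Y (by
    intro z hz
    refine ⟨⌊Λ⁻¹ * (iter lam (n + 1) z).im⌋, ?_, rfl⟩
    have him : |Λ⁻¹ * (iter lam (n + 1) z).im| ≤ 2 * x / Λ := by
      rw [abs_mul, abs_of_pos (inv_pos.2 hΛ0), inv_mul_eq_div]
      have := (Complex.abs_im_le_norm (iter lam (n + 1) z)).trans (hX.norm_le z hz)
      gcongr
    have hN : 2 * x / Λ < N := by
      simp only [N]; push_cast; exact Nat.lt_floor_add_one _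
    rw [abs_le] at him
    simp only [Finset.mem_Icc]
    refine ⟨?_, ?_⟩
    · rw [Int.le_floor]; push_cast; linarith
    · have : ⌊Λ⁻¹ * (iter lam (n + 1) z).im⌋ ≤ (Λ⁻¹ * (iter lam (n + 1) z).im) := Int.floor_le _
      exact_mod_cast (show ((⌊Λ⁻¹ * (iter lam (n + 1) z).im⌋ : ℤ) : ℝ) ≤ (N : ℤ) by
        push_cast; linarith))
  refine hcov.trans ?_
  have hpiece : ∀ j ∈ Finset.Icc (-(N : ℤ)) N, hausdorffContent s r (X ∩ Y j) ≤
      ENNReal.ofReal ((2 ^ (n + 2)) ^ s * Λ ^ s * d ^ (-s) * x ^ (-s)) := by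
    intro j _
    have key : ∀ z ∈ X ∩ Y j, ∀ w ∈ X ∩ Y j,
        derivNorm lam (n + 1) w * ‖z - w‖ ≤ 2 ^ (n + 2) * Λ := by
      intro z hz w hw
      -- Closeness is needed only below order `n + 1`, so `Λ` itself may be large.
      refine (derivNorm_mul_norm_sub_le fun k hk =>
        hX.norm_sub_le z hz.1 w hw.1 k (by omega)).trans ?_
      have him : |(iter lam (n + 1) z).im - (iter lam (n + 1) w).im| ≤ Λ := by
        have := abs_sub_le_of_floor_eq (inv_pos.2 hΛ0) (hz.2.trans hw.2.symm)
        simpa using this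
      have hre : |(iter lam (n + 1) z).re - (iter lam (n + 1) w).re| ≤ Λ := by
        have h1 := (hX.subset hz.1).2 (n + 1)
        have h2 := (hX.subset hw.1).2 (n + 1)
        have hα0 := hη.trans_le (hα (n + 1))
        rw [re_iter_eq hlam, re_iter_eq hlam, hΛ, Real.log_div
          (hα0.trans_le (h1.1.trans h1.2)).ne' hα0.ne']
        have a1 := Real.log_le_log hα0 h1.1
        have a2 := Real.log_le_log hα0 h2.1
        have a3 := Real.log_le_log (hα0.trans_le h1.1) h1.2
        have a4 := Real.log_le_log (hα0.trans_le h2.1) h2.2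
        rw [abs_le]
        constructor <;> linarith
      have : ‖iter lam (n + 1) z - iter lam (n + 1) w‖ ≤ 2 * Λ := by
        refine (Complex.norm_le_abs_re_add_abs_im _).trans ?_
        rw [Complex.sub_re, Complex.sub_im]
        linarith
      calc _ ≤ (2 : ℝ) ^ (n + 1) * (2 * Λ) := by gcongr
        _ = _ := by ring
    refine (hausdorffContent_le (ρ := 2 ^ (n + 2) * Λ / (d * x)) hs ?_
      ((ediam_le_of_mul_le hP ?_).trans hr)).trans ?_
    · intro z hz w hw
      rw [le_div_iff₀ (by positivity), mul_comm]
      refine le_trans ?_ (key z hz w hw)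
      rw [derivNorm_succ]
      have h1 := hX.le_derivNorm w hw.1
      have h2 := hX.le_norm w hw.1
      gcongr
      exact derivNorm_nonneg _ _
    · intro z hz w hw
      refine le_trans ?_ (key z hz w hw)
      gcongr
      exact prod_le_derivNorm hη hα (hX.subset hw.1) (n + 1)
    · rw [ENNReal.ofReal_rpow_of_nonneg (by positivity) hs]
      refine ENNReal.ofReal_le_ofReal (le_of_eq ?_)
      rw [Real.div_rpow (by positivity) (by positivity), Real.mul_rpow (by positivity) hΛ0.le,
        Real.mul_rpow hd.le hx0.le, Real.rpow_neg hd.le, Real.rpow_neg hx0.le]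
      field_simp
  refine (Finset.sum_le_sum hpiece).trans ?_
  rw [Finset.sum_const, nsmul_eq_mul, ← ENNReal.ofReal_natCast,
    ← ENNReal.ofReal_mul (by positivity)]
  refine ENNReal.ofReal_le_ofReal ?_
  have hcard : ((Finset.Icc (-(N : ℤ)) N).card : ℝ) ≤ (4 + 6 * D) * x / Λ := by
    rw [Int.card_Icc]
    have h1 : ((N : ℤ) + 1 - -(N : ℤ)).toNat = 2 * N + 1 := by omega
    rw [h1]
    have h2 := Nat.floor_le (a := 2 * x / Λ) (by positivity)
    have h3 : 3 ≤ 6 * D * x / Λ := by rw [le_div_iff₀ hΛ0]; linarith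
    have h4 : (4 + 6 * D) * x / Λ = 2 * (2 * x / Λ) + 6 * D * x / Λ := by ring
    rw [h4]
    simp only [N]; push_cast
    linarith
  have h3 : x ^ (-(s - 1)) = x * x ^ (-s) := by
    rw [show -(s - 1) = 1 + -s by ring, Real.rpow_add hx0, Real.rpow_one]
  have h4 : Λ ^ (s - 1) = Λ ^ s / Λ := by
    rw [Real.rpow_sub hΛ0, Real.rpow_one]
  calc _ ≤ ((4 + 6 * D) * x / Λ) * ((2 ^ (n + 2)) ^ s * Λ ^ s * d ^ (-s) * x ^ (-s)) := by gcongr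
    _ = _ := by rw [h3, h4]; ring

end Content

/-! ### Exponential factors against products of radii. -/

section Asymptotics

/-- The logarithm of `α 1 * ⋯ * α n`. -/
noncomputable def logProd (α : ℕ → ℝ) (n : ℕ) : ℝ := ∑ k ∈ Finset.range n, Real.log (α (k + 1))

theorem logProd_succ (α : ℕ → ℝ) (n : ℕ) :
    logProd α (n + 1) = logProd α n + Real.log (α (n + 1)) := Finset.sum_range_succ _ _

variable {α β : ℕ → ℝ} {η s t : ℝ}

theorem exp_logProd (hα : ∀ n, 0 < α (n + 1)) (n : ℕ) :
    Real.exp (logProd α n) = ∏ k ∈ Finset.range n, α (k + 1) := by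
  rw [logProd, Real.exp_sum]
  exact Finset.prod_congr rfl fun k _ => Real.exp_log (hα k)

theorem prod_rpow_neg (hα : ∀ n, 0 < α (n + 1)) (t : ℝ) (n : ℕ) :
    ∏ k ∈ Finset.range n, α (k + 1) ^ (-t) = Real.exp (-t * logProd α n) := by
  rw [logProd, Finset.mul_sum, Real.exp_sum]
  refine Finset.prod_congr rfl fun k _ => ?_
  rw [Real.rpow_def_of_pos (hα k), mul_comm]

/-- Here the growth of the geometric means absorbs the constants `C ^ n`: once `τ * L n / n` exceeds
`log (2 * (|C| + 1))`, even a geometric rate 1/2 is left over. -/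
theorem eventually_pow_mul_exp_le {L : ℕ → ℝ} (hL : Tendsto (fun n => L n / n) atTop atTop)
    {τ : ℝ} (hτ : 0 < τ) (C : ℝ) :
    ∀ᶠ n in atTop, C ^ n * Real.exp (-τ * L n) ≤ (1 / 2) ^ n := by
  filter_upwards [hL.eventually_ge_atTop ((Real.log (2 * (|C| + 1))) / τ), eventually_gt_atTop 0]
    with n hn hn0
  have hn0' : (0 : ℝ) < n := by exact_mod_cast hn0
  rw [div_le_div_iff₀ hτ hn0'] at hn
  have h1 : (2 * (|C| + 1)) ^ n ≤ Real.exp (τ * L n) := by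
    rw [← Real.exp_log (show 0 < 2 * (|C| + 1) by positivity), ← Real.exp_nat_mul]
    refine Real.exp_le_exp.2 ?_
    linarith
  rw [show -τ * L n = -(τ * L n) by ring, Real.exp_neg, ← div_eq_mul_inv, div_le_iff₀ (Real.exp_pos _)]
  calc C ^ n ≤ |C| ^ n := by rw [← abs_pow]; exact le_abs_self _
    _ ≤ (|C| + 1) ^ n := by gcongr; linarith
    _ = (1 / 2) ^ n * (2 * (|C| + 1)) ^ n := by rw [← mul_pow]; congr 1; ring
    _ ≤ _ := by gcongr

theorem tendsto_pow_mul_exp {L : ℕ → ℝ} (hL : Tendsto (fun n => L n / n) atTop atTop)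
    {τ : ℝ} (hτ : 0 < τ) {C : ℝ} (hC : 0 ≤ C) :
    Tendsto (fun n => C ^ n * Real.exp (-τ * L n)) atTop (𝓝 0) :=
  squeeze_zero' (Eventually.of_forall fun n => by positivity) (eventually_pow_mul_exp_le hL hτ C)
    (tendsto_pow_atTop_nhds_zero_of_lt_one (by norm_num) (by norm_num))

theorem pow_rpow_comm {x : ℝ} (hx : 0 ≤ x) (n : ℕ) (s : ℝ) : (x ^ n) ^ s = (x ^ s) ^ n := by
  rw [← Real.rpow_natCast, ← Real.rpow_natCast, ← Real.rpow_mul hx, ← Real.rpow_mul hx, mul_comm]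

end Asymptotics

/-! ### The upper bound for the Hausdorff dimension. -/

section HausdorffUpper

variable {lam : ℕ → ℂ} {α β : ℕ → ℝ} {M η t : ℝ}

/-- Either alternative at a level `n` gives a cover with small sum. In the first, squares of side
`Λ` contribute `(Λ / α (n + 1)) ^ t ≤ D ^ t`; in the second, the factor `Λ + 1` paid once is beaten
because `τ < t`. Infinitely many levels are enough, since the contents involve an infimum over
covers. -/
theorem dimH_boundedRateSet_le (hlam : ∀ n, lam (n + 1) ≠ 0) (hη : 0 < η)
    (hα : ∀ n, η ≤ α (n + 1)) (hαβ : ∀ n, α (n + 1) < β (n + 1)) (hM : 0 ≤ M) (ht : 0 < t)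
    (hL : Tendsto (fun n : ℕ => logProd α n / n) atTop atTop) {D B τ : ℝ} (hD : 1 ≤ D)
    (hB : 0 ≤ B) (hτ : τ < t)
    (h : ∃ᶠ n in atTop, Real.log (β (n + 2) / α (n + 2)) ≤ D * α (n + 1) ∨
      Real.log (β (n + 1) / α (n + 1)) + 1 ≤ B ^ n * Real.exp (τ * logProd α n)) :
    dimH (boundedRateSet lam α β M) ≤ ENNReal.ofReal (1 + t) := by
  have hα0 : ∀ n, 0 < α (n + 1) := fun n => hη.trans_le (hα n)
  obtain ⟨C, hC, hCle⟩ := exists_measure_le_of_cellBound (s := 1 + t) hη hM (by linarith)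
  obtain ⟨C₂, hC₂, hC₂le⟩ := exists_cellBound_of_succ_zero hη
  have hL1 : Tendsto (fun n : ℕ => 4 * D * (2 ^ n * Real.exp (-1 * logProd α n))) atTop (𝓝 0) := by
    simpa using (tendsto_pow_mul_exp hL one_pos (C := 2) (by norm_num)).const_mul (4 * D)
  set T : ℝ := 2 ^ (1 + t)
  have hT : 0 < T := by positivity
  -- the two bounds for the content
  let u : ℕ → ℝ := fun n => (4 + 6 * D) * T ^ 2 * D ^ t * C * ((T * C) ^ n * Real.exp (-t * logProd α n))
  let v : ℕ → ℝ := fun n => C₂ * ((T * B * C) ^ n * Real.exp (-(t - τ) * logProd α n))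
  have hu : Tendsto u atTop (𝓝 0) := by
    simpa only [mul_zero] using (tendsto_pow_mul_exp hL ht (C := T * C) (by positivity)).const_mul
      ((4 + 6 * D) * T ^ 2 * D ^ t * C)
  have hv : Tendsto v atTop (𝓝 0) := by
    simpa only [mul_zero] using (tendsto_pow_mul_exp hL (sub_pos.2 hτ) (C := T * B * C) (by positivity)).const_mul C₂
  have hcontent : ∀ r > 0, hausdorffContent (1 + t) r (boundedRateSet lam α β M) = 0 := by
    intro r hr
    have hsmall : ∀ᶠ n in atTop,
        ENNReal.ofReal (4 * D * (2 ^ n * Real.exp (-1 * logProd α n))) ≤ r := by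
      have := (ENNReal.continuous_ofReal.tendsto 0).comp hL1
      simp only [ENNReal.ofReal_zero] at this
      exact this.eventually_le_const hr
    have key : ∃ᶠ n in atTop, hausdorffContent (1 + t) r (boundedRateSet lam α β M) ≤
        ENNReal.ofReal (u n + v n) := by
      refine (h.and_eventually (hsmall.and (eventually_gt_atTop 0))).mono ?_
      rintro n ⟨hn, hsm, hn0⟩
      rcases hn with hn | hn
      · have hΛ0 : 0 < Real.log (β (n + 2) / α (n + 2)) :=
          Real.log_pos ((one_lt_div (hα0 _)).2 (hαβ _))
        set Λ := Real.log (β (n + 2) / α (n + 2)) with hΛ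
        have hcell := cellBound_content_of_modulus_le (lam := lam) (M := M) hlam hη hα (s := 1 + t)
          (by linarith) (r := r) hΛ hΛ0 (by linarith) hn (le_trans (ENNReal.ofReal_le_ofReal ?_) hsm)
        · refine (hCle lam α β hlam hα _ n _ (by positivity) hcell).trans
            (ENNReal.ofReal_le_ofReal ?_)
          have hv0 : 0 ≤ v n := by positivity
          refine le_trans ?_ (le_add_of_nonneg_right hv0)
          rw [add_sub_cancel_left, Finset.prod_range_succ, prod_rpow_neg hα0,
            pow_rpow_comm (by norm_num)]
          have hΛt : Λ ^ t * α (n + 1) ^ (-t) ≤ D ^ t := by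
            calc Λ ^ t * α (n + 1) ^ (-t) ≤ (D * α (n + 1)) ^ t * α (n + 1) ^ (-t) := by
                  have := hα0 n
                  gcongr
              _ = D ^ t := by
                  rw [Real.mul_rpow (by linarith) (hα0 n).le, mul_assoc,
                    ← Real.rpow_add (hα0 n)]
                  simp
          calc (4 + 6 * D) * (2 ^ (1 + t)) ^ (n + 2) * Λ ^ t * C ^ (n + 1) *
                (Real.exp (-t * logProd α n) * α (n + 1) ^ (-t))
              = (4 + 6 * D) * T ^ 2 * C * ((T * C) ^ n * Real.exp (-t * logProd α n)) *
                  (Λ ^ t * α (n + 1) ^ (-t)) := by simp only [T]; ring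
            _ ≤ (4 + 6 * D) * T ^ 2 * C * ((T * C) ^ n * Real.exp (-t * logProd α n)) * D ^ t := by
                gcongr
            _ = _ := by simp only [u]; ring
        · rw [Finset.prod_range_succ, ← exp_logProd hα0, neg_one_mul, Real.exp_neg,
            div_le_iff₀ (mul_pos (Real.exp_pos _) (hα0 n))]
          calc 2 ^ (n + 2) * Λ ≤ 2 ^ (n + 2) * (D * α (n + 1)) := by gcongr
            _ = _ := by field_simp; ring
      -- The bound with exponent 0 lives at level `m + 1`; the single costly step leads down to
      -- level `m`.
      · obtain ⟨m, rfl⟩ : ∃ m, n = m + 1 := ⟨n - 1, by omega⟩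
        have h0 := cellBound_content_zero (lam := lam) (β := β) (M := M) (n := m + 1) hη hα
          (s := 1 + t) (by linarith) (r := r) (le_trans (ENNReal.ofReal_le_ofReal ?_) hsm)
        · have hΛ0 : 0 < Real.log (β (m + 2) / α (m + 2)) :=
            Real.log_pos ((one_lt_div (hα0 _)).2 (hαβ _))
          have h1 := hC₂le lam α β M (1 + t) hlam hα (fun n => (hαβ n).le) _ m _ (by positivity) h0
          rw [add_sub_cancel_left] at h1
          have h2 := hCle lam α β hlam hα _ m
            ((2 ^ (m + 1)) ^ (1 + t) * C₂ * (Real.log (β (m + 2) / α (m + 2)) + 1))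
            (by positivity) (by rw [add_sub_cancel_left]; exact h1)
          refine h2.trans (ENNReal.ofReal_le_ofReal ?_)
          have hu0 : 0 ≤ u (m + 1) := by
            have : 0 < D := by linarith
            positivity
          refine le_trans ?_ (le_add_of_nonneg_left hu0)
          rw [add_sub_cancel_left, prod_rpow_neg hα0, pow_rpow_comm (by norm_num)]
          calc (2 ^ (1 + t)) ^ (m + 1) * C₂ * (Real.log (β (m + 2) / α (m + 2)) + 1) *
                C ^ (m + 1) * Real.exp (-t * logProd α (m + 1))
              ≤ (2 ^ (1 + t)) ^ (m + 1) * C₂ * (B ^ (m + 1) * Real.exp (τ * logProd α (m + 1))) *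
                C ^ (m + 1) * Real.exp (-t * logProd α (m + 1)) := by gcongr
            _ = v (m + 1) := by
                simp only [v, T]
                rw [show -(t - τ) * logProd α (m + 1) = τ * logProd α (m + 1) +
                  -t * logProd α (m + 1) by ring, Real.exp_add]
                ring
        · rw [← exp_logProd hα0, neg_one_mul, Real.exp_neg, ← div_eq_mul_inv]
          exact le_mul_of_one_le_left (by positivity) (by linarith)
    have huv : Tendsto (fun n => ENNReal.ofReal (u n + v n)) atTop (𝓝 0) := by
      have := (ENNReal.continuous_ofReal.tendsto _).comp (hu.add hv)
      rw [add_zero, ENNReal.ofReal_zero] at this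
      exact this
    by_contra hne
    obtain ⟨n, hn1, hn2⟩ :=
      (key.and_eventually (huv.eventually_lt_const (pos_iff_ne_zero.2 hne))).exists
    exact absurd hn1 (not_le.2 hn2)
  have hzero := hausdorffMeasure_eq_zero_of_content hcontent
  refine dimH_le_of_hausdorffMeasure_ne_top (d := (1 + t).toNNReal) ?_
  rw [Real.coe_toNNReal _ (by linarith), hzero]
  exact ENNReal.zero_ne_top

end HausdorffUpper

/-! ### Area and length estimates for separated points in a strip. -/

section Separated

variable {ι : Type*}

theorem sum_volume_le_of_pairwiseDisjoint {E : Type*} [MeasureSpace E] (Q : Finset ι)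
    (A : ι → Set E) {S : Set E} (hA : ∀ i ∈ Q, MeasurableSet (A i))
    (hd : (Q : Set ι).PairwiseDisjoint A) (hS : ∀ i ∈ Q, A i ⊆ S) :
    ∑ i ∈ Q, volume (A i) ≤ volume S := by
  rw [← measure_biUnion_finset hd hA]
  exact measure_mono (Set.iUnion₂_subset hS)

theorem disjoint_Ioo_of_le {a b r r' : ℝ} (h : r + r' ≤ |a - b|) :
    Disjoint (Set.Ioo (a - r) (a + r)) (Set.Ioo (b - r') (b + r')) := by
  rw [Set.disjoint_left]
  rintro x ⟨h1, h2⟩ ⟨h3, h4⟩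
  rcases le_abs.1 h with h | h <;> linarith

/-- Open squares of side `R i / 2` around the points are disjoint, because two points differ by at
least `(R i + R j) / 4` in one coordinate. They lie in a rectangle of size `3 * Λ` by `6 * x`;
compare areas. -/
theorem sum_sq_le_of_separated (Q : Finset ι) (w : ι → ℂ) (R : ι → ℝ) {l Λ x : ℝ} (hx : 0 ≤ x)
    (hR : ∀ i ∈ Q, 0 ≤ R i) (hRx : ∀ i ∈ Q, R i ≤ x) (hRΛ : ∀ i ∈ Q, R i ≤ 2 * Λ) (hΛ : 0 ≤ Λ)
    (hre : ∀ i ∈ Q, (w i).re ∈ Set.Icc l (l + Λ)) (him : ∀ i ∈ Q, |(w i).im| ≤ 2 * x)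
    (hsep : ∀ i ∈ Q, ∀ j ∈ Q, i ≠ j → R i ≤ ‖w i - w j‖) :
    ∑ i ∈ Q, R i ^ 2 ≤ 72 * (x * Λ) := by
  let A : ι → Set (ℝ × ℝ) := fun i =>
    Set.Ioo ((w i).re - R i / 4) ((w i).re + R i / 4) ×ˢ
      Set.Ioo ((w i).im - R i / 4) ((w i).im + R i / 4)
  have h := sum_volume_le_of_pairwiseDisjoint Q A
    (S := Set.Ioo (l - Λ) (l + 2 * Λ) ×ˢ Set.Ioo (-(3 * x)) (3 * x))
    (fun i _ => measurableSet_Ioo.prod measurableSet_Ioo) ?_ ?_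
  · have hvol : ∀ i ∈ Q, volume (A i) = ENNReal.ofReal (R i ^ 2 / 4) := by
      intro i hi
      have := hR i hi
      simp only [A]
      rw [Measure.volume_eq_prod, Measure.prod_prod, Real.volume_Ioo, Real.volume_Ioo,
        ← ENNReal.ofReal_mul (by linarith)]
      congr 1; ring
    rw [Finset.sum_congr rfl hvol, ← ENNReal.ofReal_sum_of_nonneg (fun i _ => by positivity),
      Measure.volume_eq_prod, Measure.prod_prod, Real.volume_Ioo, Real.volume_Ioo,
      ← ENNReal.ofReal_mul (by linarith), ENNReal.ofReal_le_ofReal_iff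
      (mul_nonneg (by linarith) (by linarith)), ← Finset.sum_div] at h
    linarith
  · intro i hi j hj hij
    have h1 := hsep i hi j hj hij
    have h2 := hsep j hj i hi hij.symm
    rw [norm_sub_rev] at h2
    have h3 := Complex.norm_le_abs_re_add_abs_im (w i - w j)
    rw [Complex.sub_re, Complex.sub_im] at h3
    rw [Function.onFun, Set.disjoint_prod]
    by_cases hc : R i / 4 + R j / 4 ≤ |(w i).re - (w j).re|
    · exact Or.inl (disjoint_Ioo_of_le hc)
    · exact Or.inr (disjoint_Ioo_of_le (by linarith))
  · intro i hi
    have h1 := hRx i hi; have h2 := hRΛ i hi; have h3 := hre i hi; have h4 := abs_le.1 (him i hi)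
    have h5 := hR i hi
    exact Set.prod_mono (Set.Ioo_subset_Ioo (by linarith [h3.1]) (by linarith [h3.2]))
      (Set.Ioo_subset_Ioo (by linarith) (by linarith))

/-- The strip is narrow relative to the radii, so the separation is already vertical: intervals of
length `R i / 2` around the imaginary parts are disjoint. Compare lengths. -/
theorem sum_le_of_separated (Q : Finset ι) (w : ι → ℂ) (R : ι → ℝ) {l Λ x : ℝ} (hx : 0 ≤ x)
    (hR : ∀ i ∈ Q, 0 ≤ R i) (hRx : ∀ i ∈ Q, R i ≤ x) (hRΛ : ∀ i ∈ Q, 2 * Λ ≤ R i)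
    (hre : ∀ i ∈ Q, (w i).re ∈ Set.Icc l (l + Λ)) (him : ∀ i ∈ Q, |(w i).im| ≤ 2 * x)
    (hsep : ∀ i ∈ Q, ∀ j ∈ Q, i ≠ j → R i ≤ ‖w i - w j‖) :
    ∑ i ∈ Q, R i ≤ 12 * x := by
  have h := sum_volume_le_of_pairwiseDisjoint Q
    (fun i => Set.Ioo ((w i).im - R i / 4) ((w i).im + R i / 4))
    (S := Set.Ioo (-(3 * x)) (3 * x)) (fun i _ => measurableSet_Ioo) ?_ ?_
  · have hvol : ∀ i ∈ Q, volume (Set.Ioo ((w i).im - R i / 4) ((w i).im + R i / 4)) =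
        ENNReal.ofReal (R i / 2) := by
      intro i hi
      rw [Real.volume_Ioo]
      congr 1; ring
    rw [Finset.sum_congr rfl hvol,
      ← ENNReal.ofReal_sum_of_nonneg (fun i hi => by have := hR i hi; positivity),
      Real.volume_Ioo, ENNReal.ofReal_le_ofReal_iff (by linarith), ← Finset.sum_div] at h
    linarith
  · intro i hi j hj hij
    have h1 := hsep i hi j hj hij
    have h2 := hsep j hj i hi hij.symm
    rw [norm_sub_rev] at h2
    have h3 := Complex.norm_le_abs_re_add_abs_im (w i - w j)
    rw [Complex.sub_re, Complex.sub_im] at h3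
    have h4 : |(w i).re - (w j).re| ≤ Λ := by
      have a := hre i hi; have b := hre j hj
      rw [abs_le]; constructor <;> linarith [a.1, a.2, b.1, b.2]
    refine disjoint_Ioo_of_le ?_
    linarith [hRΛ i hi, hRΛ j hj]
  · intro i hi
    have h1 := hRx i hi; have h4 := abs_le.1 (him i hi); have h5 := hR i hi
    exact Set.Ioo_subset_Ioo (by linarith) (by linarith)

end Separated

/-! ### The upper bound for packing sums. -/

section PackingMass

/-- The outer measure with mass `(2 * r) ^ s` at the centre of every ball of radius `r` of a finite
family. -/
noncomputable def packingMass (s : ℝ) (Q : Finset (ℂ × ℝ)) : OuterMeasure ℂ :=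
  ∑ p ∈ Q, ENNReal.ofReal (2 * p.2) ^ s • OuterMeasure.dirac p.1

open Classical in
theorem packingMass_apply (s : ℝ) (Q : Finset (ℂ × ℝ)) (X : Set ℂ) :
    packingMass s Q X = ∑ p ∈ Q with p.1 ∈ X, ENNReal.ofReal (2 * p.2) ^ s := by
  have h : packingMass s Q X =
      ∑ p ∈ Q, (ENNReal.ofReal (2 * p.2) ^ s • OuterMeasure.dirac p.1 : OuterMeasure ℂ) X := by
    rw [packingMass]
    induction Q using Finset.induction_on with
    | empty => simp
    | insert p Q hp ih => rw [Finset.sum_insert hp, Finset.sum_insert hp, ← ih]; rfl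
  rw [h, Finset.sum_filter]
  refine Finset.sum_congr rfl fun p _ => ?_
  simp [OuterMeasure.dirac_apply, Set.indicator]

variable {lam : ℕ → ℂ} {α β : ℕ → ℝ} {M η s t : ℝ}

/-- The radius of a ball seen through `iter lam n`, up to the distortion constant `2 ^ n`. -/
noncomputable def scaledRadius (lam : ℕ → ℂ) (n : ℕ) (p : ℂ × ℝ) : ℝ :=
  derivNorm lam n p.1 * p.2 / 2 ^ n

theorem scaledRadius_succ (n : ℕ) (p : ℂ × ℝ) :
    scaledRadius lam (n + 1) p = scaledRadius lam n p * (‖iter lam (n + 1) p.1‖ / 2) := by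
  rw [scaledRadius, scaledRadius, derivNorm_succ]
  field_simp
  ring

theorem radius_le_of_isPacking {K : Set ℂ} {δ : ℝ} {P : Finset (ℂ × ℝ)} (hP : IsPacking K δ P)
    {p q : ℂ × ℝ} (hp : p ∈ P) (hq : q ∈ P) (hpq : p ≠ q) : p.2 ≤ ‖p.1 - q.1‖ := by
  have hd := hP.2 hp hq hpq
  by_contra hcon
  push Not at hcon
  have hmem : q.1 ∈ Metric.closedBall p.1 p.2 := by
    rw [Metric.mem_closedBall, dist_eq_norm, norm_sub_rev]; exact hcon.le
  exact Set.disjoint_left.1 hd hmem (Metric.mem_closedBall_self (hP.1 q hq).2.1.le)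

theorem packingPremeasure_two_ne_top {K : Set ℂ} (hM : 0 ≤ M) (hK : ∀ z ∈ K, ‖z‖ ≤ M) :
    packingPremeasure 2 K ≠ ∞ := by
  refine ne_top_of_le_ne_top (b := ENNReal.ofReal (4 * (72 * ((M + 1) * (2 * M + 1)))))
    ENNReal.ofReal_ne_top ((iInf₂_le 1 one_pos).trans (iSup₂_le fun P hP => ?_))
  have h := sum_sq_le_of_separated P (fun p => p.1) (fun p => p.2) (l := -M) (Λ := 2 * M + 1)
    (x := M + 1) (by linarith) (fun p hp => (hP.1 p hp).2.1.le)
    (fun p hp => (hP.1 p hp).2.2.trans (by linarith))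
    (fun p hp => (hP.1 p hp).2.2.trans (by linarith)) (by linarith) ?_ ?_
    fun p hp q hq hpq => radius_le_of_isPacking hP hp hq hpq
  · have h1 : ∀ p ∈ P, ENNReal.ofReal (2 * p.2) ^ (2 : ℝ) = ENNReal.ofReal (4 * p.2 ^ 2) := by
      intro p hp
      rw [ENNReal.ofReal_rpow_of_nonneg (by linarith [(hP.1 p hp).2.1]) (by norm_num),
        Real.rpow_two]
      congr 1; ring
    rw [Finset.sum_congr rfl h1, ← ENNReal.ofReal_sum_of_nonneg (fun p _ => by positivity),
      ← Finset.mul_sum]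
    exact ENNReal.ofReal_le_ofReal (by linarith)
  · intro p hp
    have := abs_le.1 ((Complex.abs_re_le_norm p.1).trans (hK _ (hP.1 p hp).1))
    constructor <;> linarith
  · intro p hp
    have := (Complex.abs_im_le_norm p.1).trans (hK _ (hP.1 p hp).1)
    linarith

/-- Disjointness puts each centre outside the other balls, and bounded distortion carries this
separation over to the images. -/
theorem scaledRadius_le_of_isPacking {K : Set ℂ} {δ : ℝ} {P : Finset (ℂ × ℝ)} (hP : IsPacking K δ P)
    {p q : ℂ × ℝ} (hp : p ∈ P) (hq : q ∈ P) (hpq : p ≠ q) {n : ℕ}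
    (h : ∀ k < n, ‖iter lam k p.1 - iter lam k q.1‖ ≤ 1 / 2) :
    scaledRadius lam n p ≤ ‖iter lam n p.1 - iter lam n q.1‖ := by
  have h1 : p.2 ≤ ‖q.1 - p.1‖ := by
    rw [norm_sub_rev]; exact radius_le_of_isPacking hP hp hq hpq
  have h2 := derivNorm_mul_norm_sub_le (lam := lam) (z := q.1) (w := p.1) (n := n)
    (fun k hk => by rw [norm_sub_rev]; exact h k hk)
  rw [scaledRadius, div_le_iff₀ (by positivity), mul_comm _ ((2 : ℝ) ^ n), norm_sub_rev]
  refine le_trans ?_ h2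
  gcongr
  exact derivNorm_nonneg _ _

theorem ofReal_two_mul_rpow_le {n : ℕ} {d x : ℝ} (hs : 0 ≤ s) (hd : 0 < d) (hx : 0 < x)
    {p : ℂ × ℝ} (hp : 0 < p.2) (h1 : d ≤ derivNorm lam n p.1) (h2 : x ≤ ‖iter lam (n + 1) p.1‖) :
    ENNReal.ofReal (2 * p.2) ^ s ≤ ENNReal.ofReal
      ((2 ^ (n + 2)) ^ s * d ^ (-s) * x ^ (-s) * scaledRadius lam (n + 1) p ^ s) := by
  rw [ENNReal.ofReal_rpow_of_nonneg (by positivity) hs]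
  refine ENNReal.ofReal_le_ofReal ?_
  have hR0 : 0 ≤ scaledRadius lam (n + 1) p := by
    have := derivNorm_nonneg (lam := lam) (n + 1) p.1
    unfold scaledRadius; positivity
  have h3 : 2 * p.2 ≤ 2 ^ (n + 2) * scaledRadius lam (n + 1) p / (d * x) := by
    rw [le_div_iff₀ (by positivity), scaledRadius, derivNorm_succ]
    have h4 : d * x ≤ derivNorm lam n p.1 * ‖iter lam (n + 1) p.1‖ :=
      mul_le_mul h1 h2 hx.le (derivNorm_nonneg _ _)
    calc 2 * p.2 * (d * x) ≤ 2 * p.2 * (derivNorm lam n p.1 * ‖iter lam (n + 1) p.1‖) := by gcongr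
      _ = _ := by rw [pow_succ (2 : ℝ) (n + 1)]; field_simp
  calc (2 * p.2) ^ s ≤ (2 ^ (n + 2) * scaledRadius lam (n + 1) p / (d * x)) ^ s := by gcongr
    _ = _ := by
      rw [Real.div_rpow (by positivity) (by positivity), Real.mul_rpow (by positivity) hR0,
        Real.mul_rpow hd.le hx.le, Real.rpow_neg hd.le, Real.rpow_neg hx.le]
      field_simp

theorem re_iter_mem_Icc (hlam : ∀ n, lam (n + 1) ≠ 0) (hη : 0 < η) (hα : ∀ n, η ≤ α (n + 1))
    {z : ℂ} (hz : z ∈ boundedRateSet lam α β M) (n : ℕ) :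
    (iter lam n z).re ∈ Set.Icc (Real.log (α (n + 1)) - Real.log ‖lam (n + 1)‖)
      (Real.log (α (n + 1)) - Real.log ‖lam (n + 1)‖ + Real.log (β (n + 1) / α (n + 1))) := by
  have h1 := hz.2 n
  have hα0 := hη.trans_le (hα n)
  rw [re_iter_eq hlam, Real.log_div (hα0.trans_le (h1.1.trans h1.2)).ne' hα0.ne']
  have a1 := Real.log_le_log hα0 h1.1
  have a3 := Real.log_le_log (hα0.trans_le h1.1) h1.2
  constructor <;> linarith

/-- Write `R` for the scaled radius of order `n + 1`. From `1 ≤ R` and `s ≤ 2` one has `R ^ s ≤ R ^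
2`, so the area estimate applies. It needs `R ≤ x`, which holds because the scaled radius of order
`n` is below 1 and the next modulus is at most `2 * x`. -/
theorem cellBound_packingMass_of_le (hlam : ∀ n, lam (n + 1) ≠ 0) (hη : 0 < η)
    (hα : ∀ n, η ≤ α (n + 1)) (hs : 0 ≤ s) (hs2 : s ≤ 2) {n : ℕ} {δ Λ : ℝ}
    (hΛ : Λ = Real.log (β (n + 2) / α (n + 2))) (hΛ0 : 0 ≤ Λ) {P Q : Finset (ℂ × ℝ)}
    (hP : IsPacking (boundedRateSet lam α β M) δ P) (hQP : Q ⊆ P)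
    (hQ : ∀ p ∈ Q, scaledRadius lam n p < 1 ∧ 1 ≤ scaledRadius lam (n + 1) p ∧
      scaledRadius lam (n + 1) p ≤ 2 * Λ) :
    CellBound lam (boundedRateSet lam α β M) η s (packingMass s Q) n (s - 1)
      (72 * (2 ^ (n + 2)) ^ s * Λ) := by
  classical
  intro d x X hd hx hX
  have hx0 : 0 < x := hη.trans_le hx
  rw [packingMass_apply]
  set Q' := Q.filter fun p => p.1 ∈ X
  have hQ' : ∀ p ∈ Q', p ∈ Q ∧ p.1 ∈ X := fun p hp => Finset.mem_filter.1 hp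
  have hsum := sum_sq_le_of_separated Q' (fun p => iter lam (n + 1) p.1)
    (scaledRadius lam (n + 1)) (Λ := Λ)
    (l := Real.log (α (n + 2)) - Real.log ‖lam (n + 2)‖) hx0.le
    (fun p hp => zero_le_one.trans (hQ p (hQ' p hp).1).2.1) ?_
    (fun p hp => (hQ p (hQ' p hp).1).2.2) hΛ0 ?_ ?_ ?_
  · calc _ ≤ ∑ p ∈ Q', ENNReal.ofReal ((2 ^ (n + 2)) ^ s * d ^ (-s) * x ^ (-s) *
          scaledRadius lam (n + 1) p ^ 2) := by
          refine Finset.sum_le_sum fun p hp => ?_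
          refine (ofReal_two_mul_rpow_le hs hd hx0 (hP.1 p (hQP (hQ' p hp).1)).2.1
            (hX.le_derivNorm _ (hQ' p hp).2) (hX.le_norm _ (hQ' p hp).2)).trans
            (ENNReal.ofReal_le_ofReal ?_)
          gcongr
          rw [← Real.rpow_natCast]
          exact Real.rpow_le_rpow_of_exponent_le (hQ p (hQ' p hp).1).2.1 (by exact_mod_cast hs2)
      _ ≤ _ := by
          rw [← ENNReal.ofReal_sum_of_nonneg (fun p _ => by positivity), ← Finset.mul_sum]
          refine ENNReal.ofReal_le_ofReal ?_
          have h3 : x ^ (-(s - 1)) = x * x ^ (-s) := by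
            rw [show -(s - 1) = 1 + -s by ring, Real.rpow_add hx0, Real.rpow_one]
          calc _ ≤ (2 ^ (n + 2)) ^ s * d ^ (-s) * x ^ (-s) * (72 * (x * Λ)) := by gcongr
            _ = _ := by rw [h3]; ring
  · intro p hp
    rw [scaledRadius_succ]
    have h1 := (hQ p (hQ' p hp).1).1
    have h2 := hX.norm_le _ (hQ' p hp).2
    have h3 := norm_nonneg (iter lam (n + 1) p.1)
    nlinarith
  · intro p hp
    rw [hΛ]
    exact re_iter_mem_Icc hlam hη hα (hX.subset (hQ' p hp).2) (n + 1)
  · exact fun p hp => (Complex.abs_im_le_norm _).trans (hX.norm_le _ (hQ' p hp).2)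
  · intro p hp q hq hpq
    exact scaledRadius_le_of_isPacking hP (hQP (hQ' p hp).1) (hQP (hQ' q hq).1) hpq fun k hk =>
      hX.norm_sub_le _ (hQ' p hp).2 _ (hQ' q hq).2 k (by omega)

/-- Here `R ≤ x` gives `R ^ s ≤ x ^ (s - 1) * R`, and the length estimate bounds the sum of the `R`.
All powers of `x` cancel, which leaves the exponent 0 without a factor `Λ`. -/
theorem cellBound_packingMass_of_ge (hlam : ∀ n, lam (n + 1) ≠ 0) (hη : 0 < η)
    (hα : ∀ n, η ≤ α (n + 1)) (hs : 1 ≤ s) {n : ℕ} {δ Λ : ℝ}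
    (hΛ : Λ = Real.log (β (n + 2) / α (n + 2))) {P Q : Finset (ℂ × ℝ)}
    (hP : IsPacking (boundedRateSet lam α β M) δ P) (hQP : Q ⊆ P)
    (hQ : ∀ p ∈ Q, scaledRadius lam n p < 1 ∧ 1 ≤ scaledRadius lam (n + 1) p ∧
      2 * Λ ≤ scaledRadius lam (n + 1) p) :
    CellBound lam (boundedRateSet lam α β M) η s (packingMass s Q) n 0
      (12 * (2 ^ (n + 2)) ^ s) := by
  classical
  intro d x X hd hx hX
  have hx0 : 0 < x := hη.trans_le hx
  rw [packingMass_apply]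
  set Q' := Q.filter fun p => p.1 ∈ X
  have hQ' : ∀ p ∈ Q', p ∈ Q ∧ p.1 ∈ X := fun p hp => Finset.mem_filter.1 hp
  have hRx : ∀ p ∈ Q', scaledRadius lam (n + 1) p ≤ x := by
    intro p hp
    rw [scaledRadius_succ]
    have h1 := (hQ p (hQ' p hp).1).1
    have h2 := hX.norm_le _ (hQ' p hp).2
    have h3 := norm_nonneg (iter lam (n + 1) p.1)
    nlinarith
  have hsum := sum_le_of_separated Q' (fun p => iter lam (n + 1) p.1)
    (scaledRadius lam (n + 1)) (Λ := Λ)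
    (l := Real.log (α (n + 2)) - Real.log ‖lam (n + 2)‖) hx0.le
    (fun p hp => zero_le_one.trans (hQ p (hQ' p hp).1).2.1) hRx
    (fun p hp => (hQ p (hQ' p hp).1).2.2) ?_ ?_ ?_
  · calc _ ≤ ∑ p ∈ Q', ENNReal.ofReal ((2 ^ (n + 2)) ^ s * d ^ (-s) * x ^ (-s) * x ^ (s - 1) *
          scaledRadius lam (n + 1) p) := by
          refine Finset.sum_le_sum fun p hp => ?_
          refine (ofReal_two_mul_rpow_le (zero_le_one.trans hs) hd hx0 (hP.1 p (hQP (hQ' p hp).1)).2.1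
            (hX.le_derivNorm _ (hQ' p hp).2) (hX.le_norm _ (hQ' p hp).2)).trans
            (ENNReal.ofReal_le_ofReal ?_)
          have hR1 := (hQ p (hQ' p hp).1).2.1
          have hR0 : 0 < scaledRadius lam (n + 1) p := by linarith
          have h5 : scaledRadius lam (n + 1) p ^ s =
              scaledRadius lam (n + 1) p ^ (s - 1) * scaledRadius lam (n + 1) p := by
            rw [Real.rpow_sub_one hR0.ne']; field_simp
          have h6 : scaledRadius lam (n + 1) p ^ (s - 1) ≤ x ^ (s - 1) :=
            Real.rpow_le_rpow hR0.le (hRx p hp) (by linarith)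
          rw [h5, ← mul_assoc]
          gcongr
      _ ≤ _ := by
          rw [← ENNReal.ofReal_sum_of_nonneg (fun p hp => by
            have hR1 := (hQ p (hQ' p hp).1).2.1
            have hR0 : 0 < scaledRadius lam (n + 1) p := by linarith
            positivity), ← Finset.mul_sum]
          refine ENNReal.ofReal_le_ofReal ?_
          have h3 : x ^ (-s) * x ^ (s - 1) * x = 1 := by
            rw [← Real.rpow_add hx0, ← Real.rpow_add_one hx0.ne',
              show -s + (s - 1) + 1 = 0 by ring, Real.rpow_zero]
          calc _ ≤ (2 ^ (n + 2)) ^ s * d ^ (-s) * x ^ (-s) * x ^ (s - 1) * (12 * x) := by gcongr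
            _ = 12 * (2 ^ (n + 2)) ^ s * d ^ (-s) * (x ^ (-s) * x ^ (s - 1) * x) := by ring
            _ = _ := by rw [h3]; simp
  · intro p hp
    rw [hΛ]
    exact re_iter_mem_Icc hlam hη hα (hX.subset (hQ' p hp).2) (n + 1)
  · exact fun p hp => (Complex.abs_im_le_norm _).trans (hX.norm_le _ (hQ' p hp).2)
  · intro p hp q hq hpq
    exact scaledRadius_le_of_isPacking hP (hQP (hQ' p hp).1) (hQP (hQ' q hq).1) hpq fun k hk =>
      hX.norm_sub_le _ (hQ' p hp).2 _ (hQ' q hq).2 k (by omega)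

/-- The derivative grows faster than `2 ^ n`, so the scaled radius eventually reaches 1; take the
first such order, which is at least 2 by assumption. -/
theorem exists_scaledRadius_lt_one_le (hη : 0 < η) (hα : ∀ n, η ≤ α (n + 1))
    (hL : Tendsto (fun n : ℕ => logProd α n / n) atTop atTop) {p : ℂ × ℝ}
    (hp : p.1 ∈ boundedRateSet lam α β M) (hr : 0 < p.2) (hr1 : scaledRadius lam 0 p < 1)
    (hr2 : scaledRadius lam 1 p < 1) :
    ∃ n, scaledRadius lam (n + 1) p < 1 ∧ 1 ≤ scaledRadius lam (n + 2) p := by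
  classical
  have hex : ∃ n, 1 ≤ scaledRadius lam n p := by
    have h1 := tendsto_pow_mul_exp hL one_pos (C := 2) (by norm_num)
    obtain ⟨n, hn⟩ := (h1.eventually_lt_const hr).exists
    refine ⟨n, ?_⟩
    rw [neg_one_mul, Real.exp_neg, exp_logProd fun n => hη.trans_le (hα n)] at hn
    have hP : 0 < ∏ k ∈ Finset.range n, α (k + 1) :=
      Finset.prod_pos fun k _ => hη.trans_le (hα k)
    rw [← div_eq_mul_inv, div_lt_iff₀ hP] at hn
    rw [scaledRadius, one_le_div (by positivity)]
    calc (2 : ℝ) ^ n ≤ p.2 * ∏ k ∈ Finset.range n, α (k + 1) := hn.le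
      _ ≤ p.2 * derivNorm lam n p.1 := by gcongr; exact prod_le_derivNorm hη hα hp n
      _ = _ := mul_comm _ _
  have hspec := Nat.find_spec hex
  have h0 : Nat.find hex ≠ 0 := fun h => by rw [h] at hspec; linarith
  have h1 : Nat.find hex ≠ 1 := fun h => by rw [h] at hspec; linarith
  obtain ⟨n, hn⟩ : ∃ n, Nat.find hex = n + 2 := ⟨Nat.find hex - 2, by omega⟩
  refine ⟨n, ?_, by rw [← hn]; exact hspec⟩
  have := Nat.find_min hex (m := n + 1) (by omega)
  exact not_le.1 this

/-- The balls are grouped by the level at which they reach unit size. Every level contributes, so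
the bound on the moduli is needed for all large `n`, and `τ < t` makes the contributions summable.
-/
theorem packingPremeasure_boundedRateSet_ne_top (hlam : ∀ n, lam (n + 1) ≠ 0) (hη : 0 < η)
    (hα : ∀ n, η ≤ α (n + 1)) (hαβ : ∀ n, α (n + 1) < β (n + 1)) (hM : 0 ≤ M) (ht : 0 < t)
    (ht1 : t ≤ 1) (hL : Tendsto (fun n : ℕ => logProd α n / n) atTop atTop) {B τ : ℝ}
    (hτ : τ < t) (h : ∀ᶠ n in atTop,
      Real.log (β (n + 1) / α (n + 1)) + 1 ≤ B ^ n * Real.exp (τ * logProd α n)) :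
    packingPremeasure (1 + t) (boundedRateSet lam α β M) ≠ ∞ := by
  classical
  have hα0 : ∀ n, 0 < α (n + 1) := fun n => hη.trans_le (hα n)
  set K := boundedRateSet lam α β M
  have hΛ0 : ∀ n, 0 < Real.log (β (n + 1) / α (n + 1)) := fun n =>
    Real.log_pos ((one_lt_div (hα0 _)).2 (hαβ _))
  obtain ⟨C, hC, hCle⟩ := exists_measure_le_of_cellBound (s := 1 + t) hη hM (by linarith)
  obtain ⟨C₂, hC₂, hC₂le⟩ := exists_cellBound_of_succ_zero hη
  set T : ℝ := 2 ^ (1 + t)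
  have hT : 0 < T := by positivity
  let g : ℕ → ℝ := fun n => (Real.log (β (n + 1) / α (n + 1)) + 1) *
    ((T * C) ^ n * Real.exp (-t * logProd α n))
  have hg0 : ∀ n, 0 ≤ g n := fun n => by
    have := hΛ0 n
    positivity
  have hg : Summable g := by
    refine summable_of_isBigO_nat (summable_geometric_of_lt_one (r := 1 / 2) (by norm_num)
      (by norm_num)) (Asymptotics.IsBigO.of_bound 1 ?_)
    filter_upwards [h, eventually_pow_mul_exp_le hL (sub_pos.2 hτ) (T * C * B)] with n hn1 hn2
    rw [Real.norm_of_nonneg (hg0 n), Real.norm_of_nonneg (by positivity), one_mul]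
    refine le_trans ?_ hn2
    calc g n ≤ (B ^ n * Real.exp (τ * logProd α n)) *
          ((T * C) ^ n * Real.exp (-t * logProd α n)) := by simp only [g]; gcongr
      _ = (T * C * B) ^ n * (Real.exp (τ * logProd α n) * Real.exp (-t * logProd α n)) := by ring
      _ = _ := by rw [← Real.exp_add]; congr 2; ring
  let c₁ : ℝ := 72 * T
  let c₂ : ℝ := 12 * T ^ 2 * C₂
  let G : ℕ → ℝ := fun n => c₁ * g (n + 2) + c₂ * g (n + 1)
  have hGsum : Summable G :=
    (((summable_nat_add_iff 2).2 hg).mul_left c₁).add (((summable_nat_add_iff 1).2 hg).mul_left c₂)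
  have hG0 : ∀ n, 0 ≤ G n := fun n => by
    have := hg0 (n + 1); have := hg0 (n + 2)
    positivity
  -- This bound on the radii keeps the scaled radii of orders 0 and 1 below 1.
  set δ : ℝ := min (1 / 2) (1 / β 1)
  have hβ1 : 0 < β 1 := (hα0 0).trans (hαβ 0)
  have hδ : 0 < δ := by positivity
  have key : packingSup (1 + t) δ K ≤ ENNReal.ofReal (∑' n, G n) := by
    refine iSup₂_le fun P hP => ?_
    have hex : ∀ p ∈ P, ∃ n, scaledRadius lam (n + 1) p < 1 ∧ 1 ≤ scaledRadius lam (n + 2) p := by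
      intro p hp
      obtain ⟨hpK, hp0, hpδ⟩ := hP.1 p hp
      refine exists_scaledRadius_lt_one_le hη hα hL hpK hp0 ?_ ?_
      · simp only [scaledRadius, derivNorm_zero]
        have := hpδ.trans (min_le_left _ _)
        norm_num; linarith
      · have h1 := hpδ.trans (min_le_right _ _)
        rw [le_div_iff₀ hβ1] at h1
        have h2 := (hpK.2 0).2
        simp only [scaledRadius, derivNorm, Finset.range_one, Finset.prod_singleton, zero_add,
          pow_one] at h2 ⊢
        rw [div_lt_one (by norm_num)]
        nlinarith
    choose! f hf using hex
    have hlevel : ∀ n, ∑ p ∈ P with f p = n, ENNReal.ofReal (2 * p.2) ^ (1 + t) ≤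
        ENNReal.ofReal (G n) := by
      intro n
      set Λ := Real.log (β (n + 3) / α (n + 3)) with hΛ
      have hΛpos : 0 < Λ := hΛ0 (n + 2)
      set Q := P.filter fun p => f p = n
      have hQ : ∀ p ∈ Q, p ∈ P ∧ scaledRadius lam (n + 1) p < 1 ∧
          1 ≤ scaledRadius lam (n + 2) p := by
        intro p hp
        obtain ⟨hpP, hpn⟩ := Finset.mem_filter.1 hp
        exact ⟨hpP, hpn ▸ hf p hpP⟩
      set Q₁ := Q.filter fun p => scaledRadius lam (n + 2) p ≤ 2 * Λ
      set Q₂ := Q.filter fun p => ¬ scaledRadius lam (n + 2) p ≤ 2 * Λ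
      have hQ1P : Q₁ ⊆ P := (Finset.filter_subset _ _).trans (Finset.filter_subset _ _)
      have hQ2P : Q₂ ⊆ P := (Finset.filter_subset _ _).trans (Finset.filter_subset _ _)
      have b₁ := cellBound_packingMass_of_le (n := n + 1) (s := 1 + t) hlam hη hα (by linarith)
        (by linarith) hΛ hΛpos.le hP hQ1P fun p hp => by
          obtain ⟨h1, h2⟩ := Finset.mem_filter.1 hp
          exact ⟨(hQ p h1).2.1, (hQ p h1).2.2, h2⟩
      have b₂ := cellBound_packingMass_of_ge (n := n + 1) (s := 1 + t) hlam hη hα (by linarith)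
        hΛ hP hQ2P fun p hp => by
          obtain ⟨h1, h2⟩ := Finset.mem_filter.1 hp
          exact ⟨(hQ p h1).2.1, (hQ p h1).2.2, (not_le.1 h2).le⟩
      have b₃ := hC₂le lam α β M (1 + t) hlam hα (fun n => (hαβ n).le) _ n _ (by positivity) b₂
      have e₁ := hCle lam α β hlam hα _ (n + 1) _ (by positivity) b₁
      have e₂ := hCle lam α β hlam hα _ n _ (by have := hΛ0 (n + 1); positivity) b₃
      have hall : ∀ Q' ⊆ P, packingMass (1 + t) Q' K =
          ∑ p ∈ Q', ENNReal.ofReal (2 * p.2) ^ (1 + t) := by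
        intro Q' hQ'
        rw [packingMass_apply, Finset.filter_true_of_mem fun p hp => (hP.1 p (hQ' hp)).1]
      rw [← Finset.sum_filter_add_sum_filter_not Q fun p => scaledRadius lam (n + 2) p ≤ 2 * Λ,
        ← hall Q₁ hQ1P, ← hall Q₂ hQ2P]
      refine (add_le_add e₁ e₂).trans ?_
      have := hΛ0 (n + 1)
      rw [← ENNReal.ofReal_add
        (mul_nonneg (by positivity) (Finset.prod_nonneg fun k _ => by have := hα0 k; positivity))
        (mul_nonneg (by positivity) (Finset.prod_nonneg fun k _ => by have := hα0 k; positivity))]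
      refine ENNReal.ofReal_le_ofReal (add_le_add ?_ ?_)
      · rw [add_sub_cancel_left, prod_rpow_neg hα0, pow_rpow_comm (by norm_num)]
        calc 72 * (2 ^ (1 + t)) ^ (n + 1 + 2) * Λ * C ^ (n + 1 + 1) *
              Real.exp (-t * logProd α (n + 1 + 1))
            ≤ 72 * (2 ^ (1 + t)) ^ (n + 1 + 2) * (Λ + 1) * C ^ (n + 1 + 1) *
              Real.exp (-t * logProd α (n + 1 + 1)) := by gcongr; linarith
          _ = c₁ * g (n + 2) := by simp only [c₁, g, T, hΛ]; ring
      · rw [add_sub_cancel_left, prod_rpow_neg hα0, pow_rpow_comm (by norm_num)]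
        refine le_of_eq ?_
        simp only [c₂, g, T]; ring
    calc ∑ p ∈ P, ENNReal.ofReal (2 * p.2) ^ (1 + t)
        = ∑ n ∈ P.image f, ∑ p ∈ P with f p = n, ENNReal.ofReal (2 * p.2) ^ (1 + t) :=
          (Finset.sum_fiberwise_of_maps_to (fun p hp => Finset.mem_image_of_mem f hp) _).symm
      _ ≤ ∑ n ∈ P.image f, ENNReal.ofReal (G n) := Finset.sum_le_sum fun n _ => hlevel n
      _ = ENNReal.ofReal (∑ n ∈ P.image f, G n) :=
          (ENNReal.ofReal_sum_of_nonneg fun n _ => hG0 n).symm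
      _ ≤ _ := ENNReal.ofReal_le_ofReal (hGsum.sum_le_tsum _ fun n _ => hG0 n)
  exact ne_top_of_le_ne_top ENNReal.ofReal_ne_top ((iInf₂_le δ hδ).trans key)

end PackingMass

/-! ### Boxes of height `2π` and annuli. -/

section Boxes

/-- The closed rectangle of width `δ` and height `2 * π` with lower left corner `p`. -/
def box (δ : ℝ) (p : ℂ) : Set ℂ :=
  {z | p.re ≤ z.re ∧ z.re ≤ p.re + δ ∧ p.im ≤ z.im ∧ z.im ≤ p.im + 2 * Real.pi}

theorem isCompact_box (δ : ℝ) (p : ℂ) : IsCompact (box δ p) := by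
  have : box δ p = Set.Icc p.re (p.re + δ) ×ℂ Set.Icc p.im (p.im + 2 * Real.pi) := by
    ext z; simp [box, Complex.mem_reProdIm, and_assoc]
  rw [this]
  exact isCompact_Icc.reProdIm isCompact_Icc

/-- The height is a full period, so the box covers the whole annulus: shift the principal logarithm
by the multiple of `2πi` that brings it into the box. -/
theorem exists_mem_box_of_norm_mem {c w p : ℂ} {δ : ℝ} (hc : c ≠ 0)
    (h1 : ‖c‖ * Real.exp p.re ≤ ‖w‖) (h2 : ‖w‖ ≤ ‖c‖ * Real.exp (p.re + δ)) :
    ∃ z ∈ box δ p, c * Complex.exp z = w := by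
  have hc' : 0 < ‖c‖ := norm_pos_iff.2 hc
  have hw' : 0 < ‖w‖ := lt_of_lt_of_le (by positivity) h1
  have hw : w ≠ 0 := norm_pos_iff.1 hw'
  have hπ := Real.two_pi_pos
  set k : ℤ := ⌊((Complex.log (w / c)).im - p.im) / (2 * Real.pi)⌋
  have hk1 := Int.floor_le (((Complex.log (w / c)).im - p.im) / (2 * Real.pi))
  have hk2 := Int.lt_floor_add_one (((Complex.log (w / c)).im - p.im) / (2 * Real.pi))
  rw [le_div_iff₀ hπ] at hk1
  rw [div_lt_iff₀ hπ] at hk2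
  refine ⟨Complex.log (w / c) + ((-k : ℤ) : ℂ) * (2 * Real.pi * Complex.I), ?_, ?_⟩
  · have hre : (Complex.log (w / c) + ((-k : ℤ) : ℂ) * (2 * Real.pi * Complex.I)).re =
        Real.log (‖w‖ / ‖c‖) := by
      simp [Complex.log_re]
    have him : (Complex.log (w / c) + ((-k : ℤ) : ℂ) * (2 * Real.pi * Complex.I)).im =
        (Complex.log (w / c)).im - k * (2 * Real.pi) := by
      simp; ring
    refine ⟨?_, ?_, ?_, ?_⟩
    · rw [hre, Real.le_log_iff_exp_le (by positivity), le_div_iff₀ hc', mul_comm]; exact h1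
    · rw [hre, Real.log_le_iff_le_exp (by positivity), div_le_iff₀ hc', mul_comm]; exact h2
    · rw [him]; linarith
    · rw [him]; linarith
  · rw [Complex.exp_add, Complex.exp_log (div_ne_zero hw hc), Complex.exp_int_mul_two_pi_mul_I]
    field_simp

/-- The height at which the vertical line with abscissae in `[u, u + δ]` enters the annulus of
inner radius `x`. -/
noncomputable def entryHeight (δ x u : ℝ) : ℝ :=
  √(x ^ 2 - max |u| |u + δ| ^ 2 + 2 * max |u| |u + δ| * δ)

/-- With `U = max |u| |u + δ|`, the square of the real part lies between `U ^ 2 - 2 * U * δ` and `U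
^ 2`, so above the entry height the modulus is at least `x`. The bound on `j` gives `16 * j + 2π ≤ δ
* x / 4`, hence `‖z‖ ^ 2 ≤ x ^ 2 * (1 + 2 * δ)`. -/
theorem norm_mem_of_mem_box {δ x u : ℝ} {j : ℕ} (hδ : 0 < δ) (hδ1 : δ ≤ 1 / 4) (hx : 2 ≤ x)
    (hu : -x ≤ u) (hu' : u + δ ≤ x) (hj : 64 * ((j : ℝ) + 1) ≤ δ * x) {z : ℂ}
    (hz : z ∈ box δ ⟨u, entryHeight δ x u + 16 * j⟩) :
    x ≤ ‖z‖ ∧ ‖z‖ ≤ x * Real.exp δ := by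
  obtain ⟨h1, h2, h3, h4⟩ := hz
  simp only at h1 h2 h3 h4
  set U := max |u| |u + δ| with hU
  have hUx : U ≤ x := max_le (abs_le.2 ⟨hu, by linarith⟩) (abs_le.2 ⟨by linarith, hu'⟩)
  have hU0 : 0 ≤ U := (abs_nonneg u).trans (le_max_left _ _)
  have hreU : |z.re| ≤ U := by
    rw [abs_le]
    constructor
    · linarith [neg_abs_le u, le_max_left |u| |u + δ|]
    · linarith [le_abs_self (u + δ), le_max_right |u| |u + δ|]
  have hUre : U ≤ |z.re| + δ := by
    refine max_le ?_ ?_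
    · have := abs_sub_abs_le_abs_sub u z.re
      have h5 : |u - z.re| ≤ δ := by rw [abs_le]; constructor <;> linarith
      linarith
    · have := abs_sub_abs_le_abs_sub (u + δ) z.re
      have h5 : |u + δ - z.re| ≤ δ := by rw [abs_le]; constructor <;> linarith
      linarith
  have hre1 : U ^ 2 - 2 * U * δ ≤ z.re ^ 2 := by
    rw [← sq_abs z.re]
    rcases le_total δ U with h | h
    · nlinarith [abs_nonneg z.re]
    · nlinarith [sq_nonneg |z.re|]
  have hre2 : z.re ^ 2 ≤ U ^ 2 := by
    rw [← sq_abs z.re]; gcongr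
  have hrad : 0 ≤ x ^ 2 - U ^ 2 + 2 * U * δ := by nlinarith
  set y := entryHeight δ x u with hy
  have hy0 : 0 ≤ y := Real.sqrt_nonneg _
  have hysq : y ^ 2 = x ^ 2 - U ^ 2 + 2 * U * δ := Real.sq_sqrt hrad
  have hyx : y ≤ 11 / 10 * x := by
    refine abs_le_of_sq_le_sq' ?_ (by linarith) |>.2
    rw [hysq]
    nlinarith [sq_nonneg (U - δ)]
  have hnorm : ‖z‖ ^ 2 = z.re ^ 2 + z.im ^ 2 := by
    rw [← Complex.normSq_eq_norm_sq, Complex.normSq_apply]; ring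
  have hπ := Real.pi_lt_four
  have hj0 : (0 : ℝ) ≤ j := Nat.cast_nonneg j
  have him1 : y ≤ z.im := by linarith
  have him2 : z.im ≤ y + δ * x / 4 := by linarith
  constructor
  · refine abs_le_of_sq_le_sq' ?_ (norm_nonneg z) |>.2
    rw [hnorm]
    nlinarith
  · have hexp : 1 + 2 * δ ≤ Real.exp δ ^ 2 := by
      rw [← Real.exp_nat_mul]
      have := Real.add_one_le_exp ((2 : ℕ) * δ)
      push_cast at this ⊢
      linarith
    refine abs_le_of_sq_le_sq' ?_ (by positivity) |>.2
    rw [hnorm, mul_pow]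
    have h5 : z.im ^ 2 ≤ (y + δ * x / 4) ^ 2 := by
      have : 0 ≤ z.im := hy0.trans him1
      gcongr
    have h6 : y * (δ * x) ≤ 11 / 10 * x * (δ * x) := by
      have : 0 ≤ δ * x := by positivity
      gcongr
    have h7 : (δ * x) ^ 2 ≤ 1 / 4 * (δ * x ^ 2) := by
      have : 0 ≤ δ * x ^ 2 := by positivity
      nlinarith
    have h8 : 2 * U * δ ≤ δ * x ^ 2 := by
      have : 2 * U ≤ x ^ 2 := by nlinarith
      nlinarith
    have h9 : 0 ≤ δ * x ^ 2 := by positivity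
    have h10 : x ^ 2 * (1 + 2 * δ) ≤ x ^ 2 * Real.exp δ ^ 2 := by gcongr
    nlinarith

end Boxes

/-! ### Trees of boxes coded by mixed radix expansions. -/

section StripSystem

/-- A sequence of vertical strips `c n ≤ re z ≤ c n + w n` such that the image of every strip under
the next exponential map consists of circles around `0` that cross the next strip. -/
structure IsStripSystem (lam : ℕ → ℂ) (c w : ℕ → ℝ) (δ : ℝ) : Prop where
  pos : 0 < δ
  le_quarter : δ ≤ 1 / 4
  lam_ne_zero : ∀ n, lam (n + 1) ≠ 0
  two_mul_le : ∀ n, 2 * δ ≤ w n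
  le_norm : ∀ n, 64 / δ ≤ ‖lam (n + 1)‖ * Real.exp (c n)
  neg_le : ∀ n, -(‖lam (n + 1)‖ * Real.exp (c n)) ≤ c (n + 1)
  add_le : ∀ n, c (n + 1) + w (n + 1) ≤ ‖lam (n + 1)‖ * Real.exp (c n)

/-- The points whose iterates stay in the strips. -/
def stripSet (lam : ℕ → ℂ) (c w : ℕ → ℝ) : Set ℂ :=
  {z | ∀ n, c n ≤ (iter lam n z).re ∧ (iter lam n z).re ≤ c n + w n}

/-- The inner radius of the image of the box of level `n` with corner `p`. -/
noncomputable def innerRadius (lam : ℕ → ℂ) (n : ℕ) (p : ℂ) : ℝ :=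
  ‖lam (n + 1)‖ * Real.exp p.re

/-- The number of columns of boxes in the strip of level `n`. -/
noncomputable def columns (w : ℕ → ℝ) (δ : ℝ) (n : ℕ) : ℕ := ⌊w n / (2 * δ)⌋₊

/-- The number of boxes of level `n + 1` in a column, inside the image of the box with corner `p`. -/
noncomputable def rows (lam : ℕ → ℂ) (δ : ℝ) (n : ℕ) (p : ℂ) : ℕ := ⌊δ * innerRadius lam n p / 64⌋₊

/-- The number of boxes of level `n + 1` inside the image of the box with corner `p`. -/
noncomputable def children (lam : ℕ → ℂ) (w : ℕ → ℝ) (δ : ℝ) (n : ℕ) (p : ℂ) : ℕ :=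
  columns w δ (n + 1) * rows lam δ n p

/-- The corner of the box of level `n + 1` in column `i` and row `j`. -/
noncomputable def childCorner (lam : ℕ → ℂ) (c : ℕ → ℝ) (δ : ℝ) (n : ℕ) (p : ℂ) (i j : ℕ) : ℂ :=
  ⟨c (n + 1) + 2 * δ * i,
    entryHeight δ (innerRadius lam n p) (c (n + 1) + 2 * δ * i) + 16 * j⟩

/-- The expansion of a number `t ∈ [0, 1)` along the tree of boxes: the current box and the
position of `t` in the interval that corresponds to it. -/
noncomputable def expansion (lam : ℕ → ℂ) (c w : ℕ → ℝ) (δ : ℝ) : ℕ → ℝ → ℂ × ℝ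
  | 0, t => (⟨c 0, 0⟩, t)
  | n + 1, t =>
    let s := expansion lam c w δ n t
    let d := ⌊children lam w δ n s.1 * s.2⌋₊
    (childCorner lam c δ n s.1 (d % columns w δ (n + 1)) (d / columns w δ (n + 1)),
      Int.fract (children lam w δ n s.1 * s.2))

/-- The number of the child chosen at level `n`. -/
noncomputable def digit (lam : ℕ → ℂ) (c w : ℕ → ℝ) (δ : ℝ) (n : ℕ) (t : ℝ) : ℕ :=
  ⌊children lam w δ n (expansion lam c w δ n t).1 * (expansion lam c w δ n t).2⌋₊

variable {lam : ℕ → ℂ} {c w : ℕ → ℝ} {δ : ℝ}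

theorem expansion_succ_fst (n : ℕ) (t : ℝ) :
    (expansion lam c w δ (n + 1) t).1 = childCorner lam c δ n (expansion lam c w δ n t).1
      (digit lam c w δ n t % columns w δ (n + 1)) (digit lam c w δ n t / columns w δ (n + 1)) := rfl

theorem expansion_snd_mem (n : ℕ) {t : ℝ} (ht : t ∈ Set.Ico (0 : ℝ) 1) :
    (expansion lam c w δ n t).2 ∈ Set.Ico (0 : ℝ) 1 := by
  cases n with
  | zero => exact ht
  | succ n => exact ⟨Int.fract_nonneg _, Int.fract_lt_one _⟩

theorem children_mul_expansion_snd (n : ℕ) {t : ℝ} (ht : t ∈ Set.Ico (0 : ℝ) 1) :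
    children lam w δ n (expansion lam c w δ n t).1 * (expansion lam c w δ n t).2 =
      digit lam c w δ n t + (expansion lam c w δ (n + 1) t).2 := by
  have h0 : (0 : ℝ) ≤ children lam w δ n (expansion lam c w δ n t).1 *
      (expansion lam c w δ n t).2 :=
    mul_nonneg (Nat.cast_nonneg _) (expansion_snd_mem n ht).1
  have h1 : (digit lam c w δ n t : ℝ) =
      ⌊children lam w δ n (expansion lam c w δ n t).1 * (expansion lam c w δ n t).2⌋ := by
    rw [digit, ← natCast_floor_eq_intCast_floor h0]
  rw [h1]
  exact (Int.floor_add_fract _).symm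

theorem le_innerRadius_of_le_re (n : ℕ) {p : ℂ} (hp : c n ≤ p.re) :
    ‖lam (n + 1)‖ * Real.exp (c n) ≤ innerRadius lam n p := by
  unfold innerRadius; gcongr

namespace IsStripSystem

variable (h : IsStripSystem lam c w δ)
include h

theorem half_le_columns (n : ℕ) : w n / (4 * δ) ≤ columns w δ n := by
  have hδ := h.pos
  have h1 := Nat.lt_floor_add_one (w n / (2 * δ))
  have h2 : 1 ≤ w n / (2 * δ) := (one_le_div (by linarith)).2 (h.two_mul_le n)
  have h3 : (1 : ℝ) ≤ ⌊w n / (2 * δ)⌋₊ := by exact_mod_cast Nat.one_le_floor_iff _ |>.2 h2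
  have h4 : w n / (4 * δ) = w n / (2 * δ) / 2 := by field_simp; norm_num
  rw [columns, h4]
  linarith

theorem columns_pos (n : ℕ) : 0 < columns w δ n := by
  have h1 := h.half_le_columns n
  have h2 := h.two_mul_le n
  have hδ := h.pos
  have h3 : 0 < w n / (4 * δ) := by
    have : 0 < w n := by linarith
    positivity
  exact_mod_cast h3.trans_le h1

theorem two_mul_columns_le (n : ℕ) : 2 * δ * columns w δ n ≤ w n := by
  have hδ := h.pos
  have h2 := h.two_mul_le n
  have h1 := Nat.floor_le (a := w n / (2 * δ)) (div_nonneg (by linarith) (by linarith))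
  rw [le_div_iff₀ (by linarith)] at h1
  rw [columns]; linarith

theorem re_expansion_mem (n : ℕ) (t : ℝ) :
    c n ≤ (expansion lam c w δ n t).1.re ∧
      (expansion lam c w δ n t).1.re + δ ≤ c n + w n := by
  have hδ := h.pos
  cases n with
  | zero => exact ⟨le_rfl, by have := h.two_mul_le 0; simp only [expansion]; linarith⟩
  | succ n =>
    rw [expansion_succ_fst]
    simp only [childCorner]
    have h1 := Nat.mod_lt (digit lam c w δ n t) (h.columns_pos (n + 1))
    have h2 : ((digit lam c w δ n t % columns w δ (n + 1) : ℕ) : ℝ) + 1 ≤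
        columns w δ (n + 1) := by exact_mod_cast h1
    have h3 := h.two_mul_columns_le (n + 1)
    constructor
    · have : (0 : ℝ) ≤ 2 * δ * (digit lam c w δ n t % columns w δ (n + 1) : ℕ) := by positivity
      linarith
    · nlinarith

theorem le_innerRadius (n : ℕ) {p : ℂ} (hp : c n ≤ p.re) : 64 ≤ δ * innerRadius lam n p := by
  have h1 := (h.le_norm n).trans (le_innerRadius_of_le_re n hp)
  rw [div_le_iff₀ h.pos] at h1
  linarith

theorem two_le_innerRadius (n : ℕ) {p : ℂ} (hp : c n ≤ p.re) : 2 ≤ innerRadius lam n p := by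
  have h1 := h.le_innerRadius n hp
  have := h.le_quarter
  have := h.pos
  by_contra hcon
  push Not at hcon
  nlinarith

theorem half_le_rows (n : ℕ) {p : ℂ} (hp : c n ≤ p.re) :
    δ * innerRadius lam n p / 128 ≤ rows lam δ n p := by
  have h1 := h.le_innerRadius n hp
  have h2 := Nat.lt_floor_add_one (δ * innerRadius lam n p / 64)
  have h3 : (1 : ℝ) ≤ ⌊δ * innerRadius lam n p / 64⌋₊ := by
    exact_mod_cast (Nat.one_le_floor_iff _).2 ((one_le_div (by norm_num)).2 h1)
  rw [rows]
  linarith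

theorem rows_pos (n : ℕ) {p : ℂ} (hp : c n ≤ p.re) : 0 < rows lam δ n p := by
  have h1 := h.half_le_rows n hp
  have h2 := h.le_innerRadius n hp
  have h3 : (0 : ℝ) < rows lam δ n p := by linarith
  exact_mod_cast h3

theorem children_pos (n : ℕ) {p : ℂ} (hp : c n ≤ p.re) : 0 < children lam w δ n p :=
  Nat.mul_pos (h.columns_pos _) (h.rows_pos n hp)

theorem digit_lt (n : ℕ) {t : ℝ} (ht : t ∈ Set.Ico (0 : ℝ) 1) :
    digit lam c w δ n t < children lam w δ n (expansion lam c w δ n t).1 := by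
  have hN := h.children_pos n (h.re_expansion_mem n t).1
  have hs := expansion_snd_mem (lam := lam) (c := c) (w := w) (δ := δ) n ht
  rw [digit, Nat.floor_lt (mul_nonneg (Nat.cast_nonneg _) hs.1)]
  have : (0 : ℝ) < children lam w δ n (expansion lam c w δ n t).1 := by exact_mod_cast hN
  nlinarith [hs.2]

/-- Every point of a box is the image of a point of the parent box. -/
theorem exists_mem_box_preimage (n : ℕ) {t : ℝ} (ht : t ∈ Set.Ico (0 : ℝ) 1) {z : ℂ}
    (hz : z ∈ box δ (expansion lam c w δ (n + 1) t).1) :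
    ∃ z' ∈ box δ (expansion lam c w δ n t).1, lam (n + 1) * Complex.exp z' = z := by
  have hp := h.re_expansion_mem n t
  have hp' := h.re_expansion_mem (n + 1) t
  set p := (expansion lam c w δ n t).1
  have hx := le_innerRadius_of_le_re (lam := lam) n hp.1
  have hj : digit lam c w δ n t / columns w δ (n + 1) + 1 ≤ rows lam δ n p := by
    have := h.digit_lt n ht
    rw [children] at this
    exact Nat.div_lt_of_lt_mul this
  have hj' : 64 * (((digit lam c w δ n t / columns w δ (n + 1) : ℕ) : ℝ) + 1) ≤
      δ * innerRadius lam n p := by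
    have h1 : ((digit lam c w δ n t / columns w δ (n + 1) : ℕ) : ℝ) + 1 ≤ rows lam δ n p := by
      exact_mod_cast hj
    have h2 := Nat.floor_le (a := δ * innerRadius lam n p / 64)
      (by have := h.le_innerRadius n hp.1; linarith)
    rw [rows] at h1
    linarith
  rw [expansion_succ_fst] at hz hp'
  obtain ⟨h1, h2⟩ := norm_mem_of_mem_box h.pos h.le_quarter (h.two_le_innerRadius n hp.1)
    (by have := h.neg_le n; have := hp'.1; simp only [childCorner] at this; linarith)
    (by have := h.add_le n; have := hp'.2; simp only [childCorner] at this; linarith) hj' hz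
  refine exists_mem_box_of_norm_mem (h.lam_ne_zero n) h1 ?_
  rw [Real.exp_add, ← mul_assoc]; exact h2

theorem exists_iter_mem_box_of_mem (n : ℕ) {t : ℝ} (ht : t ∈ Set.Ico (0 : ℝ) 1) :
    ∀ z ∈ box δ (expansion lam c w δ n t).1, ∃ z₀,
      (∀ k ≤ n, iter lam k z₀ ∈ box δ (expansion lam c w δ k t).1) ∧ iter lam n z₀ = z := by
  induction n with
  | zero =>
    intro z hz
    refine ⟨z, fun k hk => ?_, rfl⟩
    obtain rfl : k = 0 := by omega
    exact hz
  | succ n ih =>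
    intro z hz
    obtain ⟨z', hz', rfl⟩ := h.exists_mem_box_preimage n ht hz
    obtain ⟨z₀, h1, h2⟩ := ih z' hz'
    have h3 : iter lam (n + 1) z₀ = lam (n + 1) * Complex.exp z' := by rw [iter, h2]
    refine ⟨z₀, fun k hk => ?_, h3⟩
    rcases hk.lt_or_eq with hk | rfl
    · exact h1 k (by omega)
    · rw [h3]; exact hz

/-- Pulling back a point of the last box realises every finite path; nested compact sets then give a
point for the infinite path. -/
theorem exists_iter_mem_box {t : ℝ} (ht : t ∈ Set.Ico (0 : ℝ) 1) :
    ∃ z₀, ∀ k, iter lam k z₀ ∈ box δ (expansion lam c w δ k t).1 := by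
  have hcont : ∀ k, Continuous (iter lam k) := by
    intro k
    induction k with
    | zero => exact continuous_id
    | succ k ih => exact continuous_const.mul (Complex.continuous_exp.comp ih)
  let K : ℕ → Set ℂ := fun n => ⋂ k ∈ Finset.range (n + 1),
    iter lam k ⁻¹' box δ (expansion lam c w δ k t).1
  have hcl : ∀ n, IsClosed (K n) := fun n =>
    isClosed_biInter fun k _ => (isCompact_box _ _).isClosed.preimage (hcont k)
  have hne := IsCompact.nonempty_iInter_of_sequence_nonempty_isCompact_isClosed K
    (fun n => Set.biInter_subset_biInter_left (by
      intro k hk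
      simp only [Finset.mem_coe, Finset.mem_range] at hk ⊢
      omega))
    (fun n => by
      have hb := h.exists_iter_mem_box_of_mem n ht (expansion lam c w δ n t).1
        ⟨le_rfl, by linarith [h.pos], le_rfl, by linarith [Real.two_pi_pos]⟩
      obtain ⟨z₀, hz₀, -⟩ := hb
      exact ⟨z₀, Set.mem_iInter₂.2 fun k hk => hz₀ k (by
        have := Finset.mem_range.1 hk; omega)⟩)
    (by
      refine (isCompact_box δ (expansion lam c w δ 0 t).1).of_isClosed_subset (hcl 0) ?_
      intro z hz
      exact Set.mem_iInter₂.1 hz 0 (by simp)) hcl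
  obtain ⟨z₀, hz₀⟩ := hne
  refine ⟨z₀, fun k => ?_⟩
  exact Set.mem_iInter₂.1 (Set.mem_iInter.1 hz₀ k) k (by simp)

/-- Different children of a box are separated. -/
theorem digit_eq_of_norm_sub_lt (n : ℕ) {t t' : ℝ} {z z' : ℂ}
    (he : (expansion lam c w δ n t).1 = (expansion lam c w δ n t').1)
    (hz : z ∈ box δ (expansion lam c w δ (n + 1) t).1)
    (hz' : z' ∈ box δ (expansion lam c w δ (n + 1) t').1) (hzz : ‖z - z'‖ < δ) :
    digit lam c w δ n t = digit lam c w δ n t' := by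
  have hδ := h.pos
  have hδ1 := h.le_quarter
  rw [expansion_succ_fst] at hz hz'
  rw [← he] at hz'
  set p := (expansion lam c w δ n t).1
  set N := columns w δ (n + 1)
  obtain ⟨a1, a2, a3, a4⟩ := hz
  obtain ⟨b1, b2, b3, b4⟩ := hz'
  simp only [childCorner] at a1 a2 a3 a4 b1 b2 b3 b4
  have hre := abs_lt.1 ((Complex.abs_re_le_norm _).trans_lt hzz)
  have him := abs_lt.1 ((Complex.abs_im_le_norm _).trans_lt hzz)
  rw [Complex.sub_re] at hre
  rw [Complex.sub_im] at him
  -- Columns are spaced by `2 * δ` and have width `δ`, so different columns are at distance at least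
  -- `δ`.
  have hmod : digit lam c w δ n t % N = digit lam c w δ n t' % N := by
    by_contra hne
    rcases Nat.lt_or_gt_of_ne hne with hlt | hlt
    · have : ((digit lam c w δ n t % N : ℕ) : ℝ) + 1 ≤ (digit lam c w δ n t' % N : ℕ) := by
        exact_mod_cast hlt
      nlinarith [hre.1, hre.2]
    · have : ((digit lam c w δ n t' % N : ℕ) : ℝ) + 1 ≤ (digit lam c w δ n t % N : ℕ) := by
        exact_mod_cast hlt
      nlinarith [hre.1, hre.2]
  have hπ := Real.pi_lt_d2
  -- In one column the entry heights agree, and the row gap `16 - 2π` exceeds `δ`.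
  have hdiv : digit lam c w δ n t / N = digit lam c w δ n t' / N := by
    rw [hmod] at a3 a4
    by_contra hne
    rcases Nat.lt_or_gt_of_ne hne with hlt | hlt
    · have : ((digit lam c w δ n t / N : ℕ) : ℝ) + 1 ≤ (digit lam c w δ n t' / N : ℕ) := by
        exact_mod_cast hlt
      linarith [him.1, him.2]
    · have : ((digit lam c w δ n t' / N : ℕ) : ℝ) + 1 ≤ (digit lam c w δ n t / N : ℕ) := by
        exact_mod_cast hlt
      linarith [him.1, him.2]
  rw [← Nat.mod_add_div (digit lam c w δ n t) N, ← Nat.mod_add_div (digit lam c w δ n t') N,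
    hmod, hdiv]

end IsStripSystem

/-- The number of boxes of level `n` in a tree with constant numbers of children as on the path
of `t`. -/
noncomputable def prodChildren (lam : ℕ → ℂ) (c w : ℕ → ℝ) (δ : ℝ) (n : ℕ) (t : ℝ) : ℝ :=
  ∏ k ∈ Finset.range n, (children lam w δ k (expansion lam c w δ k t).1 : ℝ)

/-- The number of children depends only on the current box, so equal digits mean equal bases;
subtracting the two mixed radix expansions leaves the rescaled difference of the remainders. -/
theorem expansion_eq_of_digit_eq {n : ℕ} {t t' : ℝ} (ht : t ∈ Set.Ico (0 : ℝ) 1)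
    (ht' : t' ∈ Set.Ico (0 : ℝ) 1) (hd : ∀ k < n, digit lam c w δ k t = digit lam c w δ k t') :
    (expansion lam c w δ n t).1 = (expansion lam c w δ n t').1 ∧
      (t - t') * prodChildren lam c w δ n t' =
        (expansion lam c w δ n t).2 - (expansion lam c w δ n t').2 := by
  induction n with
  | zero => exact ⟨rfl, by simp [prodChildren, expansion]⟩
  | succ n ih =>
    obtain ⟨h1, h2⟩ := ih fun k hk => hd k (by omega)
    have h3 := hd n (by omega)
    refine ⟨by rw [expansion_succ_fst, expansion_succ_fst, h1, h3], ?_⟩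
    have e1 := children_mul_expansion_snd (lam := lam) (c := c) (w := w) (δ := δ) n ht
    have e2 := children_mul_expansion_snd (lam := lam) (c := c) (w := w) (δ := δ) n ht'
    rw [h1, h3] at e1
    rw [prodChildren, Finset.prod_range_succ, ← mul_assoc, ← prodChildren, h2, sub_mul]
    linarith

namespace IsStripSystem

variable (h : IsStripSystem lam c w δ)
include h

theorem prodChildren_pos (n : ℕ) (t : ℝ) :
    0 < prodChildren lam c w δ n t :=
  Finset.prod_pos fun k _ => by
    exact_mod_cast h.children_pos k (h.re_expansion_mem k t).1

theorem abs_sub_le_of_digit_eq {n : ℕ} {t t' : ℝ} (ht : t ∈ Set.Ico (0 : ℝ) 1)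
    (ht' : t' ∈ Set.Ico (0 : ℝ) 1) (hd : ∀ k < n, digit lam c w δ k t = digit lam c w δ k t') :
    |t - t'| ≤ 1 / prodChildren lam c w δ n t' := by
  have h1 := (expansion_eq_of_digit_eq ht ht' hd).2
  have h2 := h.prodChildren_pos n t'
  rw [le_div_iff₀ h2, ← abs_of_pos h2, ← abs_mul, h1, abs_le]
  have a := expansion_snd_mem (lam := lam) (c := c) (w := w) (δ := δ) n ht
  have b := expansion_snd_mem (lam := lam) (c := c) (w := w) (δ := δ) n ht'
  constructor <;> linarith [a.1, a.2, b.1, b.2]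

end IsStripSystem

end StripSystem

/-! ### The equidistributed mass and its local size. -/

section MassBound

variable {lam : ℕ → ℂ} {c w : ℕ → ℝ} {δ : ℝ}

theorem sum_card_Icc_le (a : ℝ) {L : ℝ} (hL : 0 ≤ L) :
    ((Finset.Icc ⌈a⌉ ⌊a + L⌋).card : ℝ) ≤ L + 1 := by
  rw [Int.card_Icc]
  have h1 := Int.floor_le (a + L)
  have h2 := Int.le_ceil a
  have h3 : (((⌊a + L⌋ + 1 - ⌈a⌉).toNat : ℤ) : ℝ) = ((max (⌊a + L⌋ + 1 - ⌈a⌉) 0 : ℤ) : ℝ) := by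
    rw [Int.toNat_eq_max]
  rw [Int.cast_natCast] at h3
  rw [h3, Int.cast_max]
  push_cast
  exact max_le (by linarith) (by linarith)

namespace IsStripSystem

/-- A point whose iterates follow the boxes of `t`. -/
def Follows (lam : ℕ → ℂ) (c w : ℕ → ℝ) (δ t : ℝ) (z : ℂ) : Prop :=
  ∀ k, iter lam k z ∈ box δ (expansion lam c w δ k t).1

theorem norm_iter_succ_mem {t : ℝ} {z : ℂ} (hz : Follows lam c w δ t z) (n : ℕ) :
    innerRadius lam n (expansion lam c w δ n t).1 ≤ ‖iter lam (n + 1) z‖ ∧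
      ‖iter lam (n + 1) z‖ ≤ innerRadius lam n (expansion lam c w δ n t).1 * Real.exp δ := by
  obtain ⟨h1, h2, -, -⟩ := hz n
  rw [norm_iter_succ, innerRadius, mul_assoc, ← Real.exp_add]
  constructor <;> gcongr

variable (h : IsStripSystem lam c w δ)
include h

theorem mem_stripSet {t : ℝ} {z : ℂ} (hz : Follows lam c w δ t z) : z ∈ stripSet lam c w := by
  intro n
  have h1 := h.re_expansion_mem n t
  obtain ⟨h2, h3, -, -⟩ := hz n
  constructor <;> linarith

theorem half_norm_iter_succ_le {t : ℝ} {z : ℂ} (hz : Follows lam c w δ t z) (n : ℕ) :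
    ‖iter lam (n + 1) z‖ / 2 ≤ innerRadius lam n (expansion lam c w δ n t).1 := by
  have h1 := (norm_iter_succ_mem hz n).2
  have h2 : Real.exp δ ≤ 2 := (Real.exp_le_exp.2 h.le_quarter).trans exp_quarter_le_two
  have h3 := h.two_le_innerRadius n (h.re_expansion_mem n t).1
  nlinarith

theorem two_le_norm_iter_succ {z : ℂ} (hz : z ∈ stripSet lam c w) (n : ℕ) :
    2 ≤ ‖iter lam (n + 1) z‖ := by
  rw [norm_iter_succ]
  exact h.two_le_innerRadius n (hz n).1

/-- There are at least `w / (4 * δ)` columns and `δ * x / 128` rows, and the inner radius `x` is at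
least half the modulus; `δ` cancels. -/
theorem mul_norm_le_children {t : ℝ} {z : ℂ} (hz : Follows lam c w δ t z) (n : ℕ) :
    w (n + 1) * ‖iter lam (n + 1) z‖ / 1024 ≤
      children lam w δ n (expansion lam c w δ n t).1 := by
  have hδ := h.pos
  have hw := h.two_mul_le (n + 1)
  have h1 := h.half_le_columns (n + 1)
  have h2 := h.half_le_rows n (h.re_expansion_mem n t).1
  have h3 := h.half_norm_iter_succ_le hz n
  rw [children]
  push_cast
  calc w (n + 1) * ‖iter lam (n + 1) z‖ / 1024
      = w (n + 1) / (4 * δ) * (δ * (‖iter lam (n + 1) z‖ / 2) / 128) := by field_simp; ring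
    _ ≤ w (n + 1) / (4 * δ) * (δ * innerRadius lam n (expansion lam c w δ n t).1 / 128) := by
        have : 0 ≤ w (n + 1) := by linarith
        gcongr
    _ ≤ _ := by
        have : 0 ≤ innerRadius lam n (expansion lam c w δ n t).1 := by
          unfold innerRadius; positivity
        gcongr

theorem prod_le_prodChildren {t : ℝ} {z : ℂ} (hz : Follows lam c w δ t z) (n : ℕ) :
    (∏ k ∈ Finset.range n, w (k + 1)) * derivNorm lam n z / 1024 ^ n ≤
      prodChildren lam c w δ n t := by
  rw [derivNorm, ← Finset.prod_mul_distrib, ← Finset.card_range n, ← Finset.prod_const,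
    Finset.card_range, ← Finset.prod_div_distrib]
  refine Finset.prod_le_prod (fun k _ => ?_) fun k _ => h.mul_norm_le_children hz k
  have := h.two_mul_le (k + 1)
  have := h.pos
  have : 0 ≤ w (k + 1) := by linarith
  positivity

/-- The level `m` attached to the scale `r` is the last one at which the distortion bound keeps
images smaller than the gap `δ` between children. -/
theorem exists_level {z : ℂ} (hz : z ∈ stripSet lam c w) {r : ℝ} (hr : 0 < r) (hrδ : r < δ) :
    ∃ m, 2 ^ m * derivNorm lam m z * r < δ ∧ δ ≤ 2 ^ (m + 1) * derivNorm lam (m + 1) z * r := by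
  classical
  have hge : ∀ n, 1 ≤ derivNorm lam n z := fun n => by
    rw [derivNorm, ← Finset.prod_const_one (s := Finset.range n)]
    exact Finset.prod_le_prod (fun _ _ => zero_le_one) fun k _ => by
      linarith [h.two_le_norm_iter_succ hz k]
  have hex : ∃ n, δ ≤ 2 ^ n * derivNorm lam n z * r := by
    obtain ⟨n, hn⟩ := pow_unbounded_of_one_lt (δ / r) (one_lt_two (α := ℝ))
    refine ⟨n, ?_⟩
    rw [div_lt_iff₀ hr] at hn
    refine hn.le.trans ?_
    have := hge n
    have h2 : (0 : ℝ) < 2 ^ n * r := by positivity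
    nlinarith
  have h0 : Nat.find hex ≠ 0 := fun h0 => by
    have := Nat.find_spec hex
    rw [h0] at this
    simp at this
    linarith
  obtain ⟨m, hm⟩ := Nat.exists_eq_succ_of_ne_zero h0
  refine ⟨m, not_le.1 (Nat.find_min hex (by omega)), ?_⟩
  have := Nat.find_spec hex
  rwa [hm] at this

theorem pow_mul_derivNorm_mono {z : ℂ} (hz : z ∈ stripSet lam c w) {k m : ℕ} (hkm : k ≤ m) :
    2 ^ k * derivNorm lam k z ≤ 2 ^ m * derivNorm lam m z := by
  have hmono : Monotone fun n => 2 ^ n * derivNorm lam n z := by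
    refine monotone_nat_of_le_succ fun n => ?_
    rw [derivNorm_succ, pow_succ]
    have h1 := h.two_le_norm_iter_succ hz n
    have h2 : 0 ≤ 2 ^ n * derivNorm lam n z := mul_nonneg (by positivity) (derivNorm_nonneg _ _)
    nlinarith
  exact hmono hkm

theorem norm_iter_sub_lt {z z₀ : ℂ} (hz₀ : z₀ ∈ stripSet lam c w) {r : ℝ}
    (hzz : ‖z - z₀‖ ≤ r) {m : ℕ} (hm : 2 ^ m * derivNorm lam m z₀ * r < δ) :
    ∀ k ≤ m, ‖iter lam k z - iter lam k z₀‖ < δ := by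
  intro k
  induction k using Nat.strong_induction_on with
  | _ k ih =>
    intro hk
    have h1 := norm_iter_sub_le (lam := lam) (n := k) (z := z) (w := z₀)
      fun j hj => (ih j hj (by omega)).le.trans (by linarith [h.le_quarter])
    refine h1.trans_lt (lt_of_le_of_lt ?_ hm)
    have h2 := h.pow_mul_derivNorm_mono hz₀ hk
    have h3 : 0 ≤ 2 ^ k * derivNorm lam k z₀ := mul_nonneg (by positivity) (derivNorm_nonneg _ _)
    exact mul_le_mul h2 hzz (norm_nonneg _) (h3.trans h2)

/-- The parameters of the points in a small set have small measure. -/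
theorem volume_le {φ : ℝ → ℂ} (hφ : ∀ t ∈ Set.Ico (0 : ℝ) 1, Follows lam c w δ t (φ t)) {B : Set ℂ}
    {r : ℝ} (hr : 0 < r) (hB : ∀ z ∈ B, ∀ z' ∈ B, ‖z - z'‖ ≤ r) {t₀ : ℝ}
    (ht₀ : t₀ ∈ Set.Ico (0 : ℝ) 1) (hB₀ : φ t₀ ∈ B) {m : ℕ}
    (hm : 2 ^ m * derivNorm lam m (φ t₀) * r < δ)
    (hm' : δ ≤ 2 ^ (m + 1) * derivNorm lam (m + 1) (φ t₀) * r) :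
    volume {t | t ∈ Set.Ico (0 : ℝ) 1 ∧ φ t ∈ B} ≤
      ENNReal.ofReal ((2048 * 768 / δ ^ 2) ^ (m + 1) * r / ∏ k ∈ Finset.range m, w (k + 1)) := by
  have hδ := h.pos
  have hδ1 := h.le_quarter
  set z₀ := φ t₀
  set p := (expansion lam c w δ m t₀).1
  set R := 2 ^ (m + 1) * derivNorm lam (m + 1) z₀ * r with hR
  set N := columns w δ (m + 1)
  have hz₀ : z₀ ∈ stripSet lam c w := h.mem_stripSet (hφ t₀ ht₀)
  set S := {t | t ∈ Set.Ico (0 : ℝ) 1 ∧ φ t ∈ B}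
  have hclose : ∀ t ∈ S, ∀ k ≤ m, ‖iter lam k (φ t) - iter lam k z₀‖ < δ := fun t ht =>
    h.norm_iter_sub_lt hz₀ (hB _ ht.2 _ hB₀) hm
  -- Up to order `m` the images are closer than `δ`, so all these paths pass through the same boxes.
  have hdigit : ∀ t ∈ S, ∀ n ≤ m, ∀ k < n, digit lam c w δ k t = digit lam c w δ k t₀ := by
    intro t ht n
    induction n with
    | zero => intro _ k hk; omega
    | succ n ih =>
      intro hn k hk
      rcases Nat.lt_succ_iff_lt_or_eq.1 hk with hk | rfl
      · exact ih (by omega) k hk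
      · exact h.digit_eq_of_norm_sub_lt k
          (expansion_eq_of_digit_eq ht.1 ht₀ (ih (by omega))).1 (hφ t ht.1 (k + 1))
          (hφ t₀ ht₀ (k + 1)) (hclose t ht _ hn)
  have hexp : ∀ t ∈ S, (expansion lam c w δ m t).1 = p := fun t ht =>
    (expansion_eq_of_digit_eq ht.1 ht₀ (hdigit t ht m le_rfl)).1
  have hnext : ∀ t ∈ S, ‖iter lam (m + 1) (φ t) - iter lam (m + 1) z₀‖ ≤ R := by
    intro t ht
    refine (norm_iter_sub_le fun k hk => ((hclose t ht k (by omega)).le.trans (by linarith))).trans ?_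
    have := derivNorm_nonneg (lam := lam) (m + 1) z₀
    rw [hR]
    gcongr
    exact hB _ ht.2 _ hB₀
  have hR0 : 0 < R := hδ.trans_le hm'
  -- The rows of column `i` that meet the disc of radius `R` around the image of `z₀` have indices
  -- in `[a i, a i + L]`; 7 bounds the height `2π` and 16 is the spacing.
  let a : ℕ → ℝ := fun i => ((iter lam (m + 1) z₀).im - R - 7 -
    entryHeight δ (innerRadius lam m p) (c (m + 1) + 2 * δ * i)) / 16
  let L : ℝ := (2 * R + 7) / 16
  let A : ℕ → ℤ → Set ℝ := fun i j => {t | t ∈ S ∧ digit lam c w δ m t % N = i ∧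
    ((digit lam c w δ m t / N : ℕ) : ℤ) = j}
  have hcover : S ⊆ ⋃ i ∈ Finset.range N, ⋃ j ∈ Finset.Icc ⌈a i⌉ ⌊a i + L⌋, A i j := by
    intro t ht
    simp only [Set.mem_iUnion]
    refine ⟨digit lam c w δ m t % N, Finset.mem_range.2 (Nat.mod_lt _ (h.columns_pos _)),
      ((digit lam c w δ m t / N : ℕ) : ℤ), ?_, ht, rfl, rfl⟩
    obtain ⟨-, -, h3, h4⟩ := hφ t ht.1 (m + 1)
    rw [expansion_succ_fst, hexp t ht] at h3 h4
    simp only [childCorner] at h3 h4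
    have h5 := abs_le.1 ((Complex.abs_im_le_norm _).trans (hnext t ht))
    rw [Complex.sub_im] at h5
    have hπ := Real.pi_lt_d2
    rw [Finset.mem_Icc, Int.ceil_le, Int.le_floor]
    simp only [a, L]
    constructor
    · rw [div_le_iff₀ (by norm_num)]
      rw [Int.cast_natCast]
      simp only [N] at h3 h4 ⊢
      linarith [h5.1, h5.2]
    · rw [← add_div, le_div_iff₀ (by norm_num)]
      rw [Int.cast_natCast]
      simp only [N] at h3 h4 ⊢
      linarith [h5.1, h5.2]
  have hP := h.prodChildren_pos (m + 1) t₀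
  have hA : ∀ i j, volume (A i j) ≤ ENNReal.ofReal (1 / prodChildren lam c w δ (m + 1) t₀) := by
    intro i j
    refine (Real.volume_le_diam _).trans ?_
    refine Metric.ediam_le_of_forall_dist_le fun t ht t' ht' => ?_
    rw [Real.dist_eq]
    have hprod : prodChildren lam c w δ (m + 1) t' = prodChildren lam c w δ (m + 1) t₀ := by
      refine Finset.prod_congr rfl fun k hk => ?_
      rw [(expansion_eq_of_digit_eq ht'.1.1 ht₀ (hdigit t' ht'.1 k
        (Nat.lt_succ_iff.1 (Finset.mem_range.1 hk)))).1]
    rw [← hprod]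
    refine h.abs_sub_le_of_digit_eq ht.1.1 ht'.1.1 fun k hk => ?_
    rcases Nat.lt_succ_iff_lt_or_eq.1 hk with hk | rfl
    · rw [hdigit t ht.1 m le_rfl k hk, hdigit t' ht'.1 m le_rfl k hk]
    · have h1 : digit lam c w δ k t % N = digit lam c w δ k t' % N := ht.2.1.trans ht'.2.1.symm
      have h2 : digit lam c w δ k t / N = digit lam c w δ k t' / N := by
        exact_mod_cast ht.2.2.trans ht'.2.2.symm
      rw [← Nat.mod_add_div (digit lam c w δ k t) N, ← Nat.mod_add_div (digit lam c w δ k t') N,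
        h1, h2]
  have hL : 0 ≤ L := by positivity
  calc volume S ≤ ∑ i ∈ Finset.range N, ∑ j ∈ Finset.Icc ⌈a i⌉ ⌊a i + L⌋, volume (A i j) := by
        refine (measure_mono hcover).trans ((measure_biUnion_finset_le _ _).trans ?_)
        exact Finset.sum_le_sum fun i _ => measure_biUnion_finset_le _ _
    _ ≤ ∑ i ∈ Finset.range N, ENNReal.ofReal ((L + 1) *
          (1 / prodChildren lam c w δ (m + 1) t₀)) := by
        refine Finset.sum_le_sum fun i _ => (Finset.sum_le_sum fun j _ => hA i j).trans ?_
        rw [Finset.sum_const, nsmul_eq_mul, ← ENNReal.ofReal_natCast,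
          ← ENNReal.ofReal_mul (Nat.cast_nonneg _)]
        refine ENNReal.ofReal_le_ofReal ?_
        gcongr
        exact sum_card_Icc_le _ hL
    _ = ENNReal.ofReal (N * ((L + 1) * (1 / prodChildren lam c w δ (m + 1) t₀))) := by
        rw [Finset.sum_const, nsmul_eq_mul, Finset.card_range, ← ENNReal.ofReal_natCast,
          ← ENNReal.ofReal_mul (Nat.cast_nonneg _)]
    _ ≤ _ := by
        refine ENNReal.ofReal_le_ofReal ?_
        have hN : (0 : ℝ) < N := by exact_mod_cast h.columns_pos (m + 1)
        have hx := h.half_norm_iter_succ_le (hφ t₀ ht₀) m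
        have hF := h.two_le_norm_iter_succ hz₀ m
        have hrows := h.half_le_rows m (h.re_expansion_mem m t₀).1
        have hF0 : 0 < ‖iter lam (m + 1) z₀‖ := by linarith
        have hrows' : δ * ‖iter lam (m + 1) z₀‖ / 256 ≤ rows lam δ m p := by
          refine le_trans ?_ hrows
          have : δ * (‖iter lam (m + 1) z₀‖ / 2) ≤ δ * innerRadius lam m p := by gcongr
          linarith
        have hrows0 : (0 : ℝ) < rows lam δ m p := lt_of_lt_of_le (by positivity) hrows'
        have hPm := h.prodChildren_pos m t₀
        have hD := derivNorm_nonneg (lam := lam) m z₀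
        have hwP : 0 < ∏ k ∈ Finset.range m, w (k + 1) :=
          Finset.prod_pos fun k _ => by have := h.two_mul_le (k + 1); linarith
        have hDpos : 0 < derivNorm lam m z₀ := by
          refine Finset.prod_pos fun k _ => ?_
          linarith [h.two_le_norm_iter_succ hz₀ k]
        have hPle := h.prod_le_prodChildren (hφ t₀ ht₀) m
        have hL1 : L + 1 ≤ 3 * R / δ := by
          rw [le_div_iff₀ hδ]
          simp only [L]
          nlinarith
        have hsplit : prodChildren lam c w δ (m + 1) t₀ =
            prodChildren lam c w δ m t₀ * (N * rows lam δ m p) := by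
          rw [prodChildren, Finset.prod_range_succ, ← prodChildren, children]
          push_cast
          rfl
        -- All columns of level `m + 1` may be hit, so their number cancels and the width `w (m +
        -- 1)` is not gained.
        have e1 : (N : ℝ) * ((L + 1) * (1 / prodChildren lam c w δ (m + 1) t₀)) =
            (L + 1) / (prodChildren lam c w δ m t₀ * rows lam δ m p) := by
          rw [hsplit]; field_simp
        rw [e1]
        have hden : (∏ k ∈ Finset.range m, w (k + 1)) * derivNorm lam m z₀ / 1024 ^ m *
            (δ * ‖iter lam (m + 1) z₀‖ / 256) ≤ prodChildren lam c w δ m t₀ * rows lam δ m p :=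
          mul_le_mul hPle hrows' (by positivity) hPm.le
        have hδ2 : 1 ≤ 768 / δ ^ 2 := by
          rw [one_le_div (by positivity)]; nlinarith
        calc (L + 1) / (prodChildren lam c w δ m t₀ * rows lam δ m p)
            ≤ (3 * R / δ) / ((∏ k ∈ Finset.range m, w (k + 1)) * derivNorm lam m z₀ / 1024 ^ m *
              (δ * ‖iter lam (m + 1) z₀‖ / 256)) := by gcongr
          _ = 2048 ^ m * (768 / δ ^ 2) * 2 * r / ∏ k ∈ Finset.range m, w (k + 1) := by
              rw [hR, derivNorm_succ, show (2048 : ℝ) ^ m = 2 ^ m * 1024 ^ m by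
                rw [← mul_pow]; norm_num]
              field_simp
              ring
          _ ≤ 2048 ^ m * (768 / δ ^ 2) ^ (m + 1) * 2048 * r / ∏ k ∈ Finset.range m, w (k + 1) := by
              gcongr
              · exact le_self_pow₀ hδ2 (by omega)
              · norm_num
          _ = _ := by
              congr 1
              rw [show (2048 : ℝ) * 768 / δ ^ 2 = 2048 * (768 / δ ^ 2) by ring, mul_pow, pow_succ]
              ring

/-- A unit mass on the points that stay in the strips, with small mass on small sets. -/
theorem exists_outerMeasure :
    ∃ ν : OuterMeasure ℂ, ν (stripSet lam c w) = 1 ∧ ∀ (B : Set ℂ) (r : ℝ), 0 < r → r < δ →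
      (∀ z ∈ B, ∀ z' ∈ B, ‖z - z'‖ ≤ r) → ν B = 0 ∨ ∃ z ∈ stripSet lam c w, ∃ m,
        2 ^ m * derivNorm lam m z * r < δ ∧ δ ≤ 2 ^ (m + 1) * derivNorm lam (m + 1) z * r ∧
        ν B ≤ ENNReal.ofReal
          ((2048 * 768 / δ ^ 2) ^ (m + 1) * r / ∏ k ∈ Finset.range m, w (k + 1)) := by
  choose! φ hφ using fun t (ht : t ∈ Set.Ico (0 : ℝ) 1) => h.exists_iter_mem_box ht
  -- Working with outer measures makes any choice of `φ` admissible, measurable or not.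
  let ν : OuterMeasure ℂ := OuterMeasure.map φ
    (OuterMeasure.restrict (Set.Ico 0 1) (volume : Measure ℝ).toOuterMeasure)
  have hν : ∀ B, ν B = volume {t | t ∈ Set.Ico (0 : ℝ) 1 ∧ φ t ∈ B} := by
    intro B
    simp only [ν, OuterMeasure.map_apply, OuterMeasure.restrict_apply]
    rw [Measure.toOuterMeasure_apply]
    congr 1
    ext t
    exact and_comm
  refine ⟨ν, ?_, ?_⟩
  · rw [hν]
    have : {t | t ∈ Set.Ico (0 : ℝ) 1 ∧ φ t ∈ stripSet lam c w} = Set.Ico (0 : ℝ) 1 := by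
      ext t
      exact ⟨fun ht => ht.1, fun ht => ⟨ht, h.mem_stripSet (hφ t ht)⟩⟩
    rw [this]; simp
  · intro B r hr hrδ hB
    rw [hν]
    rcases Set.eq_empty_or_nonempty {t | t ∈ Set.Ico (0 : ℝ) 1 ∧ φ t ∈ B} with he | ⟨t₀, ht₀, hB₀⟩
    · left; rw [he]; simp
    · right
      have hz := h.mem_stripSet (hφ t₀ ht₀)
      obtain ⟨m, hm, hm'⟩ := h.exists_level hz hr hrδ
      exact ⟨φ t₀, hz, m, hm, hm', h.volume_le hφ hr hB ht₀ hB₀ hm hm'⟩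

end IsStripSystem

end MassBound

/-! ### Logarithms of products and consequences of the assumptions. -/

section Products

theorem prod_Icc_one_eq_range (f : ℕ → ℝ) (n : ℕ) :
    ∏ i ∈ Finset.Icc 1 n, f i = ∏ k ∈ Finset.range n, f (k + 1) := by
  induction n with
  | zero => simp
  | succ n ih => rw [Finset.prod_Icc_succ_top (by omega), ih, Finset.prod_range_succ]

theorem log_prod_Icc_one {f : ℕ → ℝ} (hf : ∀ n, 0 < f (n + 1)) (n : ℕ) :
    Real.log (∏ i ∈ Finset.Icc 1 n, f i) = logProd f n := by
  rw [prod_Icc_one_eq_range, Real.log_prod fun k _ => (hf k).ne', logProd]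

theorem log_prod_Ico_one {f : ℕ → ℝ} (hf : ∀ n, 0 < f (n + 1)) (n : ℕ) :
    Real.log (∏ i ∈ Finset.Ico 1 (n + 1), f i) = logProd f n := by
  rw [← log_prod_Icc_one hf]
  rfl

variable {α a : ℕ → ℝ}

theorem logProd_le_add_const {N : ℕ} (hpos : ∀ n ≥ N, 0 < a (n + 1))
    (h : ∀ n ≥ N, a (n + 1) ≤ α (n + 1)) :
    ∃ C, 0 ≤ C ∧ ∀ n ≥ N, logProd a n ≤ logProd α n + C := by
  refine ⟨|logProd a N - logProd α N|, abs_nonneg _, fun n hn => ?_⟩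
  induction n, hn using Nat.le_induction with
  | base => linarith [le_abs_self (logProd a N - logProd α N)]
  | succ n hn ih =>
    rw [logProd_succ, logProd_succ]
    linarith [Real.log_le_log (hpos n hn) (h n hn)]

theorem tendsto_logProd_div_of_le {N : ℕ} (hpos : ∀ n ≥ N, 0 < a (n + 1))
    (h : ∀ n ≥ N, a (n + 1) ≤ α (n + 1))
    (ha : Tendsto (fun n : ℕ => logProd a n / n) atTop atTop) :
    Tendsto (fun n : ℕ => logProd α n / n) atTop atTop := by
  obtain ⟨C, hC, hle⟩ := logProd_le_add_const hpos h
  refine tendsto_atTop_mono' _ ?_ (tendsto_atTop_add_const_right _ (-C) ha)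
  filter_upwards [eventually_ge_atTop N, eventually_ge_atTop 1] with n hn hn1
  have hn0 : (1 : ℝ) ≤ n := by exact_mod_cast hn1
  have h1 := hle n hn
  rw [← sub_eq_add_neg, sub_le_iff_le_add, div_le_iff₀ (by linarith), add_mul,
    div_mul_cancel₀ _ (by linarith)]
  nlinarith

end Products

namespace Assumptions

variable {q Δ A : ℝ} {lam : ℕ → ℂ} {a b : ℕ → ℝ} (h : Assumptions q Δ A lam a b)
include h

theorem a_succ_pos (n : ℕ) : 0 < a (n + 1) := h.a_pos _ (by omega)

theorem lam_succ_ne_zero (n : ℕ) : lam (n + 1) ≠ 0 := h.lam_ne_zero _ (by omega)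

theorem a_lt_b_succ (n : ℕ) : a (n + 1) < b (n + 1) := h.a_lt_b _ (by omega)

theorem b_succ_pos (n : ℕ) : 0 < b (n + 1) := (h.a_succ_pos n).trans (h.a_lt_b_succ n)

theorem tendsto_logProd_div : Tendsto (fun n : ℕ => logProd a n / n) atTop atTop := by
  refine (Real.tendsto_log_atTop.comp h.geom_mean).congr fun n => ?_
  have hpos : 0 < ∏ i ∈ Finset.Icc 1 n, a i :=
    Finset.prod_pos fun i hi => h.a_pos i (Finset.mem_Icc.1 hi).1
  simp only [Function.comp]
  rw [Real.log_rpow hpos, log_prod_Icc_one h.a_succ_pos]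
  ring

theorem eventually_logProd_ge (C : ℝ) : ∀ᶠ n : ℕ in atTop, C * n ≤ logProd a n := by
  filter_upwards [h.tendsto_logProd_div.eventually_ge_atTop C, eventually_gt_atTop 0] with n hn hn0
  rwa [le_div_iff₀ (by exact_mod_cast hn0)] at hn

theorem eventually_lt_a : ∀ᶠ n in atTop, A < a n := by
  filter_upwards [eventually_lt_of_lt_liminf h.liminf_gt] with n hn
  exact_mod_cast hn

theorem modulus_succ_gt (n : ℕ) : Δ < modulus a b (n + 1) := h.modulus_gt _ (by omega)

theorem modulus_succ_pos (hΔ : 0 < Δ) (n : ℕ) : 0 < modulus a b (n + 1) :=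
  hΔ.trans (h.modulus_succ_gt n)

theorem le_logProd_modulus (hΔ : 0 < Δ) (n : ℕ) :
    -(|Real.log Δ| * n) ≤ logProd (modulus a b) n := by
  have h1 : ∀ k ∈ Finset.range n, -|Real.log Δ| ≤ Real.log (modulus a b (k + 1)) := fun k _ =>
    (neg_abs_le _).trans (Real.log_le_log hΔ (h.modulus_succ_gt k).le)
  have h2 := Finset.card_nsmul_le_sum _ _ _ h1
  rw [Finset.card_range, nsmul_eq_mul] at h2
  rw [logProd]
  linarith

/-- The moduli exceed `Δ`, so the logarithm of their product is at least linear in `n` with some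
negative slope, which `logProd a n` dominates. Hence the limits in the upper bounds are nonnegative.
-/
theorem eventually_mul_logProd_le (hΔ : 0 < Δ) {z : ℝ} (hz : z < 0) :
    ∀ᶠ n in atTop, z * logProd a n ≤ logProd (modulus a b) (n + 1) := by
  filter_upwards [h.eventually_logProd_ge (2 * |Real.log Δ| / -z), eventually_ge_atTop 1]
    with n hn hn1
  have h1 := h.le_logProd_modulus hΔ (n + 1)
  have hn1' : (1 : ℝ) ≤ n := by exact_mod_cast hn1
  rw [div_mul_eq_mul_div, div_le_iff₀ (by linarith)] at hn
  push_cast at h1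
  nlinarith [abs_nonneg (Real.log Δ)]

/-- The first `n` factors exceed `Δ`, so a bound on the product passes to its last factor at the
cost of `exp (|log Δ| * n)`. -/
theorem modulus_add_one_le (hΔ : 0 < Δ) {τ : ℝ} {n : ℕ} (hn : 1 ≤ n)
    (h0 : 0 ≤ τ * logProd a n) (hle : logProd (modulus a b) (n + 1) ≤ τ * logProd a n) :
    modulus a b (n + 1) + 1 ≤ (2 * Real.exp |Real.log Δ|) ^ n * Real.exp (τ * logProd a n) := by
  have h1 := h.le_logProd_modulus hΔ n
  rw [logProd_succ] at hle
  have h2 : modulus a b (n + 1) ≤ Real.exp (|Real.log Δ| * n + τ * logProd a n) := by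
    rw [← Real.log_le_iff_le_exp (h.modulus_succ_pos hΔ n)]
    linarith
  have h3 : 1 ≤ Real.exp (|Real.log Δ| * n + τ * logProd a n) :=
    Real.one_le_exp (by positivity)
  calc modulus a b (n + 1) + 1 ≤ 2 * Real.exp (|Real.log Δ| * n + τ * logProd a n) := by linarith
    _ ≤ 2 ^ n * Real.exp (|Real.log Δ| * n + τ * logProd a n) := by
        gcongr
        exact le_self_pow₀ (by norm_num) (by omega)
    _ = _ := by
        rw [Real.exp_add, mul_pow, ← Real.exp_nat_mul, mul_comm (n : ℝ)]
        ring

end Assumptions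

/-! ### Reduction to constraints on all iterates. -/

section Truncation

/-- The sequence `a` with its first terms replaced by `x`. -/
def truncate (N : ℕ) (x : ℝ) (a : ℕ → ℝ) (n : ℕ) : ℝ := if n < N then x else a n

theorem truncate_of_le {N n : ℕ} (hn : N ≤ n) (x : ℝ) (a : ℕ → ℝ) : truncate N x a n = a n :=
  if_neg (by omega)

namespace Assumptions

variable {q Δ A : ℝ} {lam : ℕ → ℂ} {a b : ℕ → ℝ} (h : Assumptions q Δ A lam a b)

/-- Finitely many initial iterates are nonzero and finite, hence lie in a large annulus. The outer
radius `M + 2` exceeds the inner radius `1 / (M + 1)` strictly even for `M = 0`. -/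
theorem rateSet_subset (hlam : ∀ n, lam (n + 1) ≠ 0) (N₀ : ℕ) :
    rateSet lam a b ⊆ ⋃ i : ℕ × ℕ, boundedRateSet lam
      (truncate (N₀ + i.1) (1 / ((i.2 : ℝ) + 1)) a) (truncate (N₀ + i.1) ((i.2 : ℝ) + 2) b) i.2 := by
  intro z hz
  obtain ⟨N, hN⟩ := eventually_atTop.1 hz
  have hM : ∀ᶠ M : ℕ in atTop, ‖z‖ ≤ M ∧ ∀ n ∈ Finset.range (N₀ + N),
      1 / ((M : ℝ) + 1) ≤ ‖iter lam (n + 1) z‖ ∧ ‖iter lam (n + 1) z‖ ≤ (M : ℝ) + 2 := by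
    refine (tendsto_natCast_atTop_atTop.eventually_ge_atTop ‖z‖).and
      ((Finset.eventually_all _).2 fun n _ => ?_)
    have hpos : 0 < ‖iter lam (n + 1) z‖ := by
      rw [norm_iter_succ]
      exact mul_pos (norm_pos_iff.2 (hlam n)) (Real.exp_pos _)
    filter_upwards [(tendsto_natCast_atTop_atTop (R := ℝ)).eventually_ge_atTop
      (1 / ‖iter lam (n + 1) z‖), (tendsto_natCast_atTop_atTop (R := ℝ)).eventually_ge_atTop
      ‖iter lam (n + 1) z‖] with M h1 h2
    refine ⟨?_, by linarith⟩
    rw [div_le_iff₀ hpos] at h1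
    rw [div_le_iff₀ (by positivity)]
    linarith
  obtain ⟨M, hM1, hM2⟩ := hM.exists
  refine Set.mem_iUnion.2 ⟨(N, M), hM1, fun n => ?_⟩
  by_cases hn : n + 1 < N₀ + N
  · simp only [truncate, if_pos hn]
    exact hM2 n (Finset.mem_range.2 (by omega))
  · simp only [truncate, if_neg hn]
    exact hN (n + 1) (by omega)

include h

/-- The truncated sequences satisfy uniform assumptions. -/
theorem truncate_spec (N M : ℕ) (hN : ∀ n ≥ N, 1 ≤ a n) :
    (∀ n, 1 / ((M : ℝ) + 1) ≤ truncate N (1 / ((M : ℝ) + 1)) a (n + 1)) ∧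
    (∀ n, truncate N (1 / ((M : ℝ) + 1)) a (n + 1) < truncate N ((M : ℝ) + 2) b (n + 1)) ∧
    Tendsto (fun n : ℕ => logProd (truncate N (1 / ((M : ℝ) + 1)) a) n / n) atTop atTop ∧
    (∀ n ≥ N, Real.log (truncate N ((M : ℝ) + 2) b n / truncate N (1 / ((M : ℝ) + 1)) a n) =
      modulus a b n) ∧
    ∃ C, 0 ≤ C ∧ ∀ n ≥ N, logProd a n ≤ logProd (truncate N (1 / ((M : ℝ) + 1)) a) n + C := by
  have hM1 : 1 / ((M : ℝ) + 1) ≤ 1 := by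
    rw [div_le_one (by positivity)]; linarith [Nat.cast_nonneg (α := ℝ) M]
  have heq : ∀ n ≥ N, a (n + 1) ≤ truncate N (1 / ((M : ℝ) + 1)) a (n + 1) := fun n hn =>
    (truncate_of_le (by omega) _ _).ge
  refine ⟨fun n => ?_, fun n => ?_, ?_, fun n hn => ?_, ?_⟩
  · by_cases hn : n + 1 < N
    · simp only [truncate, if_pos hn]; exact le_rfl
    · simp only [truncate, if_neg hn]
      exact hM1.trans (hN _ (by omega))
  · by_cases hn : n + 1 < N
    · simp only [truncate, if_pos hn]
      linarith [Nat.cast_nonneg (α := ℝ) M]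
    · simp only [truncate, if_neg hn]
      exact h.a_lt_b_succ n
  · exact tendsto_logProd_div_of_le (fun n _ => h.a_succ_pos n) heq h.tendsto_logProd_div
  · rw [truncate_of_le hn, truncate_of_le hn, modulus]
  · exact logProd_le_add_const (fun n _ => h.a_succ_pos n) heq

theorem modulus_add_one_le_truncate (hΔ : 0 < Δ) {τ : ℝ} (hτ : 0 ≤ τ) (N M : ℕ)
    (hN : ∀ n ≥ N, 1 ≤ a n) : ∃ B : ℝ, 0 ≤ B ∧ ∀ᶠ n in atTop,
      logProd (modulus a b) (n + 1) ≤ τ * logProd a n →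
      Real.log (truncate N ((M : ℝ) + 2) b (n + 1) / truncate N (1 / ((M : ℝ) + 1)) a (n + 1)) + 1 ≤
        B ^ n * Real.exp (τ * logProd (truncate N (1 / ((M : ℝ) + 1)) a) n) := by
  obtain ⟨-, -, -, h4, C, hC, h5⟩ := h.truncate_spec N M hN
  refine ⟨2 * Real.exp |Real.log Δ| * Real.exp (τ * C), by positivity, ?_⟩
  filter_upwards [eventually_ge_atTop N, eventually_ge_atTop 1, h.eventually_logProd_ge 0]
    with n hn hn1 hn0 hle
  rw [h4 (n + 1) (by omega)]
  rw [zero_mul] at hn0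
  refine (h.modulus_add_one_le hΔ hn1 (by positivity) hle).trans ?_
  rw [mul_pow _ (Real.exp (τ * C)), mul_assoc]
  gcongr
  calc Real.exp (τ * logProd a n)
      ≤ Real.exp (τ * C + τ * logProd (truncate N (1 / ((M : ℝ) + 1)) a) n) := by
        refine Real.exp_le_exp.2 ?_
        have := mul_le_mul_of_nonneg_left (h5 n hn) hτ
        linarith
    _ = Real.exp (τ * C) * Real.exp (τ * logProd (truncate N (1 / ((M : ℝ) + 1)) a) n) :=
        Real.exp_add _ _
    _ ≤ _ := by
        gcongr
        exact le_self_pow₀ (Real.one_le_exp (by positivity)) (by omega)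

theorem dimH_rateSet_le (hA : 1 ≤ A) (hΔ : 0 < Δ) {t τ D : ℝ} (ht : 0 < t) (hτ : 0 ≤ τ)
    (hτt : τ < t) (hD : 1 ≤ D)
    (hfreq : ∃ᶠ n in atTop, modulus a b (n + 2) ≤ D * a (n + 1) ∨
      logProd (modulus a b) (n + 1) ≤ τ * logProd a n) :
    dimH (rateSet lam a b) ≤ ENNReal.ofReal (1 + t) := by
  obtain ⟨N₀, hN₀⟩ := eventually_atTop.1 h.eventually_lt_a
  refine (dimH_mono (rateSet_subset h.lam_succ_ne_zero N₀)).trans ?_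
  rw [dimH_iUnion]
  refine iSup_le fun i => ?_
  have hN : ∀ n ≥ N₀ + i.1, 1 ≤ a n := fun n hn => (hA.trans_lt (hN₀ n (by omega))).le
  obtain ⟨h1, h2, h3, h4, -⟩ := h.truncate_spec (N₀ + i.1) i.2 hN
  obtain ⟨B, hB, hBle⟩ := h.modulus_add_one_le_truncate hΔ hτ (N₀ + i.1) i.2 hN
  refine dimH_boundedRateSet_le h.lam_succ_ne_zero (by positivity) h1 h2 (Nat.cast_nonneg _) ht h3
    hD hB hτt ?_
  refine (hfreq.and_eventually (hBle.and (eventually_ge_atTop (N₀ + i.1)))).mono ?_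
  rintro n ⟨hn | hn, hn1, hn2⟩
  · left
    rwa [h4 (n + 2) (by omega), truncate_of_le (by omega)]
  · exact Or.inr (hn1 hn)

theorem dimP_rateSet_le (hA : 1 ≤ A) (hΔ : 0 < Δ) {t τ : ℝ} (ht : 0 < t) (hτ : 0 ≤ τ)
    (hτt : τ < t)
    (hev : ∀ᶠ n in atTop, logProd (modulus a b) (n + 1) ≤ τ * logProd a n) :
    dimP (rateSet lam a b) ≤ ENNReal.ofReal (1 + t) := by
  obtain ⟨N₀, hN₀⟩ := eventually_atTop.1 h.eventually_lt_a
  rcases le_or_gt t 1 with ht1 | ht1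
  · refine dimP_le_of_packingPremeasure_ne_top (rateSet_subset h.lam_succ_ne_zero N₀) fun i => ?_
    have hN : ∀ n ≥ N₀ + i.1, 1 ≤ a n := fun n hn => (hA.trans_lt (hN₀ n (by omega))).le
    obtain ⟨h1, h2, h3, -, -⟩ := h.truncate_spec (N₀ + i.1) i.2 hN
    obtain ⟨B, hB, hBle⟩ := h.modulus_add_one_le_truncate hΔ hτ (N₀ + i.1) i.2 hN
    refine packingPremeasure_boundedRateSet_ne_top h.lam_succ_ne_zero (by positivity) h1 h2
      (Nat.cast_nonneg _) ht ht1 h3 hτt (B := B) ?_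
    filter_upwards [hev, hBle] with n hn hn1 using hn1 hn
  -- For `t > 1` comparison of areas in the plane suffices.
  · refine (dimP_le_of_packingPremeasure_ne_top (s := 2) (rateSet_subset h.lam_succ_ne_zero N₀)
      fun i => ?_).trans (ENNReal.ofReal_le_ofReal (by linarith))
    exact packingPremeasure_two_ne_top (Nat.cast_nonneg _) fun z hz => hz.1

end Assumptions

end Truncation

/-! ### Lower bounds for the dimensions of strip systems. -/

section StripDimension

variable {lam : ℕ → ℂ} {c w : ℕ → ℝ} {δ : ℝ}

/-- The inner radius of the annulus of level `n` of a system of strips. -/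
noncomputable def stripLower (lam : ℕ → ℂ) (c : ℕ → ℝ) (n : ℕ) : ℝ :=
  ‖lam n‖ * Real.exp (c (n - 1))

/-- The outer radius of the annulus of level `n` of a system of strips. -/
noncomputable def stripUpper (lam : ℕ → ℂ) (c w : ℕ → ℝ) (n : ℕ) : ℝ :=
  ‖lam n‖ * Real.exp (c (n - 1) + w (n - 1))

theorem exists_pow_mul_exp_le {L : ℕ → ℝ} (hL : Tendsto (fun n => L n / n) atTop atTop)
    {τ : ℝ} (hτ : 0 < τ) {C : ℝ} (hC : 0 ≤ C) :
    ∃ K, 0 < K ∧ ∀ n, C ^ n * Real.exp (-τ * L n) ≤ K := by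
  obtain ⟨K, hK⟩ := (tendsto_pow_mul_exp hL hτ hC).bddAbove_range
  exact ⟨max K 1, by positivity, fun n => (hK ⟨n, rfl⟩).trans (le_max_left _ _)⟩

theorem derivNorm_le_prod {z : ℂ} (hz : z ∈ stripSet lam c w) (n : ℕ) :
    derivNorm lam n z ≤ ∏ k ∈ Finset.range n, stripUpper lam c w (k + 1) := by
  refine Finset.prod_le_prod (fun k _ => norm_nonneg _) fun k _ => ?_
  rw [norm_iter_succ, stripUpper]
  have := (hz k).2
  simp only [add_tsub_cancel_right]
  gcongr

namespace IsStripSystem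

variable (h : IsStripSystem lam c w δ)
include h

theorem stripLower_pos (n : ℕ) : 0 < stripLower lam c (n + 1) :=
  mul_pos (norm_pos_iff.2 (h.lam_ne_zero n)) (Real.exp_pos _)

theorem exp_logProd_le_derivNorm {z : ℂ} (hz : z ∈ stripSet lam c w) (n : ℕ) :
    Real.exp (logProd (stripLower lam c) n) ≤ derivNorm lam n z := by
  rw [exp_logProd h.stripLower_pos]
  refine Finset.prod_le_prod (fun k _ => (h.stripLower_pos k).le) fun k _ => ?_
  rw [norm_iter_succ, stripLower]
  have := (hz k).1
  simp only [add_tsub_cancel_right]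
  gcongr

theorem prod_width_pos (n : ℕ) : 0 < ∏ k ∈ Finset.range n, w (k + 1) :=
  Finset.prod_pos fun k _ => by have := h.two_mul_le (k + 1); have := h.pos; linarith

theorem prod_width_le {n m : ℕ} (hnm : n ≤ m) :
    (∏ k ∈ Finset.range m, w (k + 1))⁻¹ ≤
      (1 / (2 * δ)) ^ m * (∏ k ∈ Finset.range n, w (k + 1))⁻¹ := by
  have hδ := h.pos
  have hδ1 := h.le_quarter
  have h1 : (1 : ℝ) ≤ 1 / (2 * δ) := by
    rw [one_le_div (by linarith)]; linarith
  induction m, hnm using Nat.le_induction with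
  | base =>
    have := h.prod_width_pos n
    exact le_mul_of_one_le_left (by positivity) (one_le_pow₀ h1)
  | succ m hm ih =>
    have h2 := h.two_mul_le (m + 1)
    have h3 : (w (m + 1))⁻¹ ≤ 1 / (2 * δ) := by
      rw [one_div]; gcongr
    have h4 := h.prod_width_pos n
    have h5 : 0 ≤ (w (m + 1))⁻¹ := inv_nonneg.2 (by linarith)
    rw [Finset.prod_range_succ, mul_inv]
    calc _ ≤ ((1 / (2 * δ)) ^ m * (∏ k ∈ Finset.range n, w (k + 1))⁻¹) * (1 / (2 * δ)) := by
          gcongr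
      _ = _ := by rw [pow_succ]; ring

theorem lt_exp_neg_logProd {z : ℂ} (hz : z ∈ stripSet lam c w) {m : ℕ} {r : ℝ} (hr : 0 < r)
    (hm : 2 ^ m * derivNorm lam m z * r < δ) : r ≤ Real.exp (-logProd (stripLower lam c) m) := by
  have h1 := h.exp_logProd_le_derivNorm hz m
  have h2 : Real.exp (logProd (stripLower lam c) m) * r ≤ 1 := by
    calc _ ≤ derivNorm lam m z * r := by gcongr
      _ ≤ 2 ^ m * derivNorm lam m z * r := by
        gcongr
        exact le_mul_of_one_le_left (derivNorm_nonneg _ _) (one_le_pow₀ (by norm_num))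
      _ ≤ 1 := by linarith [h.le_quarter]
  rw [Real.exp_neg, ← one_div, le_div_iff₀ (Real.exp_pos _), mul_comm]
  exact h2

/-- At level `m` the scale satisfies `r ≤ exp (-logProd (stripLower lam c) m)`, so a factor `C ^ m`
costs only an arbitrarily small power of `r`. -/
theorem pow_mul_le_rpow {ε C : ℝ} (hε : 0 < ε)
    {K : ℝ} (hK0 : 0 < K)
    (hK : ∀ n, C ^ n * Real.exp (-ε * logProd (stripLower lam c) n) ≤ K) {z : ℂ}
    (hz : z ∈ stripSet lam c w) {m : ℕ} {r : ℝ} (hr : 0 < r)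
    (hm : 2 ^ m * derivNorm lam m z * r < δ) : C ^ m ≤ K * r ^ (-ε) := by
  have h1 := h.lt_exp_neg_logProd hz hr hm
  have h2 : Real.exp (ε * logProd (stripLower lam c) m) ≤ r ^ (-ε) := by
    have h3 := Real.rpow_le_rpow_of_nonpos hr h1 (by linarith : -ε ≤ 0)
    rw [← Real.exp_mul] at h3
    refine le_trans (le_of_eq ?_) h3
    congr 1; ring
  have h4 := hK m
  rw [neg_mul, Real.exp_neg, ← div_eq_mul_inv, div_le_iff₀ (Real.exp_pos _)] at h4
  exact h4.trans (by gcongr)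

/-- Mass distribution principle: widths are at least `2 * δ`, so the local bound reads `C ^ m * r`,
at most a multiple of `r ^ s` for each `s < 1`. -/
theorem one_le_dimH (hL : Tendsto (fun n : ℕ => logProd (stripLower lam c) n / n) atTop atTop) :
    1 ≤ dimH (stripSet lam c w) := by
  obtain ⟨ν, hν1, hν⟩ := h.exists_outerMeasure
  have hδ := h.pos
  set C : ℝ := 2048 * 768 / δ ^ 2
  have hC : 0 < C := by positivity
  refine le_of_forall_lt fun s' hs' => ?_
  obtain ⟨s, hs's, hs1⟩ := exists_between hs'
  lift s to ℝ≥0 using hs1.ne_top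
  have hs1' : (s : ℝ) < 1 := by exact_mod_cast hs1
  refine hs's.trans_le (le_dimH_of_hausdorffMeasure_ne_zero ?_)
  obtain ⟨K, hK0, hK⟩ := exists_pow_mul_exp_le hL (sub_pos.2 hs1') (C := C * (1 / (2 * δ)))
    (by positivity)
  have key : ∀ (B : Set ℂ) (r : ℝ), 0 < r → r < δ → (∀ z ∈ B, ∀ z' ∈ B, ‖z - z'‖ ≤ r) →
      ν B ≤ ENNReal.ofReal (C * K) * ENNReal.ofReal r ^ (s : ℝ) := by
    intro B r hr hrδ hB
    rcases hν B r hr hrδ hB with h0 | ⟨z, hz, m, hm, -, hle⟩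
    · rw [h0]; exact zero_le
    · refine hle.trans ?_
      rw [ENNReal.ofReal_rpow_of_pos hr, ← ENNReal.ofReal_mul (by positivity)]
      refine ENNReal.ofReal_le_ofReal ?_
      have h1 := h.prod_width_le (Nat.zero_le m)
      rw [Finset.range_zero, Finset.prod_empty, inv_one, mul_one] at h1
      have h2 := h.pow_mul_le_rpow (sub_pos.2 hs1') hK0 hK hz hr hm
      rw [mul_pow] at h2
      calc C ^ (m + 1) * r / ∏ k ∈ Finset.range m, w (k + 1)
          = C ^ (m + 1) * r * (∏ k ∈ Finset.range m, w (k + 1))⁻¹ := div_eq_mul_inv _ _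
        _ ≤ C ^ (m + 1) * r * (1 / (2 * δ)) ^ m := by gcongr
        _ = C * r * (C ^ m * (1 / (2 * δ)) ^ m) := by ring
        _ ≤ C * r * (K * r ^ (-(1 - (s : ℝ)))) := by gcongr
        _ = C * K * (r ^ (1 : ℝ) * r ^ (-(1 - (s : ℝ)))) := by rw [Real.rpow_one]; ring
        _ = _ := by rw [← Real.rpow_add hr]; congr 2; ring
  have hle : ν ≤ OuterMeasure.mkMetric (ENNReal.ofReal (C * K) • fun x => x ^ (s : ℝ)) := by
    refine OuterMeasure.le_mkMetric _ ν (ENNReal.ofReal (δ / 2)) (by simpa using hδ) fun B hB => ?_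
    have hfin : Metric.ediam B ≠ ∞ := ne_top_of_le_ne_top ENNReal.ofReal_ne_top hB
    set d := (Metric.ediam B).toReal
    have hd : Metric.ediam B = ENNReal.ofReal d := (ENNReal.ofReal_toReal hfin).symm
    have hd0 : 0 ≤ d := ENNReal.toReal_nonneg
    have hdδ : d < δ := by
      rw [hd, ENNReal.ofReal_le_ofReal_iff (by linarith)] at hB
      linarith
    -- The estimate needs a positive radius, while the diameter `d` may be 0; let `r` decrease to
    -- `d`.
    have hlim : Tendsto (fun r => ENNReal.ofReal (C * K) * ENNReal.ofReal r ^ (s : ℝ)) (𝓝[>] d)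
        (𝓝 (ENNReal.ofReal (C * K) * ENNReal.ofReal d ^ (s : ℝ))) := by
      have hc : Continuous fun r : ℝ => ENNReal.ofReal (C * K) * ENNReal.ofReal r ^ (s : ℝ) :=
        (ENNReal.continuous_const_mul ENNReal.ofReal_ne_top).comp
          ((ENNReal.continuous_rpow_const).comp ENNReal.continuous_ofReal)
      exact (hc.tendsto d).mono_left nhdsWithin_le_nhds
    rw [Pi.smul_apply, smul_eq_mul, hd]
    refine ge_of_tendsto hlim ?_
    filter_upwards [Ioo_mem_nhdsGT hdδ] with r hr
    refine key B r (hd0.trans_lt hr.1) hr.2 fun z hz z' hz' => ?_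
    rw [← dist_eq_norm, ← ENNReal.ofReal_le_ofReal_iff (hd0.trans hr.1.le), ← edist_dist]
    exact (Metric.edist_le_ediam_of_mem hz hz').trans (hd.le.trans
      (ENNReal.ofReal_le_ofReal hr.1.le))
  have h1 := hle (stripSet lam c w)
  rw [OuterMeasure.mkMetric_smul _ ENNReal.ofReal_ne_top
    (by simpa using mul_pos hC hK0), hν1] at h1
  intro h0
  rw [Measure.hausdorffMeasure, ← OuterMeasure.coe_mkMetric] at h0
  change 1 ≤ ENNReal.ofReal (C * K) * _ at h1
  rw [h0, mul_zero] at h1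
  exact absurd h1 (by simp)

/-- At a scale slightly below the reciprocal of the largest derivative of order `n`, every point has
level at least `n`. So the first `n` widths all reduce the mass, and the hypothesis converts them
into the extra power `σ` of the scale. Infinitely many such scales suffice for packing measures. -/
theorem le_dimP (hL : Tendsto (fun n : ℕ => logProd (stripLower lam c) n / n) atTop atTop)
    {σ K₀ E : ℝ} (hK₀ : 0 < K₀) (hE : 1 ≤ E)
    (hfreq : ∃ᶠ n in atTop, (2 ^ n * ∏ k ∈ Finset.range n, stripUpper lam c w (k + 1)) ^ σ ≤
      K₀ * E ^ n * ∏ k ∈ Finset.range n, w (k + 1)) :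
    ENNReal.ofReal (1 + σ) ≤ dimP (stripSet lam c w) := by
  obtain ⟨ν, hν1, hν⟩ := h.exists_outerMeasure
  have hδ := h.pos
  have hδ1 := h.le_quarter
  set C : ℝ := 2048 * 768 / δ ^ 2
  have hC : 0 < C := by positivity
  have hU : ∀ n, 2 ≤ stripUpper lam c w (n + 1) := by
    intro n
    have h1 := h.le_norm n
    have h2 : 2 ≤ 64 / δ := by rw [le_div_iff₀ hδ]; linarith
    have h3 : ‖lam (n + 1)‖ * Real.exp (c n) ≤ stripUpper lam c w (n + 1) := by
      rw [stripUpper, add_tsub_cancel_right]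
      have := h.two_mul_le n
      gcongr
      linarith
    linarith
  -- it suffices to lose an arbitrarily small amount
  suffices hs : ∀ ε > 0, ENNReal.ofReal (1 + σ - ε) ≤ dimP (stripSet lam c w) by
    have hlim : Tendsto (fun ε : ℝ => ENNReal.ofReal (1 + σ - ε)) (𝓝[>] 0)
        (𝓝 (ENNReal.ofReal (1 + σ))) := by
      have hc : Continuous fun ε : ℝ => ENNReal.ofReal (1 + σ - ε) :=
        ENNReal.continuous_ofReal.comp (by fun_prop)
      have := hc.tendsto 0
      rw [sub_zero] at this
      exact this.mono_left nhdsWithin_le_nhds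
    exact le_of_tendsto hlim (eventually_nhdsWithin_of_forall fun ε hε => hs ε hε)
  intro ε hε
  refine le_dimP_of_packingMeasure_ne_zero fun h0 => ?_
  obtain ⟨K, hK0, hK⟩ := exists_pow_mul_exp_le hL hε (C := C * (1 / (2 * δ)) * E)
    (by positivity)
  set K₁ : ℝ := C * K * K₀ * (2 / δ) ^ σ * 2 ^ (1 + σ - ε)
  have hK₁ : 0 < K₁ := by positivity
  have hle := le_mul_packingMeasure (s := 1 + σ - ε) hK₁ ν ?_ (stripSet lam c w)
  · rw [hν1, h0, mul_zero] at hle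
    exact absurd hle (by simp)
  intro δ' hδ'
  have hsmall : ∀ᶠ n : ℕ in atTop, (1 / 2 : ℝ) ^ n ≤ δ' :=
    (tendsto_pow_atTop_nhds_zero_of_lt_one (by norm_num) (by norm_num)).eventually_le_const hδ'
  obtain ⟨n, hn, hnδ'⟩ := (hfreq.and_eventually hsmall).exists
  set P := ∏ k ∈ Finset.range n, stripUpper lam c w (k + 1)
  have hP1 : 1 ≤ P := by
    rw [← Finset.prod_const_one (s := Finset.range n)]
    exact Finset.prod_le_prod (fun _ _ => zero_le_one) fun k _ => by linarith [hU k]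
  -- Then `2 ^ n * P * ρ = δ / 2 < δ`, which forces `n ≤ m`. The packing radius is `ρ / 4`, as sets
  -- of diameter four times that radius are tested.
  set ρ : ℝ := δ / (2 * (2 ^ n * P)) with hρ
  have hρ0 : 0 < ρ := by positivity
  have hρδ : ρ ≤ δ / 2 := by
    rw [hρ]
    gcongr
    nlinarith [one_le_pow₀ (n := n) (one_le_two (α := ℝ))]
  refine ⟨ρ / 4, by positivity, ?_, fun B hB => ?_⟩
  · refine le_trans ?_ hnδ'
    have h1 : ρ ≤ 1 / 2 ^ n := by
      rw [hρ]
      gcongr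
      · linarith
      · have : (0 : ℝ) < 2 ^ n := by positivity
        nlinarith
    rw [one_div_pow]
    linarith
  have hB' : ∀ z ∈ B, ∀ z' ∈ B, ‖z - z'‖ ≤ ρ := fun z hz z' hz' => by
    have := hB z hz z' hz'
    rw [dist_eq_norm] at this
    linarith
  rcases hν B ρ hρ0 (by linarith) hB' with h0 | ⟨z, hz, m, hm, hm', hle⟩
  · rw [h0]; exact zero_le
  · refine hle.trans ?_
    rw [ENNReal.ofReal_rpow_of_pos (by positivity), ← ENNReal.ofReal_mul (by positivity)]
    refine ENNReal.ofReal_le_ofReal ?_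
    have hnm : n ≤ m := by
      by_contra hcon
      have h1 := h.pow_mul_derivNorm_mono hz (show m + 1 ≤ n by omega)
      have h2 := derivNorm_le_prod hz n
      have h3 : 2 ^ n * derivNorm lam n z ≤ 2 ^ n * P := by gcongr
      have h4 : 2 ^ (m + 1) * derivNorm lam (m + 1) z * ρ ≤ 2 ^ n * P * ρ :=
        mul_le_mul_of_nonneg_right (h1.trans h3) hρ0.le
      have h5 : 2 ^ n * P * ρ = δ / 2 := by rw [hρ]; field_simp
      linarith
    have h1 := h.prod_width_le hnm
    have h2 := h.pow_mul_le_rpow hε hK0 hK hz hρ0 hm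
    rw [mul_pow, mul_pow] at h2
    have hW := h.prod_width_pos n
    have h3 : (∏ k ∈ Finset.range n, w (k + 1))⁻¹ ≤ K₀ * E ^ m * ((2 / δ) ^ σ * ρ ^ σ) := by
      have h4 : (2 ^ n * P) = (2 / δ * ρ)⁻¹ := by rw [hρ]; field_simp
      rw [h4, Real.inv_rpow (by positivity), Real.mul_rpow (by positivity) hρ0.le,
        inv_le_iff_one_le_mul₀ (by positivity)] at hn
      rw [inv_le_iff_one_le_mul₀ hW]
      refine hn.trans ?_
      have h5 : E ^ n ≤ E ^ m := pow_le_pow_right₀ hE hnm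
      calc _ = K₀ * E ^ n * ((2 / δ) ^ σ * ρ ^ σ) * ∏ k ∈ Finset.range n, w (k + 1) := by ring
        _ ≤ _ := by gcongr
    calc C ^ (m + 1) * ρ / ∏ k ∈ Finset.range m, w (k + 1)
        = C ^ (m + 1) * ρ * (∏ k ∈ Finset.range m, w (k + 1))⁻¹ := div_eq_mul_inv _ _
      _ ≤ C ^ (m + 1) * ρ * ((1 / (2 * δ)) ^ m * (K₀ * E ^ m * ((2 / δ) ^ σ * ρ ^ σ))) := by
          gcongr
          exact h1.trans (by gcongr)
      _ = C * K₀ * (2 / δ) ^ σ * (ρ * ρ ^ σ) * (C ^ m * (1 / (2 * δ)) ^ m * E ^ m) := by ring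
      _ ≤ C * K₀ * (2 / δ) ^ σ * (ρ * ρ ^ σ) * (K * ρ ^ (-ε)) := by gcongr
      _ = C * K * K₀ * (2 / δ) ^ σ * (ρ ^ (1 : ℝ) * ρ ^ σ * ρ ^ (-ε)) := by
          rw [Real.rpow_one]; ring
      _ = C * K * K₀ * (2 / δ) ^ σ * ρ ^ (1 + σ - ε) := by
          rw [← Real.rpow_add hρ0, ← Real.rpow_add hρ0, ← sub_eq_add_neg]
      _ = K₁ * (2 * (ρ / 4)) ^ (1 + σ - ε) := by
          rw [show 2 * (ρ / 4) = ρ / 2 by ring, Real.div_rpow hρ0.le (by norm_num)]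
          simp only [K₁]
          field_simp

theorem one_le_dimP (hL : Tendsto (fun n : ℕ => logProd (stripLower lam c) n / n) atTop atTop) :
    1 ≤ dimP (stripSet lam c w) := by
  have hδ := h.pos
  have hE : (1 : ℝ) ≤ 1 / (2 * δ) := by
    rw [one_le_div (by linarith)]; linarith [h.le_quarter]
  have := h.le_dimP hL (σ := 0) one_pos hE (Eventually.of_forall fun n => ?_).frequently
  · simpa using this
  · have h1 := h.prod_width_le (Nat.zero_le n)
    rw [Finset.range_zero, Finset.prod_empty, inv_one, mul_one,
      inv_le_iff_one_le_mul₀ (h.prod_width_pos n)] at h1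
    simpa using h1

end IsStripSystem

end StripDimension

/-! ### Construction of strips from the admissibility condition. -/

section Construction

/-- The initial strips are filled in backwards: each gets width `2 * δ` and is placed so that its
inner image radius is large enough for the strip after it. -/
theorem exists_isStripSystem_of_tail {lam : ℕ → ℂ} {δ : ℝ} (hδ : 0 < δ) (hδ1 : δ ≤ 1 / 4)
    (hlam : ∀ n, lam (n + 1) ≠ 0) (N : ℕ) : ∀ c w : ℕ → ℝ, (∀ n ≥ N, 2 * δ ≤ w n) →
    (∀ n ≥ N, 64 / δ ≤ ‖lam (n + 1)‖ * Real.exp (c n)) →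
    (∀ n ≥ N, -(‖lam (n + 1)‖ * Real.exp (c n)) ≤ c (n + 1)) →
    (∀ n ≥ N, c (n + 1) + w (n + 1) ≤ ‖lam (n + 1)‖ * Real.exp (c n)) →
    ∃ c' w', IsStripSystem lam c' w' δ ∧ ∀ n ≥ N, c' n = c n ∧ w' n = w n := by
  induction N with
  | zero =>
    intro c w h1 h2 h3 h4
    exact ⟨c, w, ⟨hδ, hδ1, hlam, fun n => h1 n n.zero_le, fun n => h2 n n.zero_le,
      fun n => h3 n n.zero_le, fun n => h4 n n.zero_le⟩, fun n _ => ⟨rfl, rfl⟩⟩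
  | succ N ih =>
    intro c w h1 h2 h3 h4
    set x : ℝ := max (64 / δ) (|c (N + 1)| + |w (N + 1)|)
    have hx : 0 < x := lt_max_of_lt_left (by positivity)
    have hlamN : 0 < ‖lam (N + 1)‖ := norm_pos_iff.2 (hlam N)
    set c₁ := Function.update c N (Real.log (x / ‖lam (N + 1)‖))
    set w₁ := Function.update w N (2 * δ)
    have hc : ∀ n ≥ N + 1, c₁ n = c n := fun n hn => Function.update_of_ne (by omega) _ _
    have hw : ∀ n ≥ N + 1, w₁ n = w n := fun n hn => Function.update_of_ne (by omega) _ _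
    have hcN : ‖lam (N + 1)‖ * Real.exp (c₁ N) = x := by
      simp only [c₁, Function.update_self]
      rw [Real.exp_log (by positivity)]
      field_simp
    have key : ∃ c' w', IsStripSystem lam c' w' δ ∧ ∀ n ≥ N, c' n = c₁ n ∧ w' n = w₁ n := by
      apply ih c₁ w₁
      all_goals
        intro n hn
        rcases hn.lt_or_eq with hn | rfl
      · rw [hw n hn]; exact h1 n hn
      · simp [w₁]
      · rw [hc n hn]; exact h2 n hn
      · rw [hcN]; exact le_max_left _ _
      · rw [hc n hn, hc (n + 1) (by omega)]; exact h3 n hn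
      · rw [hcN, hc (N + 1) le_rfl]
        linarith [le_max_right (64 / δ) (|c (N + 1)| + |w (N + 1)|), neg_abs_le (c (N + 1)),
          abs_nonneg (w (N + 1))]
      · rw [hc n hn, hc (n + 1) (by omega), hw (n + 1) (by omega)]; exact h4 n hn
      · rw [hcN, hc (N + 1) le_rfl, hw (N + 1) le_rfl]
        linarith [le_max_right (64 / δ) (|c (N + 1)| + |w (N + 1)|), le_abs_self (c (N + 1)),
          le_abs_self (w (N + 1))]
    obtain ⟨c', w', hsys, heq⟩ := key
    refine ⟨c', w', hsys, fun n hn => ?_⟩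
    obtain ⟨e1, e2⟩ := heq n (by omega)
    exact ⟨e1.trans (hc n hn), e2.trans (hw n hn)⟩

namespace Assumptions

variable {q Δ A : ℝ} {lam : ℕ → ℂ} {a b : ℕ → ℝ} (h : Assumptions q Δ A lam a b)
include h

theorem exists_isStripSystem (hq0 : 0 < q) (hq1 : q < 1) {δ : ℝ} (hδ : 0 < δ) (hδ1 : δ ≤ 1 / 4)
    (hδΔ : 2 * δ ≤ Δ) (hA : 64 / δ ≤ A) (hA' : 2 * δ / (1 - q) ≤ A) :
    ∃ (c w : ℕ → ℝ) (N : ℕ), IsStripSystem lam c w δ ∧ stripSet lam c w ⊆ rateSet lam a b ∧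
      (∀ n ≥ N, a (n + 1) ≤ stripLower lam c (n + 1)) ∧
      (∀ n ≥ N, stripUpper lam c w (n + 1) ≤ b (n + 1)) ∧
      ∀ n ≥ N, w n = min (modulus a b (n + 1)) ((1 - q) * a n) := by
  obtain ⟨N, hN⟩ := eventually_atTop.1
    ((h.eventually_lt_a.and h.admissible).and (eventually_ge_atTop 1))
  let l : ℕ → ℝ := fun n => Real.log (a (n + 1) / ‖lam (n + 1)‖)
  -- The strip starts where the image modulus reaches `a (n + 1)`, but not left of `-a n`. The first
  -- half of (a) gives `c₀ n ≤ q * a n`, so width `(1 - q) * a n` ends at most at `a n`. If the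
  -- strip starts at `-a n`, it ends at most at `-(q * a n)`, where the second half of (a) applies.
  let c₀ : ℕ → ℝ := fun n => max (l n) (-a n)
  let w₀ : ℕ → ℝ := fun n => min (modulus a b (n + 1)) ((1 - q) * a n)
  have hlam : ∀ n, 0 < ‖lam (n + 1)‖ := fun n => norm_pos_iff.2 (h.lam_succ_ne_zero n)
  have ha : ∀ n, 0 < a (n + 1) := h.a_succ_pos
  have ha0 : ∀ n ≥ N, 0 < a n := fun n hn => h.a_pos n (hN n hn).2
  have hexpl : ∀ n, ‖lam (n + 1)‖ * Real.exp (l n) = a (n + 1) := by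
    intro n
    simp only [l]
    rw [Real.exp_log (div_pos (ha n) (hlam n))]
    have := (hlam n).ne'
    field_simp
  have hexpc : ∀ n, a (n + 1) ≤ ‖lam (n + 1)‖ * Real.exp (c₀ n) := by
    intro n
    rw [← hexpl n]
    gcongr
    exact le_max_left _ _
  have hl : ∀ n ≥ N, l n ≤ q * a n := by
    intro n hn
    have h1 := (hN n hn).1.2.1
    simp only [l]
    rw [Real.log_le_iff_le_exp (div_pos (ha n) (hlam n)), div_le_iff₀ (hlam n), mul_comm]
    exact h1
  have hcw : ∀ n ≥ N, c₀ n + w₀ n ≤ a n := by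
    intro n hn
    have h1 : w₀ n ≤ (1 - q) * a n := min_le_right _ _
    have h2 : c₀ n ≤ q * a n := max_le (hl n hn) (by nlinarith [ha0 n hn])
    linarith
  have hexpcw : ∀ n ≥ N, ‖lam (n + 1)‖ * Real.exp (c₀ n + w₀ n) ≤ b (n + 1) := by
    intro n hn
    rcases max_choice (l n) (-a n) with hc | hc
    · have h1 : w₀ n ≤ modulus a b (n + 1) := min_le_left _ _
      calc ‖lam (n + 1)‖ * Real.exp (c₀ n + w₀ n)
          ≤ ‖lam (n + 1)‖ * Real.exp (l n + modulus a b (n + 1)) := by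
            have : c₀ n = l n := hc
            rw [this]
            gcongr
        _ = a (n + 1) * (b (n + 1) / a (n + 1)) := by
            rw [Real.exp_add, ← mul_assoc, hexpl, modulus,
              Real.exp_log (div_pos (h.b_succ_pos n) (ha n))]
        _ = b (n + 1) := by have := (ha n).ne'; field_simp
    · have h1 : w₀ n ≤ (1 - q) * a n := min_le_right _ _
      refine le_trans ?_ (hN n hn).1.2.2
      have : c₀ n = -a n := hc
      rw [this]
      gcongr
      linarith
  have key : ∃ c w, IsStripSystem lam c w δ ∧ ∀ n ≥ N, c n = c₀ n ∧ w n = w₀ n := by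
    apply exists_isStripSystem_of_tail hδ hδ1 h.lam_succ_ne_zero N c₀ w₀
    · intro n hn
      refine le_min (hδΔ.trans (h.modulus_succ_gt n).le) ?_
      have h1 := hA'.trans (hN n hn).1.1.le
      rw [div_le_iff₀ (by linarith)] at h1
      linarith
    · intro n hn
      exact (hA.trans (hN (n + 1) (by omega)).1.1.le).trans (hexpc n)
    · intro n hn
      have h1 : -a (n + 1) ≤ c₀ (n + 1) := le_max_right _ _
      linarith [hexpc n]
    · intro n hn
      exact (hcw (n + 1) (by omega)).trans (hexpc n)
  obtain ⟨c, w, hsys, heq⟩ := key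
  have hlow : ∀ n ≥ N, a (n + 1) ≤ ‖lam (n + 1)‖ * Real.exp (c n) := fun n hn => by
    rw [(heq n hn).1]; exact hexpc n
  have hupp : ∀ n ≥ N, ‖lam (n + 1)‖ * Real.exp (c n + w n) ≤ b (n + 1) := fun n hn => by
    rw [(heq n hn).1, (heq n hn).2]; exact hexpcw n hn
  refine ⟨c, w, N, hsys, fun z hz => ?_, hlow, hupp, fun n hn => (heq n hn).2⟩
  refine eventually_atTop.2 ⟨N + 1, fun n hn => ?_⟩
  obtain ⟨k, rfl⟩ : ∃ k, n = k + 1 := ⟨n - 1, by omega⟩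
  rw [norm_iter_succ]
  constructor
  · refine (hlow k (by omega)).trans ?_
    gcongr
    exact (hz k).1
  · refine le_trans ?_ (hupp k (by omega))
    gcongr
    exact (hz k).2

theorem one_le_dimH_dimP (hq0 : 0 < q) (hq1 : q < 1) {δ : ℝ} (hδ : 0 < δ) (hδ1 : δ ≤ 1 / 4)
    (hδΔ : 2 * δ ≤ Δ) (hA : 64 / δ ≤ A) (hA' : 2 * δ / (1 - q) ≤ A) :
    1 ≤ dimH (rateSet lam a b) ∧ 1 ≤ dimP (rateSet lam a b) := by
  obtain ⟨c, w, N, hsys, hsub, hlow, -, -⟩ := h.exists_isStripSystem hq0 hq1 hδ hδ1 hδΔ hA hA'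
  have hL := tendsto_logProd_div_of_le (fun n _ => h.a_succ_pos n) hlow h.tendsto_logProd_div
  exact ⟨(hsys.one_le_dimH hL).trans (dimH_mono hsub), (hsys.one_le_dimP hL).trans (dimP_mono hsub)⟩

theorem le_dimP_of_frequently (hq0 : 0 < q) (hq1 : q < 1) {δ : ℝ} (hδ : 0 < δ) (hδ1 : δ ≤ 1 / 4)
    (hδΔ : 2 * δ ≤ Δ) (hA : 64 / δ ≤ A) (hA' : 2 * δ / (1 - q) ≤ A) {M : ℝ}
    (hM : ∀ n, 1 ≤ n → modulus a b (n + 1) / a n ≤ M) {σ : ℝ} (hσ : 0 ≤ σ)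
    (hfreq : ∃ᶠ n in atTop, σ * logProd b n ≤ logProd (modulus a b) (n + 1)) :
    ENNReal.ofReal (1 + σ) ≤ dimP (rateSet lam a b) := by
  obtain ⟨c, w, N, hsys, hsub, hlow, hupp, hw⟩ := h.exists_isStripSystem hq0 hq1 hδ hδ1 hδΔ hA hA'
  have hL := tendsto_logProd_div_of_le (fun n _ => h.a_succ_pos n) hlow h.tendsto_logProd_div
  have hΔ : 0 < Δ := by linarith
  have hmod := h.modulus_succ_pos hΔ
  -- As the moduli are at most `M * a n`, each width in the tail is at least `κ` times the modulus.
  set κ : ℝ := min 1 ((1 - q) / max M 1)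
  have hM1 : 0 < max M 1 := by positivity
  have hκ : 0 < κ := lt_min one_pos (div_pos (by linarith) hM1)
  have hκ1 : κ ≤ 1 := min_le_left _ _
  have hUpos : ∀ n, 0 < stripUpper lam c w (n + 1) := fun n =>
    mul_pos (norm_pos_iff.2 (h.lam_succ_ne_zero n)) (Real.exp_pos _)
  have hwpos : ∀ n, 0 < w n := fun n => by linarith [hsys.two_mul_le n]
  obtain ⟨C₁, -, hC₁⟩ := logProd_le_add_const (fun n _ => hUpos n) hupp
  obtain ⟨C₂, -, hC₂⟩ := logProd_le_add_const (a := fun n => κ * modulus a b (n + 1)) (α := w)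
    (N := N) (fun n _ => mul_pos hκ (hmod (n + 1))) (fun n hn => by
      rw [hw (n + 1) (by omega)]
      have h1 := hM (n + 1) (by omega)
      rw [div_le_iff₀ (h.a_succ_pos n)] at h1
      refine le_min (mul_le_of_le_one_left (hmod (n + 1)).le hκ1) ?_
      calc κ * modulus a b (n + 1 + 1)
          ≤ (1 - q) / max M 1 * modulus a b (n + 1 + 1) := by
            have := hmod (n + 1)
            gcongr
            exact min_le_right _ _
        _ ≤ (1 - q) / max M 1 * (max M 1 * a (n + 1)) := by
            have : 0 ≤ (1 - q) / max M 1 := div_nonneg (by linarith) hM1.le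
            have := h.a_succ_pos n
            gcongr
            exact h1.trans (by gcongr; exact le_max_left _ _)
        _ = _ := by field_simp)
  have hlogκ : Real.log κ ≤ 0 := Real.log_nonpos hκ.le hκ1
  have hlog2 : 0 ≤ σ * Real.log 2 := mul_nonneg hσ (Real.log_nonneg (by norm_num))
  -- `C₁` and `C₂` account for the initial strips. The widths `w 1, …, w n` correspond to the moduli
  -- of index `2, …, n + 1`, so the first modulus goes into `K₀`; `E` collects the factors `2 ^ σ`
  -- and `κ⁻¹`.
  refine (hsys.le_dimP hL (K₀ := Real.exp (σ * C₁ + C₂ + Real.log (modulus a b 1)))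
    (E := Real.exp (σ * Real.log 2 - Real.log κ)) (Real.exp_pos _) (Real.one_le_exp (by linarith))
    ?_).trans (dimP_mono hsub)
  refine (hfreq.and_eventually (eventually_ge_atTop N)).mono ?_
  rintro n ⟨hn, hnN⟩
  have h1 := hC₁ n hnN
  have h2 := hC₂ n hnN
  have h3 : logProd (fun n => κ * modulus a b (n + 1)) n =
      n * Real.log κ + logProd (modulus a b) (n + 1) - Real.log (modulus a b 1) := by
    rw [logProd, logProd, Finset.sum_range_succ']
    rw [Finset.sum_congr rfl fun k _ => Real.log_mul hκ.ne' (hmod (k + 1)).ne',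
      Finset.sum_add_distrib]
    simp only [Finset.sum_const, Finset.card_range, nsmul_eq_mul, zero_add]
    ring
  rw [← exp_logProd hUpos, ← exp_logProd fun n => hwpos (n + 1), ← Real.exp_nat_mul,
    ← Real.exp_add, ← Real.exp_add, ← Real.exp_log (show (0 : ℝ) < 2 ^ n by positivity),
    ← Real.exp_add, ← Real.exp_mul, Real.log_pow]
  refine Real.exp_le_exp.2 ?_
  have h4 := mul_le_mul_of_nonneg_left h1 hσ
  rw [h3] at h2
  nlinarith

end Assumptions

end Construction

/-! ### Passage between real exponents and extended real limits. -/

section ExtendedReal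

theorem coe_le_one_add_of_forall {d : ℝ≥0∞} {l : EReal} (hl : 0 ≤ l)
    (h : ∀ t : ℝ, 0 < t → l < t → d ≤ ENNReal.ofReal (1 + t)) : (d : EReal) ≤ 1 + l := by
  refine EReal.le_of_forall_lt_iff_le.1 fun z hz => ?_
  have hlz : l < ((z - 1 : ℝ) : EReal) := by
    induction l with
    | bot => exact EReal.bot_lt_coe _
    | top =>
      have h1 : (1 : EReal) + ⊤ = ⊤ := EReal.add_top_of_ne_bot (EReal.coe_ne_bot 1)
      rw [h1] at hz
      exact absurd hz not_top_lt
    | coe x =>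
      have : 1 + x < z := by exact_mod_cast hz
      exact EReal.coe_lt_coe_iff.2 (by linarith)
  have hz0 : 0 < z - 1 := EReal.coe_pos.1 (hl.trans_lt hlz)
  have h1 := EReal.coe_ennreal_le_coe_ennreal_iff.2 (h (z - 1) hz0 hlz)
  rwa [EReal.coe_ennreal_ofReal, add_sub_cancel, max_eq_left (by linarith)] at h1

theorem one_add_le_coe_of_forall {d : ℝ≥0∞} {l : EReal} (hd : 1 ≤ d)
    (h : ∀ s : ℝ, 0 ≤ s → s < l → ENNReal.ofReal (1 + s) ≤ d) : 1 + l ≤ (d : EReal) := by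
  refine EReal.ge_of_forall_gt_iff_ge.1 fun z hz => ?_
  rcases le_total z 1 with hz1 | hz1
  · exact (EReal.coe_le_coe_iff.2 hz1).trans
      (by rw [EReal.coe_one, ← EReal.coe_ennreal_one]; exact EReal.coe_ennreal_le_coe_ennreal_iff.2 hd)
  · have hlz : ((z - 1 : ℝ) : EReal) < l := by
      induction l with
      | bot => simp at hz
      | top => exact EReal.coe_lt_top _
      | coe x =>
        have : z < 1 + x := by exact_mod_cast hz
        exact EReal.coe_lt_coe_iff.2 (by linarith)
    have h1 := EReal.coe_ennreal_le_coe_ennreal_iff.2 (h (z - 1) (by linarith) hlz)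
    rwa [EReal.coe_ennreal_ofReal, add_sub_cancel, max_eq_left (by linarith)] at h1

theorem zero_le_liminf_coe {u : ℕ → ℝ} (h : ∀ z < 0, ∀ᶠ n in atTop, z ≤ u n) :
    0 ≤ liminf (fun n => (u n : EReal)) atTop := by
  refine EReal.ge_of_forall_gt_iff_ge.1 fun z hz => le_liminf_of_le ?_ ?_
  · isBoundedDefault
  · exact (h z (by exact_mod_cast hz)).mono fun n hn => EReal.coe_le_coe_iff.2 hn

theorem frequently_lt_of_liminf_coe_lt {u : ℕ → ℝ} {t : ℝ}
    (h : liminf (fun n => (u n : EReal)) atTop < t) : ∃ᶠ n in atTop, u n < t :=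
  (frequently_lt_of_liminf_lt (by isBoundedDefault) h).mono fun _ hn => EReal.coe_lt_coe_iff.1 hn

theorem eventually_lt_of_limsup_coe_lt {u : ℕ → ℝ} {t : ℝ}
    (h : limsup (fun n => (u n : EReal)) atTop < t) : ∀ᶠ n in atTop, u n < t :=
  (eventually_lt_of_limsup_lt h).mono fun _ hn => EReal.coe_lt_coe_iff.1 hn

theorem frequently_lt_of_lt_limsup_coe {u : ℕ → ℝ} {t : ℝ}
    (h : t < limsup (fun n => (u n : EReal)) atTop) : ∃ᶠ n in atTop, t < u n :=
  (frequently_lt_of_lt_limsup (by isBoundedDefault) h).mono fun _ hn => EReal.coe_lt_coe_iff.1 hn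

theorem exists_nonneg_real_btwn {l : EReal} {t : ℝ} (ht : 0 < t) (hlt : l < t) :
    ∃ τ : ℝ, 0 ≤ τ ∧ τ < t ∧ l < τ := by
  obtain ⟨τ, h1, h2⟩ := EReal.lt_iff_exists_real_btwn.1 hlt
  exact ⟨max τ 0, le_max_right _ _, max_lt (EReal.coe_lt_coe_iff.1 h2) ht,
    h1.trans_le (EReal.coe_le_coe_iff.2 (le_max_left _ _))⟩

end ExtendedReal

/-! ### The dimension estimates in limit form. -/

namespace Assumptions

variable {q Δ A : ℝ} {lam : ℕ → ℂ} {a b : ℕ → ℝ}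

theorem eventually_logProd_pos (h : Assumptions q Δ A lam a b) :
    ∀ᶠ n in atTop, 0 < logProd a n := by
  filter_upwards [h.eventually_logProd_ge 1, eventually_gt_atTop 0] with n hn hn0
  have : (0 : ℝ) < n := by exact_mod_cast hn0
  linarith

theorem logProd_le_logProd (h : Assumptions q Δ A lam a b) (n : ℕ) :
    logProd a n ≤ logProd b n :=
  Finset.sum_le_sum fun k _ => Real.log_le_log (h.a_succ_pos k) (h.a_lt_b (k + 1) (by omega)).le

/-- At each index where the quotient is small there is a dichotomy: either the next modulus is at
most the radius, and squares of its size work, or the `posLog` term vanishes and the quotient bounds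
the product of the moduli. -/
theorem coe_dimH_rateSet_le (h : Assumptions q Δ A lam a b) (hA : 1 ≤ A) (hΔ : 0 < Δ) :
    (dimH (rateSet lam a b) : EReal) ≤ 1 + liminf (fun n : ℕ =>
      ((Real.log (∏ i ∈ Finset.Icc 1 n, modulus a b i) /
        (Real.log (∏ i ∈ Finset.Ico 1 n, a i) +
          Real.posLog (a n / modulus a b (n + 1))) : ℝ) : EReal)) atTop := by
  have hmod := h.modulus_succ_pos hΔ
  rw [← Filter.liminf_nat_add _ 1]
  simp only [log_prod_Icc_one hmod, log_prod_Ico_one h.a_succ_pos]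
  refine coe_le_one_add_of_forall (zero_le_liminf_coe fun z hz => ?_) fun t ht0 ht => ?_
  · filter_upwards [h.eventually_mul_logProd_le hΔ hz, h.eventually_logProd_pos] with n hn hpos
    have hp : 0 ≤ Real.posLog (a (n + 1) / modulus a b (n + 1 + 1)) := Real.posLog_nonneg
    rw [le_div_iff₀ (by linarith)]
    nlinarith
  · obtain ⟨τ, hτ0, hτt, hτ⟩ := exists_nonneg_real_btwn ht0 ht
    refine h.dimH_rateSet_le hA hΔ ht0 hτ0 hτt le_rfl ?_
    refine ((frequently_lt_of_liminf_coe_lt hτ).and_eventually h.eventually_logProd_pos).mono ?_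
    rintro n ⟨hn, hpos⟩
    rcases le_or_gt (modulus a b (n + 2)) (1 * a (n + 1)) with h1 | h1
    · exact Or.inl h1
    · right
      rw [one_mul] at h1
      have h2 : Real.posLog (a (n + 1) / modulus a b (n + 1 + 1)) = 0 := by
        rw [Real.posLog_eq_zero_iff, abs_of_pos (div_pos (h.a_succ_pos n) (hmod (n + 1)))]
        exact (div_le_one (hmod (n + 1))).2 h1.le
      rw [h2, add_zero, div_lt_iff₀ hpos] at hn
      exact hn.le

theorem coe_dimP_rateSet_le (h : Assumptions q Δ A lam a b) (hA : 1 ≤ A) (hΔ : 0 < Δ) :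
    (dimP (rateSet lam a b) : EReal) ≤ 1 + limsup (fun n : ℕ =>
      ((Real.log (∏ i ∈ Finset.Icc 1 (n + 1), modulus a b i) /
        Real.log (∏ i ∈ Finset.Icc 1 n, a i) : ℝ) : EReal)) atTop := by
  simp only [log_prod_Icc_one (h.modulus_succ_pos hΔ), log_prod_Icc_one h.a_succ_pos]
  refine coe_le_one_add_of_forall
    ((zero_le_liminf_coe fun z hz => ?_).trans liminf_le_limsup) fun t ht0 ht => ?_
  · filter_upwards [h.eventually_mul_logProd_le hΔ hz, h.eventually_logProd_pos] with n hn hpos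
    rwa [le_div_iff₀ hpos]
  · obtain ⟨τ, hτ0, hτt, hτ⟩ := exists_nonneg_real_btwn ht0 ht
    refine h.dimP_rateSet_le hA hΔ ht0 hτ0 hτt ?_
    filter_upwards [eventually_lt_of_limsup_coe_lt hτ, h.eventually_logProd_pos] with n hn hpos
    exact ((div_lt_iff₀ hpos).1 hn).le

/-- The first alternative now holds at every level, with `D = max M 1`, for every positive `t`. -/
theorem dimH_rateSet_le_one (h : Assumptions q Δ A lam a b) (hA : 1 ≤ A) (hΔ : 0 < Δ) {M : ℝ}
    (hM : ∀ n, 1 ≤ n → modulus a b (n + 1) / a n ≤ M) : dimH (rateSet lam a b) ≤ 1 := by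
  rw [← EReal.coe_ennreal_le_coe_ennreal_iff, ← add_zero ((1 : ℝ≥0∞) : EReal)]
  refine coe_le_one_add_of_forall le_rfl fun t ht0 _ => ?_
  refine h.dimH_rateSet_le hA hΔ ht0 le_rfl ht0 (le_max_right M 1) (Frequently.of_forall fun n => ?_)
  have ha := h.a_succ_pos n
  have h1 := (div_le_iff₀ ha).1 (hM (n + 1) (by omega))
  exact Or.inl (h1.trans (by gcongr; exact le_max_left _ _))

theorem one_add_limsup_le_dimP (h : Assumptions q Δ A lam a b) (hq0 : 0 < q) (hq1 : q < 1)
    {δ : ℝ} (hδ : 0 < δ) (hδ1 : δ ≤ 1 / 4) (hδΔ : 2 * δ ≤ Δ) (hA : 64 / δ ≤ A)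
    (hA' : 2 * δ / (1 - q) ≤ A) {M : ℝ} (hM : ∀ n, 1 ≤ n → modulus a b (n + 1) / a n ≤ M) :
    1 + limsup (fun n : ℕ => ((Real.log (∏ i ∈ Finset.Icc 1 (n + 1), modulus a b i) /
      Real.log (∏ i ∈ Finset.Icc 1 n, b i) : ℝ) : EReal)) atTop ≤ (dimP (rateSet lam a b) : EReal) := by
  simp only [log_prod_Icc_one (h.modulus_succ_pos (by linarith)), log_prod_Icc_one h.b_succ_pos]
  refine one_add_le_coe_of_forall (h.one_le_dimH_dimP hq0 hq1 hδ hδ1 hδΔ hA hA').2 fun σ hσ0 hσ => ?_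
  refine h.le_dimP_of_frequently hq0 hq1 hδ hδ1 hδΔ hA hA' hM hσ0 ?_
  refine ((frequently_lt_of_lt_limsup_coe hσ).and_eventually h.eventually_logProd_pos).mono ?_
  rintro n ⟨hn, hpos⟩
  exact ((lt_div_iff₀ (hpos.trans_le (h.logProd_le_logProd n))).1 hn).le

end Assumptions

end ExpIter

theorem corollary2p3 (q Δ : ℝ) (hq0 : 0 < q) (hq1 : q < 1) (hΔ : 0 < Δ) :
    ∃ A : ℝ, ∀ (lam : ℕ → ℂ) (a b : ℕ → ℝ), ExpIter.Assumptions q Δ A lam a b →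
      (1 ≤ dimH (ExpIter.rateSet lam a b) ∧
        (dimH (ExpIter.rateSet lam a b) : EReal) ≤
          1 + liminf (fun n : ℕ =>
            ((Real.log (∏ i ∈ Finset.Icc 1 n, ExpIter.modulus a b i) /
              (Real.log (∏ i ∈ Finset.Ico 1 n, a i) +
                Real.posLog (a n / ExpIter.modulus a b (n + 1))) : ℝ) : EReal)) atTop) ∧
      (1 ≤ ExpIter.dimP (ExpIter.rateSet lam a b) ∧
        (ExpIter.dimP (ExpIter.rateSet lam a b) : EReal) ≤
          1 + limsup (fun n : ℕ =>
            ((Real.log (∏ i ∈ Finset.Icc 1 (n + 1), ExpIter.modulus a b i) /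
              Real.log (∏ i ∈ Finset.Icc 1 n, a i) : ℝ) : EReal)) atTop) ∧
      ((∃ M : ℝ, ∀ n, 1 ≤ n → ExpIter.modulus a b (n + 1) / a n ≤ M) →
        dimH (ExpIter.rateSet lam a b) = 1 ∧
        1 + limsup (fun n : ℕ =>
            ((Real.log (∏ i ∈ Finset.Icc 1 (n + 1), ExpIter.modulus a b i) /
              Real.log (∏ i ∈ Finset.Icc 1 n, b i) : ℝ) : EReal)) atTop ≤
          (ExpIter.dimP (ExpIter.rateSet lam a b) : EReal)) := by
  -- The box width: at most half of every modulus so that a column fits, and at most 1/4 for the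
  -- distortion estimates.
  set δ : ℝ := min (Δ / 2) (1 / 4)
  have hδ : 0 < δ := by positivity
  have hδ1 : δ ≤ 1 / 4 := min_le_right _ _
  have hδΔ : 2 * δ ≤ Δ := by linarith [min_le_left (Δ / 2) (1 / 4)]
  -- The bound 1 serves the truncation, `64 / δ` gives each image at least one row of boxes, and `2
  -- * δ / (1 - q)` makes `(1 - q) * a n` at least `2 * δ`.
  refine ⟨max 1 (max (64 / δ) (2 * δ / (1 - q))), fun lam a b h => ?_⟩
  set A : ℝ := max 1 (max (64 / δ) (2 * δ / (1 - q)))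
  have hA1 : 1 ≤ A := le_max_left _ _
  have hA : 64 / δ ≤ A := (le_max_left _ _).trans (le_max_right _ _)
  have hA' : 2 * δ / (1 - q) ≤ A := (le_max_right _ _).trans (le_max_right _ _)
  obtain ⟨hH, hP⟩ := h.one_le_dimH_dimP hq0 hq1 hδ hδ1 hδΔ hA hA'
  refine ⟨⟨hH, h.coe_dimH_rateSet_le hA1 hΔ⟩, ⟨hP, h.coe_dimP_rateSet_le hA1 hΔ⟩, ?_⟩
  rintro ⟨M, hM⟩
  exact ⟨(h.dimH_rateSet_le_one hA1 hΔ hM).antisymm hH,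
    h.one_add_limsup_le_dimP hq0 hq1 hδ hδ1 hδΔ hA hA' hM⟩
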